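/- **Setting.** Let $\mathbf\Sigma\in\mathbb R^{m\times n}$ have rank $d\ge1$, with singular value decomposition $\mathbf\Sigma=\Phi\mathbf\Sigma'\Psi^\top$, where $\Phi\in\mathbb R^{m\times m}$, $\Psi\in\mathbb R^{n\times n}$ are orthogonal and the only nonzero entries of $\mathbf\Sigma'$ are $\mathbf\Sigma'_{ii}=\sigma_i$ $(i\le d)$, $\sigma_1\ge\dots\ge\sigma_d>0$. Put $\Sigma=\mathrm{diag}(\sigma_1,\dots,\sigma_d)$, $\kappa=\sigma_1/\sigma_d$, $m'=m-d$, $n'=n-d$. Given $\mathbf U_0\in\mathbb R^{m\times d}$, $\mathbf V_0\in\mathbb R^{n\times d}$ and $\eta>0$, gradient descent for $\frac12\|\mathbf U\mathbf V^\top-\mathbf\Sigma\|_F^2$ is $$\mathbf U_{t+1}=\mathbf U_t+\eta(\mathbf\Sigma-\mathbf U_t\mathbf V_t^\top)\mathbf V_t,\qquad \mathbf V_{t+1}=\mathbf V_t+\eta(\mathbf\Sigma-\mathbf U_t\mathbf V_t^\top)^\top\mathbf U_t .$$ Let $U_t$ and $J_t$ be the upper $d\times d$ and the lower $m'\times d$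 block of $\Phi^{-1}\mathbf U_t$, let $V_t$ and $K_t$ be the upper $d\times d$ and the lower $n'\times d$ block of $\Psi^{-1}\mathbf V_t$, and set $$A_t=\tfrac{U_t+V_t}2,\qquad B_t=\tfrac{U_t-V_t}2,\qquad P_t=\Sigma-A_tA_t^\top+B_tB_t^\top .$$ Here $\sigma_i(\cdot)$ is the $i$-th largest singular value and $\preceq$ the Loewner order. For $c,\varepsilon>0$ say that the initialization is *$(c,\varepsilon)$-bounded* if $\sigma_d(A_0)\ge\frac{\varepsilon}{c\sqrt d}$, $\sigma_1(A_0)\le c\sqrt d\,\varepsilon$, $\|B_0\|_F\le cd\varepsilon$, $\|J_0\|_{op}\le c\varepsilon\sqrt{\max\{m',d\}}$ and $\|K_0\|_{op}\le c\varepsilon\sqrt{\max\{n',d\}}$. **Theorem (warm-up stage).** (a) There is an integer $p\ge0$ such that for every $c>0$ there are $k_1,k_2,C>0$, depending only on $c$, with the following property. For all $m,n,d,\mathbf\Sigma,\Phi,\Psi$ as above and all $\varepsilon,\eta$ with $$0<\varepsilon\le\frac{k_1}{(1+\ln((m+n)\kappa))^p}\cdot\frac{\sigma_d}{\sqrt{d^3\sigma_1}\,(m+n)},\qquad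 0<\eta\le k_2\frac{\sigma_d\varepsilon^2}{d\sigma_1^3},$$ there is $T_0\in\mathbb N$ with $T_0\le\frac{C}{\eta\sigma_d}\ln\frac{d\sigma_d}{\varepsilon^2}$ such that, for every $(c,\varepsilon)$-bounded initialization and all $t\le T_0$, - $\frac{\varepsilon^2}{c^2d}I\preceq A_tA_t^\top\preceq2\Sigma$; - $\|B_t\|_F\le2cd\varepsilon$; - $\|J_t\|_{op}\le c\varepsilon\sqrt{\max\{m',d\}}$ and $\|K_t\|_{op}\le c\varepsilon\sqrt{\max\{n',d\}}$, and moreover $\sigma_d(A_{T_0})\ge\sqrt{\sigma_d/2}$ and $\sigma_1(P_{T_0})\le\sigma_d/4$. (b) For every $\delta>0$ there is $c>0$, depending only on $\delta$, such that for all $m,n\ge d\ge1$, all orthogonal $\Phi,\Psi$ and all $\varepsilon>0$, if the entries of $\mathbf U_0$ and $\mathbf V_0$ are independent Gaussians with mean $0$ and variance $\varepsilon^2$, then the initialization is $(c,\varepsilon)$-bounded with probability at least $1-\delta$. Hence the conclusions of (a) hold with probability at least $1-\delta$ for this $c$. -/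

import Mathlib

open MeasureTheory ProbabilityTheory

noncomputable section

namespace LowRankGD

/-- The operator norm of a real matrix (for the Euclidean norms). -/
def opNorm {a b : ℕ} (M : Matrix (Fin a) (Fin b) ℝ) : ℝ :=
  ‖LinearMap.toContinuousLinearMap (Matrix.toEuclideanLin M)‖

/-- The Frobenius norm of a real matrix. -/
def frobNorm {a b : ℕ} (M : Matrix (Fin a) (Fin b) ℝ) : ℝ :=
  Real.sqrt (∑ i, ∑ j, M i j ^ 2)

/-- The `i`-th largest singular value of a real matrix, counted from `i = 1`. -/
def singVal {a b : ℕ} (i : ℕ) (M : Matrix (Fin a) (Fin b) ℝ) : ℝ :=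
  (Matrix.toEuclideanLin M).singularValues (i - 1)

/-- The Loewner order `M ≼ N`: the matrix `N - M` is (symmetric) positive semidefinite. -/
def Loewner {d : ℕ} (M N : Matrix (Fin d) (Fin d) ℝ) : Prop :=
  (N - M).PosSemidef

/-- The `(d + m') × (d + n')` matrix with upper left block `diag σ` and zeros elsewhere. -/
def rectDiag {d : ℕ} (m' n' : ℕ) (σ : Fin d → ℝ) :
    Matrix (Fin (d + m')) (Fin (d + n')) ℝ :=
  Matrix.reindex finSumFinEquiv finSumFinEquiv
    (Matrix.fromBlocks (Matrix.diagonal σ) 0 0 0)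

/-- `S = Φ Σ' Ψᵀ` is a singular value decomposition of the matrix `S` of rank `d`, with
positive singular values `σ 0 ≥ ⋯ ≥ σ (d - 1)`. -/
structure IsSVD {d m' n' : ℕ} (S : Matrix (Fin (d + m')) (Fin (d + n')) ℝ) (σ : Fin d → ℝ)
    (Φ : Matrix (Fin (d + m')) (Fin (d + m')) ℝ)
    (Ψ : Matrix (Fin (d + n')) (Fin (d + n')) ℝ) : Prop where
  antitone : Antitone σ
  pos : ∀ i, 0 < σ i
  left_mem : Φ ∈ Matrix.orthogonalGroup (Fin (d + m')) ℝ
  right_mem : Ψ ∈ Matrix.orthogonalGroup (Fin (d + n')) ℝ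
  eq : S = Φ * rectDiag m' n' σ * Ψ.transpose

/-- Gradient descent with step size `η` for `(U, V) ↦ ‖U Vᵀ - S‖_F² / 2`, started at
`(U₀, V₀)`. -/
def gd {m n d : ℕ} (S : Matrix (Fin m) (Fin n) ℝ) (η : ℝ)
    (U₀ : Matrix (Fin m) (Fin d) ℝ) (V₀ : Matrix (Fin n) (Fin d) ℝ) :
    ℕ → Matrix (Fin m) (Fin d) ℝ × Matrix (Fin n) (Fin d) ℝ
  | 0 => (U₀, V₀)
  | t + 1 =>
    let U := (gd S η U₀ V₀ t).1
    let V := (gd S η U₀ V₀ t).2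
    (U + η • ((S - U * V.transpose) * V),
     V + η • ((S - U * V.transpose).transpose * U))

/-- The upper `d × d` block. -/
def upper {d k : ℕ} (M : Matrix (Fin (d + k)) (Fin d) ℝ) : Matrix (Fin d) (Fin d) ℝ :=
  M.submatrix (Fin.castAdd k) id

/-- The lower `k × d` block. -/
def lower {d k : ℕ} (M : Matrix (Fin (d + k)) (Fin d) ℝ) : Matrix (Fin k) (Fin d) ℝ :=
  M.submatrix (Fin.natAdd d) id

/-- `A = (U + V) / 2`, where `U`, `V` are the upper blocks of the two factors. -/
def symA {d m' n' : ℕ} (X : Matrix (Fin (d + m')) (Fin d) ℝ)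
    (Y : Matrix (Fin (d + n')) (Fin d) ℝ) : Matrix (Fin d) (Fin d) ℝ :=
  (1 / 2 : ℝ) • (upper X + upper Y)

/-- `B = (U - V) / 2`, where `U`, `V` are the upper blocks of the two factors. -/
def asymB {d m' n' : ℕ} (X : Matrix (Fin (d + m')) (Fin d) ℝ)
    (Y : Matrix (Fin (d + n')) (Fin d) ℝ) : Matrix (Fin d) (Fin d) ℝ :=
  (1 / 2 : ℝ) • (upper X - upper Y)

/-- `P = Σ - A Aᵀ + B Bᵀ` with `Σ = diag σ`. -/
def errP {d m' n' : ℕ} (σ : Fin d → ℝ) (X : Matrix (Fin (d + m')) (Fin d) ℝ)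
    (Y : Matrix (Fin (d + n')) (Fin d) ℝ) : Matrix (Fin d) (Fin d) ℝ :=
  Matrix.diagonal σ - symA X Y * (symA X Y).transpose + asymB X Y * (asymB X Y).transpose

/-- The bounds with constant `c` on an initialization at scale `ε`; here `X` and `Y` are the
two factors in the coordinates of the singular vectors. -/
structure InitBound {d m' n' : ℕ} (c ε : ℝ) (X : Matrix (Fin (d + m')) (Fin d) ℝ)
    (Y : Matrix (Fin (d + n')) (Fin d) ℝ) : Prop where
  le_A : ε / (c * √(d : ℝ)) ≤ singVal d (symA X Y)
  A_le : singVal 1 (symA X Y) ≤ c * √(d : ℝ) * ε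
  B_le : frobNorm (asymB X Y) ≤ c * d * ε
  J_le : opNorm (lower X) ≤ c * ε * √(max (m' : ℝ) d)
  K_le : opNorm (lower Y) ≤ c * ε * √(max (n' : ℝ) d)

/-- The law of a pair of matrices, of sizes `m × d` and `n × d`, all of whose entries are
independent centred Gaussians of variance `ε ^ 2`. -/
def gaussianInit (m n d : ℕ) (ε : ℝ) :
    Measure ((Fin m → Fin d → ℝ) × (Fin n → Fin d → ℝ)) :=
  (Measure.pi fun _ => Measure.pi fun _ => gaussianReal 0 (Real.toNNReal (ε ^ 2))).prod
    (Measure.pi fun _ => Measure.pi fun _ => gaussianReal 0 (Real.toNNReal (ε ^ 2)))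

end LowRankGD

end

/-! Part (a). In the coordinates of the singular vectors a gradient step reads `A ↦ (1 + ηR)A + ηE`
with `R = Σ - AAᵀ`, where `E` collects every term containing `B`, `J` or `K`. Put `N = m + n`, `L =
log(dσ_d/ε²)` and `θ = c²ε²dN`. As long as the bounds hold, `‖B‖²`, `‖J‖² + ‖K‖²` and `ησ₁²` are all
`O(θ)`, hence `‖E‖ = O(√σ₁ θ)`: up to a tiny error `A` follows gradient descent for a symmetric
factorization.

Four facts are propagated together for `17L/(ησ_d)` steps (`WarmState.step`). (i) `J` and `K` are
multiplied by contractions. (ii) `R` becomes `(1 - ηAAᵀ)R(1 - ηAAᵀ)` up to `O(ησ₁θ)`, so its lower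
bound deteriorates only linearly in time (`residual_lower_step`). (iii) The skew part `Q = ABᵀ -
BAᵀ` of the error satisfies `⟨B, QA⟩ = -‖Q‖²/2`, so `B` grows only through the tiny negative part of
`R`, terms of second order in `η`, and `J`, `K` (`frobInner_driftB_le`). Its norm at most doubles.
(iv) The least singular value of `A` grows by the factor `1 + ησ_d/4` until it reaches `√σ_d/2`
(`lower_bound_step`).

Growth from scale `ε` to `√σ_d/2` takes at most `⌈8L/(ησ_d)⌉` steps. From then on `AAᵀ ≽ σ_d/4`, so
`‖R‖` contracts by `1 - ησ_d/4` per step, and the same number of steps again brings it below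
`σ_d/16` (`residual_decay`). Both final claims follow, since `AAᵀ = Σ - R` and `P = R + BBᵀ`.

Part (b). Orthogonal invariance reduces to standard Gaussian blocks. Operator norms are bounded by a
net and an exponential moment (`gMat_norm_bound`). The least singular value of `U₀ + V₀` is handled
by freezing `V₀` as a deterministic shift and testing against an independent random direction, which
leads to the distance of one Gaussian row from the span of the others (`gMat_least_singVal`). -/

noncomputable section

namespace LowRankGD

open Matrix
open scoped Matrix.Norms.L2Operator ENNReal

/-! ### Euclidean operator norm and vector norm. -/

section OperatorNorm

variable {a b c d : ℕ}

theorem opNorm_eq_norm (M : Matrix (Fin a) (Fin b) ℝ) : opNorm M = ‖M‖ := rfl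

theorem norm_transpose_matrix (M : Matrix (Fin a) (Fin b) ℝ) : ‖Mᵀ‖ = ‖M‖ := by
  rw [← conjTranspose_eq_transpose_of_trivial, l2_opNorm_conjTranspose]

/-- The Euclidean norm of a coordinate vector. -/
def vnorm (v : Fin a → ℝ) : ℝ := ‖WithLp.toLp 2 v‖

theorem vnorm_nonneg (v : Fin a → ℝ) : 0 ≤ vnorm v := norm_nonneg _

theorem vnorm_sq (v : Fin a → ℝ) : vnorm v ^ 2 = v ⬝ᵥ v := by
  rw [vnorm, EuclideanSpace.real_norm_sq_eq]
  simp [dotProduct, sq]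

theorem vnorm_add_le (v w : Fin a → ℝ) : vnorm (v + w) ≤ vnorm v + vnorm w := by
  simpa [vnorm] using norm_add_le (WithLp.toLp 2 v) (WithLp.toLp 2 w)

theorem vnorm_smul (r : ℝ) (v : Fin a → ℝ) : vnorm (r • v) = |r| * vnorm v := by
  simp [vnorm, norm_smul]

theorem vnorm_zero : vnorm (0 : Fin a → ℝ) = 0 := by simp [vnorm]

theorem vnorm_eq_zero {v : Fin a → ℝ} : vnorm v = 0 ↔ v = 0 := by simp [vnorm]

theorem vnorm_neg (v : Fin a → ℝ) : vnorm (-v) = vnorm v := by simp [vnorm]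

theorem vnorm_sub_le (v w : Fin a → ℝ) : vnorm v - vnorm w ≤ vnorm (v + w) := by
  have := vnorm_add_le (v + w) (-w)
  rw [add_neg_cancel_right, vnorm_neg] at this
  linarith

theorem abs_dotProduct_le (v w : Fin a → ℝ) : |v ⬝ᵥ w| ≤ vnorm v * vnorm w := by
  have := abs_real_inner_le_norm (WithLp.toLp 2 v) (WithLp.toLp 2 w)
  rw [EuclideanSpace.inner_toLp_toLp] at this
  simpa [vnorm, dotProduct_comm] using this

theorem vnorm_mulVec_le (M : Matrix (Fin a) (Fin b) ℝ) (v : Fin b → ℝ) :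
    vnorm (M *ᵥ v) ≤ ‖M‖ * vnorm v :=
  l2_opNorm_mulVec M (WithLp.toLp 2 v)

theorem norm_le_of_vnorm {M : Matrix (Fin a) (Fin b) ℝ} {r : ℝ} (hr : 0 ≤ r)
    (h : ∀ v, vnorm (M *ᵥ v) ≤ r * vnorm v) : ‖M‖ ≤ r := by
  rw [← opNorm_eq_norm]
  exact ContinuousLinearMap.opNorm_le_bound _ hr fun x => h x.ofLp

theorem norm_mul_le_of_le {M : Matrix (Fin a) (Fin b) ℝ} {N : Matrix (Fin b) (Fin c) ℝ}
    {r s : ℝ} (hM : ‖M‖ ≤ r) (hN : ‖N‖ ≤ s) : ‖M * N‖ ≤ r * s :=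
  (l2_opNorm_mul M N).trans
    (mul_le_mul hM hN (norm_nonneg _) ((norm_nonneg _).trans hM))

theorem norm_self_mul_transpose (M : Matrix (Fin a) (Fin b) ℝ) : ‖M * Mᵀ‖ = ‖M‖ ^ 2 := by
  have := l2_opNorm_conjTranspose_mul_self Mᵀ
  rw [conjTranspose_eq_transpose_of_trivial, transpose_transpose, norm_transpose_matrix] at this
  rw [this, sq]

theorem norm_one_le : ‖(1 : Matrix (Fin a) (Fin a) ℝ)‖ ≤ 1 :=
  norm_le_of_vnorm zero_le_one fun v => by simp

end OperatorNorm

/-! ### Positive semidefinite inequalities. -/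

section Loewner

variable {d : ℕ}

theorem posSemidef_iff_real {M : Matrix (Fin d) (Fin d) ℝ} :
    M.PosSemidef ↔ Mᵀ = M ∧ ∀ v, 0 ≤ v ⬝ᵥ (M *ᵥ v) := by
  rw [posSemidef_iff_dotProduct_mulVec]
  simp [IsHermitian]

theorem posSemidef_conj {M : Matrix (Fin d) (Fin d) ℝ} (hM : M.PosSemidef)
    (B : Matrix (Fin d) (Fin d) ℝ) : (B * M * Bᵀ).PosSemidef := by
  simpa using hM.mul_mul_conjTranspose_same B

theorem posSemidef_self_mul_transpose {k : ℕ} (B : Matrix (Fin d) (Fin k) ℝ) :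
    (B * Bᵀ).PosSemidef := by
  simpa using posSemidef_self_mul_conjTranspose B

theorem posSemidef_transpose_mul_self {k : ℕ} (B : Matrix (Fin k) (Fin d) ℝ) :
    (Bᵀ * B).PosSemidef := by
  simpa using posSemidef_conjTranspose_mul_self B

theorem abs_quadratic_le (M : Matrix (Fin d) (Fin d) ℝ) (v : Fin d → ℝ) :
    |v ⬝ᵥ (M *ᵥ v)| ≤ ‖M‖ * vnorm v ^ 2 := by
  refine (abs_dotProduct_le _ _).trans ?_
  nlinarith [vnorm_mulVec_le M v, vnorm_nonneg v]

theorem posSemidef_smul_one_sub {M : Matrix (Fin d) (Fin d) ℝ} {r : ℝ} (hs : Mᵀ = M)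
    (h : ‖M‖ ≤ r) : (r • (1 : Matrix (Fin d) (Fin d) ℝ) - M).PosSemidef := by
  rw [posSemidef_iff_real]
  refine ⟨by simp [hs], fun v => ?_⟩
  have h1 := (abs_le.1 (abs_quadratic_le M v)).2
  rw [sub_mulVec, dotProduct_sub, smul_mulVec, one_mulVec, dotProduct_smul, ← vnorm_sq, smul_eq_mul]
  nlinarith [sq_nonneg (vnorm v)]

/-- A symmetric matrix between `-r` and `r` has norm at most `r`. -/
theorem norm_le_of_posSemidef {M : Matrix (Fin d) (Fin d) ℝ} {r : ℝ} (hr : 0 ≤ r)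
    (h1 : (r • (1 : Matrix (Fin d) (Fin d) ℝ) - M).PosSemidef)
    (h2 : (r • (1 : Matrix (Fin d) (Fin d) ℝ) + M).PosSemidef) : ‖M‖ ≤ r := by
  have hs : Mᵀ = M := by simpa using (posSemidef_iff_real.1 h2).1
  have q1 := (posSemidef_iff_real.1 h1).2
  have q2 := (posSemidef_iff_real.1 h2).2
  simp only [sub_mulVec, add_mulVec, dotProduct_sub, dotProduct_add, smul_mulVec, one_mulVec,
    dotProduct_smul, smul_eq_mul] at q1 q2
  -- Polarization: the two quadratic bounds are added at `u + v` and `u - v`. Afterwards `u` is the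
  -- multiple of `M v` that has the length of `v`.
  have key : ∀ u v : Fin d → ℝ, u ⬝ᵥ (M *ᵥ v) ≤ r * (vnorm u ^ 2 + vnorm v ^ 2) / 2 := by
    intro u v
    have e1 := q1 (u + v)
    have e2 := q2 (u - v)
    have e3 : v ⬝ᵥ (M *ᵥ u) = u ⬝ᵥ (M *ᵥ v) := by
      rw [dotProduct_mulVec, ← mulVec_transpose, hs, dotProduct_comm]
    simp only [mulVec_add, mulVec_sub, dotProduct_add, dotProduct_sub, add_dotProduct,
      sub_dotProduct, e3, dotProduct_comm v u] at e1 e2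
    rw [vnorm_sq, vnorm_sq]
    linarith
  refine norm_le_of_vnorm hr fun v => ?_
  rcases (vnorm_nonneg v).eq_or_lt with h0 | h0
  · rw [vnorm_eq_zero.1 h0.symm]; simp [vnorm_zero]
  rcases (vnorm_nonneg (M *ᵥ v)).eq_or_lt with h3 | h3
  · rw [← h3]; positivity
  have := key ((vnorm v / vnorm (M *ᵥ v)) • (M *ᵥ v)) v
  rw [smul_dotProduct, ← vnorm_sq, vnorm_smul, abs_of_nonneg (by positivity),
    div_mul_cancel₀ _ h3.ne', smul_eq_mul] at this
  have e : vnorm v / vnorm (M *ᵥ v) * vnorm (M *ᵥ v) ^ 2 = vnorm v * vnorm (M *ᵥ v) := by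
    field_simp
  rw [e] at this
  refine le_of_mul_le_mul_left ?_ h0
  linarith

/-- If `0 ≼ M ≼ r` then `M² ≼ r M`. -/
theorem posSemidef_mul_sub {M : Matrix (Fin d) (Fin d) ℝ} {r : ℝ} (hr : 0 < r)
    (h1 : M.PosSemidef) (h2 : (r • (1 : Matrix (Fin d) (Fin d) ℝ) - M).PosSemidef) :
    (r • M - M * M).PosSemidef := by
  have hs : Mᵀ = M := (posSemidef_iff_real.1 h1).1
  -- `r(rM - M²) = M(r - M)M + (r - M)M(r - M)`, a sum of two conjugates of positive matrices.
  have := ((posSemidef_conj h2 M).add (posSemidef_conj h1 (r • 1 - M))).smul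
    (inv_nonneg.2 hr.le)
  convert this using 1
  rw [eq_inv_smul_iff₀ hr.ne']
  simp only [transpose_sub, transpose_smul, transpose_one, hs, mul_sub, sub_mul, mul_smul_comm,
    smul_mul_assoc, mul_one, one_mul, smul_sub, smul_smul]
  abel_nf

/-- `s² ≼ A Aᵀ` in terms of vectors. -/
theorem posSemidef_mul_transpose_sub_iff {A : Matrix (Fin d) (Fin d) ℝ} {s : ℝ} (hs : 0 ≤ s) :
    (A * Aᵀ - s ^ 2 • (1 : Matrix (Fin d) (Fin d) ℝ)).PosSemidef ↔
      ∀ v, s * vnorm v ≤ vnorm (Aᵀ *ᵥ v) := by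
  rw [posSemidef_iff_real]
  have e : ∀ v, v ⬝ᵥ ((A * Aᵀ - s ^ 2 • (1 : Matrix (Fin d) (Fin d) ℝ)) *ᵥ v) =
      vnorm (Aᵀ *ᵥ v) ^ 2 - (s * vnorm v) ^ 2 := by
    intro v
    rw [mul_pow, vnorm_sq, vnorm_sq, sub_mulVec, dotProduct_sub, smul_mulVec, one_mulVec,
      dotProduct_smul, ← mulVec_mulVec, dotProduct_mulVec, ← mulVec_transpose, smul_eq_mul]
  constructor
  · rintro ⟨_, h⟩ v
    have := h v
    rw [e] at this
    exact (sq_le_sq₀ (by have := vnorm_nonneg v; positivity) (vnorm_nonneg _)).1 (by linarith)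
  · intro h
    refine ⟨by simp, fun v => ?_⟩
    rw [e]
    have := (sq_le_sq₀ (by have := vnorm_nonneg v; positivity) (vnorm_nonneg _)).2 (h v)
    linarith

/-- A lower bound for a square matrix passes to its transpose. -/
theorem lower_bound_transpose {A : Matrix (Fin d) (Fin d) ℝ} {s : ℝ}
    (h : ∀ v, s * vnorm v ≤ vnorm (A *ᵥ v)) (v : Fin d → ℝ) :
    s * vnorm v ≤ vnorm (Aᵀ *ᵥ v) := by
  rcases le_or_gt s 0 with hs | hs
  · exact (mul_nonpos_of_nonpos_of_nonneg hs (vnorm_nonneg v)).trans (vnorm_nonneg _)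
  -- A square injective matrix is onto, so `v = Aw`; then `‖v‖² = ⟨Aᵀv, w⟩` while `s‖w‖ ≤ ‖v‖`.
  have hinj : Function.Injective A.mulVecLin := by
    rw [← LinearMap.ker_eq_bot, LinearMap.ker_eq_bot']
    intro x hx
    have := h x
    rw [show A *ᵥ x = 0 from hx, vnorm_zero] at this
    exact vnorm_eq_zero.1 (le_antisymm (by nlinarith [vnorm_nonneg x]) (vnorm_nonneg x))
  obtain ⟨w, hw⟩ := LinearMap.surjective_of_injective hinj v
  have hw : A *ᵥ w = v := hw
  have h1 : vnorm v ^ 2 ≤ vnorm (Aᵀ *ᵥ v) * vnorm w := by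
    rw [vnorm_sq]
    nth_rewrite 2 [← hw]
    rw [dotProduct_mulVec, ← mulVec_transpose]
    exact (le_abs_self _).trans (abs_dotProduct_le _ _)
  have h2 := h w
  rw [hw] at h2
  rcases (vnorm_nonneg v).eq_or_lt with h0 | h0
  · rw [← h0, mul_zero]; exact vnorm_nonneg _
  refine le_of_mul_le_mul_right ?_ h0
  nlinarith [vnorm_nonneg (Aᵀ *ᵥ v)]

end Loewner

/-! ### Variational description of the extreme singular values. -/

section SingularValues

/-- An orthonormal eigenbasis of `T*T` diagonalizes the quadratic form `‖Tv‖²`, and the eigenvalues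
are the squared singular values. Both extreme singular values are read off from this expansion. -/
theorem norm_sq_eq_sum_singularValues {E F : Type*} [NormedAddCommGroup E]
    [InnerProductSpace ℝ E] [FiniteDimensional ℝ E] [NormedAddCommGroup F]
    [InnerProductSpace ℝ F] [FiniteDimensional ℝ F] (T : E →ₗ[ℝ] F) {n : ℕ}
    (hn : Module.finrank ℝ E = n) :
    ∃ b : OrthonormalBasis (Fin n) ℝ E, ∀ v,
      ‖T v‖ ^ 2 = ∑ i : Fin n, T.singularValues i ^ 2 * b.repr v i ^ 2 := by
  have hT := T.isSymmetric_adjoint_comp_self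
  refine ⟨hT.eigenvectorBasis hn, fun v => ?_⟩
  set b := hT.eigenvectorBasis hn
  have h1 : ‖T v‖ ^ 2 = inner ℝ ((LinearMap.adjoint T ∘ₗ T) v) v := by
    rw [LinearMap.comp_apply, LinearMap.adjoint_inner_left, real_inner_self_eq_norm_sq]
  rw [h1, ← b.repr.inner_map_map, PiLp.inner_apply]
  refine Finset.sum_congr rfl fun i _ => ?_
  rw [hT.eigenvectorBasis_apply_self_apply hn, T.sq_singularValues_fin hn]
  simp [b]
  ring

variable {a d : ℕ}

theorem singVal_one_eq_norm (hd : 0 < d) (M : Matrix (Fin a) (Fin d) ℝ) :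
    singVal 1 M = ‖M‖ := by
  set T := Matrix.toEuclideanLin M
  obtain ⟨b, hb⟩ := norm_sq_eq_sum_singularValues T (n := d) (by simp)
  have hv : ∀ v, vnorm (M *ᵥ v) = ‖T (WithLp.toLp 2 v)‖ := fun v => rfl
  apply le_antisymm
  · have h := hb (b ⟨0, hd⟩)
    rw [Finset.sum_eq_single ⟨0, hd⟩ (fun i _ hi => by simp [b.repr_self, hi])
      (by simp)] at h
    simp only [b.repr_self, PiLp.single_apply, if_true, one_pow, mul_one] at h
    have h2 := (pow_left_inj₀ (norm_nonneg _) (T.singularValues_nonneg _) two_ne_zero).1 h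
    have h3 := vnorm_mulVec_le M (b ⟨0, hd⟩).ofLp
    rw [hv, WithLp.toLp_ofLp, h2, vnorm, WithLp.toLp_ofLp, b.norm_eq_one, mul_one] at h3
    exact h3
  · refine norm_le_of_vnorm (T.singularValues_nonneg _) fun v => ?_
    rw [hv]
    refine (sq_le_sq₀ (norm_nonneg _)
      (mul_nonneg (T.singularValues_nonneg _) (vnorm_nonneg v))).1 ?_
    rw [hb, mul_pow, vnorm, ← b.repr.norm_map, EuclideanSpace.real_norm_sq_eq, Finset.mul_sum]
    refine Finset.sum_le_sum fun i _ => mul_le_mul_of_nonneg_right ?_ (sq_nonneg _)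
    exact pow_le_pow_left₀ (T.singularValues_nonneg _)
      (T.singularValues_antitone (Nat.zero_le _)) 2

/-- Every coefficient in the eigenbasis expansion dominates the last one, and the last basis vector
attains it. This is the form in which lower bounds on `A` are propagated. -/
theorem le_singVal_iff (hd : 0 < d) (M : Matrix (Fin a) (Fin d) ℝ) (s : ℝ) :
    s ≤ singVal d M ↔ ∀ v, s * vnorm v ≤ vnorm (M *ᵥ v) := by
  set T := Matrix.toEuclideanLin M
  obtain ⟨b, hb⟩ := norm_sq_eq_sum_singularValues T (n := d) (by simp)
  have hv : ∀ v, vnorm (M *ᵥ v) = ‖T (WithLp.toLp 2 v)‖ := fun v => rfl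
  constructor
  · intro h v
    refine (mul_le_mul_of_nonneg_right h (vnorm_nonneg v)).trans ?_
    rw [hv]
    refine (sq_le_sq₀ (mul_nonneg (T.singularValues_nonneg _) (vnorm_nonneg v))
      (norm_nonneg _)).1 ?_
    rw [hb, mul_pow, vnorm, ← b.repr.norm_map, EuclideanSpace.real_norm_sq_eq, Finset.mul_sum]
    refine Finset.sum_le_sum fun i _ => mul_le_mul_of_nonneg_right ?_ (sq_nonneg _)
    exact pow_le_pow_left₀ (T.singularValues_nonneg _)
      (T.singularValues_antitone (Nat.le_sub_one_of_lt i.isLt)) 2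
  · intro h
    have hlt : d - 1 < d := Nat.sub_lt hd one_pos
    have h1 := hb (b ⟨d - 1, hlt⟩)
    rw [Finset.sum_eq_single ⟨d - 1, hlt⟩ (fun i _ hi => by simp [b.repr_self, hi])
      (by simp)] at h1
    simp only [b.repr_self, PiLp.single_apply, if_true, one_pow, mul_one] at h1
    have h2 := (pow_left_inj₀ (norm_nonneg _) (T.singularValues_nonneg _) two_ne_zero).1 h1
    have h3 := h (b ⟨d - 1, hlt⟩).ofLp
    rw [hv, WithLp.toLp_ofLp, h2, vnorm, WithLp.toLp_ofLp, b.norm_eq_one, mul_one] at h3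
    exact h3

end SingularValues

/-! ### Frobenius norm and inner product. -/

section Frobenius

variable {a b c : ℕ}

/-- The Frobenius inner product. -/
def frobInner (M N : Matrix (Fin a) (Fin b) ℝ) : ℝ := (Mᵀ * N).trace

theorem frobInner_eq_sum (M N : Matrix (Fin a) (Fin b) ℝ) :
    frobInner M N = ∑ i, ∑ j, M i j * N i j := by
  simp only [frobInner, trace, diag_apply, mul_apply, transpose_apply]
  exact Finset.sum_comm

theorem frobNorm_nonneg (M : Matrix (Fin a) (Fin b) ℝ) : 0 ≤ frobNorm M := Real.sqrt_nonneg _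

theorem frobNorm_sq (M : Matrix (Fin a) (Fin b) ℝ) : frobNorm M ^ 2 = frobInner M M := by
  rw [frobNorm, Real.sq_sqrt (by positivity), frobInner_eq_sum]
  simp only [sq]

theorem frobNorm_eq_norm (M : Matrix (Fin a) (Fin b) ℝ) :
    frobNorm M = ‖WithLp.toLp 2 fun p : Fin a × Fin b => M p.1 p.2‖ := by
  rw [EuclideanSpace.norm_eq, frobNorm, Fintype.sum_prod_type]
  simp

theorem frobNorm_add_le (M N : Matrix (Fin a) (Fin b) ℝ) :
    frobNorm (M + N) ≤ frobNorm M + frobNorm N := by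
  simp only [frobNorm_eq_norm]
  exact norm_add_le (WithLp.toLp 2 fun p : Fin a × Fin b => M p.1 p.2)
    (WithLp.toLp 2 fun p : Fin a × Fin b => N p.1 p.2)

theorem frobNorm_smul (r : ℝ) (M : Matrix (Fin a) (Fin b) ℝ) :
    frobNorm (r • M) = |r| * frobNorm M := by
  simp only [frobNorm_eq_norm]
  exact norm_smul r (WithLp.toLp 2 fun p : Fin a × Fin b => M p.1 p.2)

theorem frobNorm_neg (M : Matrix (Fin a) (Fin b) ℝ) : frobNorm (-M) = frobNorm M := by
  simp [frobNorm]

theorem frobNorm_transpose (M : Matrix (Fin a) (Fin b) ℝ) : frobNorm Mᵀ = frobNorm M := by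
  rw [frobNorm, frobNorm, Finset.sum_comm]
  simp

theorem frobNorm_sq_eq_sum_rows (M : Matrix (Fin a) (Fin b) ℝ) :
    frobNorm M ^ 2 = ∑ i, vnorm (M i) ^ 2 := by
  rw [frobNorm_sq, frobInner_eq_sum]
  simp only [vnorm_sq, dotProduct]

theorem frobNorm_mul_le (M : Matrix (Fin a) (Fin b) ℝ) (N : Matrix (Fin b) (Fin c) ℝ) :
    frobNorm (M * N) ≤ frobNorm M * ‖N‖ := by
  refine (sq_le_sq₀ (frobNorm_nonneg _)
    (mul_nonneg (frobNorm_nonneg _) (norm_nonneg _))).1 ?_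
  rw [mul_pow, frobNorm_sq_eq_sum_rows, frobNorm_sq_eq_sum_rows, Finset.sum_mul]
  refine Finset.sum_le_sum fun i _ => ?_
  rw [← mul_pow]
  refine pow_le_pow_left₀ (vnorm_nonneg _) ?_ 2
  have := vnorm_mulVec_le Nᵀ (M i)
  rw [norm_transpose_matrix, mul_comm] at this
  have e : (M * N) i = Nᵀ *ᵥ M i := by
    funext j
    simp [Matrix.mul_apply, mulVec, dotProduct, mul_comm]
  rwa [e]

theorem frobNorm_mul_le' (M : Matrix (Fin a) (Fin b) ℝ) (N : Matrix (Fin b) (Fin c) ℝ) :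
    frobNorm (M * N) ≤ ‖M‖ * frobNorm N := by
  rw [← frobNorm_transpose, transpose_mul, mul_comm, ← frobNorm_transpose N,
    ← norm_transpose_matrix M]
  exact frobNorm_mul_le _ _

theorem norm_le_frobNorm (M : Matrix (Fin a) (Fin b) ℝ) : ‖M‖ ≤ frobNorm M := by
  refine norm_le_of_vnorm (frobNorm_nonneg _) fun v => ?_
  refine (sq_le_sq₀ (vnorm_nonneg _)
    (mul_nonneg (frobNorm_nonneg _) (vnorm_nonneg _))).1 ?_
  rw [mul_pow, frobNorm_sq_eq_sum_rows, Finset.sum_mul, vnorm_sq, dotProduct]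
  refine Finset.sum_le_sum fun i _ => ?_
  rw [← mul_pow, ← sq, ← sq_abs]
  exact pow_le_pow_left₀ (abs_nonneg _) (abs_dotProduct_le (M i) v) 2

theorem frobNorm_one : frobNorm (1 : Matrix (Fin a) (Fin a) ℝ) = √a := by
  simp [frobNorm, one_apply]

theorem frobNorm_le_sqrt_mul_norm (M : Matrix (Fin a) (Fin b) ℝ) :
    frobNorm M ≤ √b * ‖M‖ := by
  have := frobNorm_mul_le' M (1 : Matrix (Fin b) (Fin b) ℝ)
  rwa [Matrix.mul_one, frobNorm_one, mul_comm] at this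

theorem frobNorm_add_smul_sq (M N : Matrix (Fin a) (Fin b) ℝ) (r : ℝ) :
    frobNorm (M + r • N) ^ 2 =
      frobNorm M ^ 2 + 2 * r * frobInner M N + r ^ 2 * frobNorm N ^ 2 := by
  simp only [frobNorm_sq, frobInner_eq_sum, Matrix.add_apply, Matrix.smul_apply, smul_eq_mul,
    Finset.mul_sum, ← Finset.sum_add_distrib]
  refine Finset.sum_congr rfl fun i _ => Finset.sum_congr rfl fun j _ => ?_
  ring

theorem frobInner_conj_nonneg {P : Matrix (Fin a) (Fin a) ℝ} (hP : P.PosSemidef)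
    (B : Matrix (Fin a) (Fin b) ℝ) : 0 ≤ frobInner B (P * B) := by
  have := (hP.conjTranspose_mul_mul_same B).trace_nonneg
  rwa [conjTranspose_eq_transpose_of_trivial, Matrix.mul_assoc] at this

end Frobenius

/-! ### One gradient step: identities and estimates for `A`, `B`, `R`, `J`, `K`. -/

section Step

variable {d : ℕ}

/-- The skew-symmetric part of the error `Σ - U Vᵀ`. -/
def skewQ (A B : Matrix (Fin d) (Fin d) ℝ) : Matrix (Fin d) (Fin d) ℝ := A * Bᵀ - B * Aᵀ

/-- The perturbation of the symmetric dynamics of `A`; here `F = JᵀJ` and `G = KᵀK`. -/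
def pertA (A B F G : Matrix (Fin d) (Fin d) ℝ) : Matrix (Fin d) (Fin d) ℝ :=
  B * Bᵀ * A - skewQ A B * B - (1 / 2 : ℝ) • (A * (G + F) + B * (G - F))

/-- The driving term of `B` without the contribution of the lower blocks. -/
def driftB (D A B : Matrix (Fin d) (Fin d) ℝ) : Matrix (Fin d) (Fin d) ℝ :=
  skewQ A B * A - (D - A * Aᵀ + B * Bᵀ) * B

/-- Substituting `U = A + B`, `V = A - B` separates the symmetric dynamics of `A` from terms that
vanish with `B`, `F`, `G`; the latter two stand for `JᵀJ` and `KᵀK`. -/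
theorem symA_step (D U V F G : Matrix (Fin d) (Fin d) ℝ) (η : ℝ)
    {A B : Matrix (Fin d) (Fin d) ℝ} (hA : A = (1 / 2 : ℝ) • (U + V))
    (hB : B = (1 / 2 : ℝ) • (U - V)) :
    (1 / 2 : ℝ) • ((U + η • (D * V - U * (Vᵀ * V + G))) + (V + η • (D * U - V * (Uᵀ * U + F)))) =
      (1 + η • (D - A * Aᵀ)) * A + η • pertA A B F G := by
  have hU : U = A + B := by rw [hA, hB]; module
  have hV : V = A - B := by rw [hA, hB]; module
  clear hA hB
  subst hU hV
  simp only [pertA, skewQ, transpose_add, transpose_sub, mul_add, add_mul, mul_sub, sub_mul,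
    smul_mul_assoc, one_mul, Matrix.mul_assoc]
  module

theorem asymB_step (D U V F G : Matrix (Fin d) (Fin d) ℝ) (η : ℝ)
    {A B : Matrix (Fin d) (Fin d) ℝ} (hA : A = (1 / 2 : ℝ) • (U + V))
    (hB : B = (1 / 2 : ℝ) • (U - V)) :
    (1 / 2 : ℝ) • ((U + η • (D * V - U * (Vᵀ * V + G))) - (V + η • (D * U - V * (Uᵀ * U + F)))) =
      (B + η • driftB D A B) + (-(η / 2)) • (A * (G - F) + B * (G + F)) := by
  have hU : U = A + B := by rw [hA, hB]; module
  have hV : V = A - B := by rw [hA, hB]; module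
  clear hA hB
  subst hU hV
  simp only [driftB, skewQ, transpose_add, transpose_sub, mul_add, add_mul, mul_sub, sub_mul,
    Matrix.mul_assoc]
  module

theorem norm_skewQ_le {A B : Matrix (Fin d) (Fin d) ℝ} {α β : ℝ} (hA : ‖A‖ ≤ α) (hB : ‖B‖ ≤ β) :
    ‖skewQ A B‖ ≤ 2 * α * β := by
  have h1 := norm_mul_le_of_le hA ((norm_transpose_matrix B).trans_le hB)
  have h2 := norm_mul_le_of_le hB ((norm_transpose_matrix A).trans_le hA)
  have := norm_sub_le (A * Bᵀ) (B * Aᵀ)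
  rw [skewQ]
  linarith

theorem norm_pertA_le {A B F G : Matrix (Fin d) (Fin d) ℝ} {α β ω : ℝ} (hA : ‖A‖ ≤ α)
    (hB : ‖B‖ ≤ β) (hβ : β ≤ α) (hFG : ‖F‖ + ‖G‖ ≤ ω) :
    ‖pertA A B F G‖ ≤ α * (3 * β ^ 2 + ω) := by
  have hα : 0 ≤ α := (norm_nonneg _).trans hA
  have hβ0 : 0 ≤ β := (norm_nonneg _).trans hB
  have h1 := norm_mul_le_of_le
    (norm_mul_le_of_le hB ((norm_transpose_matrix B).trans_le hB)) hA
  have h2 := norm_mul_le_of_le (norm_skewQ_le hA hB) hB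
  have h3 := norm_mul_le_of_le hA ((norm_add_le G F).trans ((add_comm _ _).trans_le hFG))
  have h4 := norm_mul_le_of_le hB ((norm_sub_le G F).trans ((add_comm _ _).trans_le hFG))
  have hω : 0 ≤ ω := le_trans (by positivity) hFG
  have h5 : ‖(1 / 2 : ℝ) • (A * (G + F) + B * (G - F))‖ ≤ α * ω := by
    rw [norm_smul, Real.norm_of_nonneg (by norm_num)]
    have := norm_add_le (A * (G + F)) (B * (G - F))
    nlinarith
  have h6 := norm_sub_le (B * Bᵀ * A - skewQ A B * B)
    ((1 / 2 : ℝ) • (A * (G + F) + B * (G - F)))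
  have h7 := norm_sub_le (B * Bᵀ * A) (skewQ A B * B)
  rw [pertA]
  nlinarith

/-- The second-order and perturbation terms in the evolution of `R = Σ - A Aᵀ`. -/
def pertR (R A E : Matrix (Fin d) (Fin d) ℝ) (η : ℝ) : Matrix (Fin d) (Fin d) ℝ :=
  η ^ 2 • (A * Aᵀ * R * (A * Aᵀ) + R * (A * Aᵀ) * R) +
    (η • ((1 + η • R) * A * Eᵀ) + η • (E * Aᵀ * (1 + η • R)) + η ^ 2 • (E * Eᵀ))

/-- The sandwich reproduces all terms of first order in `η` coming from `A` alone, `-η(RAAᵀ +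
AAᵀR)`; what remains is of order `η²` or contains `E`. The sandwich form preserves signs, which an
expansion would hide. -/
theorem residual_step {D A R : Matrix (Fin d) (Fin d) ℝ} (E : Matrix (Fin d) (Fin d) ℝ) (η : ℝ)
    (hD : Dᵀ = D) (hR : R = D - A * Aᵀ) :
    D - ((1 + η • R) * A + η • E) * ((1 + η • R) * A + η • E)ᵀ =
      (1 - η • (A * Aᵀ)) * R * (1 - η • (A * Aᵀ)) - pertR R A E η := by
  have hDR : D = R + A * Aᵀ := by rw [hR]; abel
  have hRt : Rᵀ = R := by rw [hR]; simp [hD]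
  rw [hDR]
  clear hR hDR hD
  simp only [pertR, transpose_add, transpose_mul, transpose_smul, hRt, mul_add,
    add_mul, mul_sub, sub_mul, smul_mul_assoc, mul_smul_comm, one_mul, mul_one, Matrix.mul_assoc]
  module

theorem pertR_transpose {R : Matrix (Fin d) (Fin d) ℝ} (A E : Matrix (Fin d) (Fin d) ℝ) (η : ℝ)
    (hR : Rᵀ = R) : (pertR R A E η)ᵀ = pertR R A E η := by
  simp only [pertR, transpose_add, transpose_mul, transpose_smul, transpose_one, hR,
    transpose_transpose, Matrix.mul_assoc]
  abel

theorem norm_pertR_le {R A E : Matrix (Fin d) (Fin d) ℝ} {η α r e : ℝ} (hη : 0 ≤ η)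
    (hA : ‖A‖ ≤ α) (hR : ‖R‖ ≤ r) (hE : ‖E‖ ≤ e) :
    ‖pertR R A E η‖ ≤
      η * (η * (α ^ 4 * r + α ^ 2 * r ^ 2) + 2 * (1 + η * r) * α * e + η * e ^ 2) := by
  have hAt := (norm_transpose_matrix A).trans_le hA
  have hEt := (norm_transpose_matrix E).trans_le hE
  have hS := norm_mul_le_of_le hA hAt
  have h1 := norm_mul_le_of_le (norm_mul_le_of_le hS hR) hS
  have h2 := norm_mul_le_of_le (norm_mul_le_of_le hR hS) hR
  have h3 : ‖1 + η • R‖ ≤ 1 + η * r := by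
    refine (norm_add_le _ _).trans (add_le_add norm_one_le ?_)
    rw [norm_smul, Real.norm_of_nonneg hη]
    exact mul_le_mul_of_nonneg_left hR hη
  have h4 := norm_mul_le_of_le (norm_mul_le_of_le h3 hA) hEt
  have h5 := norm_mul_le_of_le (norm_mul_le_of_le hE hAt) h3
  have h6 := norm_mul_le_of_le hE hEt
  have n1 : ‖η ^ 2 • (A * Aᵀ * R * (A * Aᵀ) + R * (A * Aᵀ) * R)‖ ≤
      η ^ 2 * (α * α * r * (α * α) + r * (α * α) * r) := by
    rw [norm_smul, Real.norm_of_nonneg (by positivity)]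
    exact mul_le_mul_of_nonneg_left ((norm_add_le _ _).trans (add_le_add h1 h2)) (by positivity)
  have n2 : ‖η • ((1 + η • R) * A * Eᵀ)‖ ≤ η * ((1 + η * r) * α * e) := by
    rw [norm_smul, Real.norm_of_nonneg hη]
    exact mul_le_mul_of_nonneg_left h4 hη
  have n3 : ‖η • (E * Aᵀ * (1 + η • R))‖ ≤ η * (e * α * (1 + η * r)) := by
    rw [norm_smul, Real.norm_of_nonneg hη]
    exact mul_le_mul_of_nonneg_left h5 hη
  have n4 : ‖η ^ 2 • (E * Eᵀ)‖ ≤ η ^ 2 * (e * e) := by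
    rw [norm_smul, Real.norm_of_nonneg (by positivity)]
    exact mul_le_mul_of_nonneg_left h6 (by positivity)
  rw [pertR]
  refine (norm_add_le_of_le n1 (norm_add_le_of_le (norm_add_le_of_le n2 n3) n4)).trans_eq ?_
  ring

/-- A lower bound on the residual deteriorates in one step at most by the perturbation. -/
theorem residual_lower_step {S R N : Matrix (Fin d) (Fin d) ℝ} {η r l : ℝ} (hl : 0 ≤ l)
    (hη : 0 ≤ η) (hS : S.PosSemidef) (hS1 : (1 - η • S).PosSemidef)
    (hR : (R + l • (1 : Matrix (Fin d) (Fin d) ℝ)).PosSemidef) (hN : Nᵀ = N) (hNr : ‖N‖ ≤ r) :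
    ((1 - η • S) * R * (1 - η • S) - N + (l + r) • (1 : Matrix (Fin d) (Fin d) ℝ)).PosSemidef := by
  have hSt : Sᵀ = S := (posSemidef_iff_real.1 hS).1
  have hT : (η • S).PosSemidef := hS.smul hη
  have h1 := posSemidef_conj hR (1 - η • S)
  have h2 := posSemidef_mul_sub one_pos hT (by simpa using hS1)
  -- With `T = ηS` this is `l(2T - T²) = l(1 - (1 - T)²) ≽ 0`: conjugation by `1 - T` cannot worsen
  -- the lower bound `-l`.
  have h3 := (hT.add h2).smul hl
  have h4 := posSemidef_smul_one_sub hN hNr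
  convert (h1.add h3).add h4 using 1
  simp only [transpose_sub, transpose_smul, transpose_one, hSt, mul_add, add_mul, mul_sub, sub_mul,
    smul_mul_assoc, mul_smul_comm, one_mul, mul_one, Matrix.mul_assoc]
  module

theorem norm_one_sub_smul_le {S : Matrix (Fin d) (Fin d) ℝ} {η y : ℝ} (hη : 0 ≤ η)
    (hy : η * y ≤ 1) (hS : (S - y • (1 : Matrix (Fin d) (Fin d) ℝ)).PosSemidef)
    (hS1 : (1 - η • S).PosSemidef) : ‖1 - η • S‖ ≤ 1 - η * y := by
  refine norm_le_of_posSemidef (by linarith) ?_ ?_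
  · convert hS.smul hη using 1
    module
  · convert hS1.add ((PosSemidef.one (n := Fin d) (R := ℝ)).smul (sub_nonneg.2 hy)) using 1
    abel

theorem residual_norm_step {S R N : Matrix (Fin d) (Fin d) ℝ} {η y x r : ℝ} (hη : 0 ≤ η)
    (hy0 : 0 ≤ y) (hy : η * y ≤ 1) (hS : (S - y • (1 : Matrix (Fin d) (Fin d) ℝ)).PosSemidef)
    (hS1 : (1 - η • S).PosSemidef) (hR : ‖R‖ ≤ x) (hN : ‖N‖ ≤ r) :
    ‖(1 - η • S) * R * (1 - η • S) - N‖ ≤ (1 - η * y) * x + r := by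
  have h := norm_one_sub_smul_le hη hy hS hS1
  have hx : 0 ≤ x := (norm_nonneg _).trans hR
  have h0 : 0 ≤ η * y := by positivity
  have h1 := norm_mul_le_of_le (norm_mul_le_of_le h hR) h
  -- One of the two contraction factors is enough and the other is discarded.
  have h2 : (1 - η * y) * x * (1 - η * y) ≤ (1 - η * y) * x :=
    mul_le_of_le_one_right (mul_nonneg (by linarith) hx) (by linarith)
  exact norm_sub_le_of_le (h1.trans h2) hN

/-- The least singular value of `A` grows in one step of the symmetric dynamics. -/
theorem lower_bound_step {D A E : Matrix (Fin d) (Fin d) ℝ} {η x s e : ℝ} (hη : 0 ≤ η)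
    (hs : 0 ≤ s) (hD : (D - x • (1 : Matrix (Fin d) (Fin d) ℝ)).PosSemidef)
    (hS : ((1 / 8 : ℝ) • (1 : Matrix (Fin d) (Fin d) ℝ) - η • (A * Aᵀ)).PosSemidef)
    (hA : ∀ v, s * vnorm v ≤ vnorm (Aᵀ *ᵥ v)) (hs1 : 8 * η * s ^ 2 ≤ 1)
    (hE : η * ‖D * (A * Aᵀ) * A‖ + ‖E‖ ≤ e) (v : Fin d → ℝ) :
    ((1 + η * x) * (1 - 2 * η * s ^ 2) * s - η * e) * vnorm v ≤
      vnorm (((1 + η • (D - A * Aᵀ)) * A + η • E)ᵀ *ᵥ v) := by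
  set S := A * Aᵀ with hSdef
  have hSt : Sᵀ = S := by simp [S]
  have hDt : Dᵀ = D := by simpa using (posSemidef_iff_real.1 hD).1
  have hMpos := (posSemidef_mul_transpose_sub_iff hs).2 hA
  rw [← hSdef] at hMpos
  set M := S - s ^ 2 • (1 : Matrix (Fin d) (Fin d) ℝ) with hM
  have hSpos : S.PosSemidef := posSemidef_self_mul_transpose A
  -- the matrix `S - 2 η S²` dominates its value at `s²`
  have hη8 : ((1 / 8 : ℝ) • (1 : Matrix (Fin d) (Fin d) ℝ) - η • M).PosSemidef := by
    convert hS.add ((PosSemidef.one (n := Fin d) (R := ℝ)).smul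
      (show 0 ≤ η * s ^ 2 by positivity)) using 1
    rw [hM]
    module
  have hMM := posSemidef_mul_sub (by norm_num : (0 : ℝ) < 1 / 8) (hMpos.smul hη) hη8
  have hq1 : ∀ w, s ^ 2 * (1 - 2 * η * s ^ 2) * vnorm w ^ 2 ≤
      vnorm (Aᵀ *ᵥ ((1 - η • S) *ᵥ w)) ^ 2 := by
    intro w
    have p1 := (posSemidef_iff_real.1 hMM).2 w
    have p2 := (posSemidef_iff_real.1 hMpos).2 w
    have p3 := (posSemidef_iff_real.1 (posSemidef_conj hSpos S)).2 w
    rw [hSt] at p3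
    have eS : S = M + s ^ 2 • (1 : Matrix (Fin d) (Fin d) ℝ) := by rw [hM]; abel
    have e1 : vnorm (Aᵀ *ᵥ ((1 - η • S) *ᵥ w)) ^ 2 =
        w ⬝ᵥ (((1 - η • S) * S * (1 - η • S)) *ᵥ w) := by
      rw [vnorm_sq, mulVec_mulVec, dotProduct_mulVec, ← mulVec_transpose, mulVec_mulVec,
        dotProduct_comm]
      congr 2
      simp [hSt, S, Matrix.mul_assoc]
    have e2 : (1 - η • S) * S * (1 - η • S) = S - (2 * η) • (S * S) + η ^ 2 • (S * S * S) := by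
      simp only [mul_sub, sub_mul, smul_mul_assoc, mul_smul_comm, one_mul, mul_one,
        Matrix.mul_assoc]
      module
    -- Expansion of `x - 2ηx²` around `x = s²`. The part in `M` is nonnegative because `4ηs² ≤ 1/2`
    -- and `2ηM² ≼ M/4`: the function increases on `[s², 1/(8η)]`, which contains the spectrum of
    -- `S`.
    have e3 : S - (2 * η) • (S * S) =
        (1 - 4 * η * s ^ 2) • M - (2 * η) • (M * M) +
          (s ^ 2 * (1 - 2 * η * s ^ 2)) • (1 : Matrix (Fin d) (Fin d) ℝ) := by
      rw [eS]
      simp only [mul_add, add_mul, smul_mul_assoc, mul_smul_comm, one_mul, mul_one]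
      module
    rw [e1, e2, e3]
    simp only [add_mulVec, sub_mulVec, smul_mulVec, one_mulVec, dotProduct_add, dotProduct_sub,
      dotProduct_smul, smul_eq_mul, smul_mul_assoc, mul_smul_comm] at p1 ⊢
    rw [vnorm_sq]
    set q := w ⬝ᵥ (M *ᵥ w)
    set q2 := w ⬝ᵥ ((M * M) *ᵥ w)
    have t1 : 0 ≤ η ^ 2 * w ⬝ᵥ ((S * S * S) *ᵥ w) := mul_nonneg (sq_nonneg _) p3
    have t2 : 2 * η * q2 ≤ (1 - 4 * η * s ^ 2) * q := by
      rcases hη.eq_or_lt with h0 | h0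
      · rw [← h0]; simpa using p2
      · have t3 : 2 * η * q2 ≤ (1 / 4) * q := by
          refine le_of_mul_le_mul_left ?_ h0
          linarith
        nlinarith
    linarith
  set w := (1 + η • D) *ᵥ v with hw
  have hwn : (1 + η * x) * vnorm v ≤ vnorm w := by
    have p1 := (posSemidef_iff_real.1 hD).2 v
    simp only [sub_mulVec, smul_mulVec, one_mulVec, dotProduct_sub, dotProduct_smul,
      smul_eq_mul, ← vnorm_sq] at p1
    have p2 : (1 + η * x) * vnorm v ^ 2 ≤ v ⬝ᵥ w := by
      rw [hw, add_mulVec, one_mulVec, smul_mulVec, dotProduct_add, dotProduct_smul, smul_eq_mul,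
        ← vnorm_sq]
      nlinarith
    have p3 := (le_abs_self _).trans (abs_dotProduct_le v w)
    rcases (vnorm_nonneg v).eq_or_lt with h0 | h0
    · rw [← h0, mul_zero]; exact vnorm_nonneg _
    · refine le_of_mul_le_mul_left ?_ h0
      linarith
  have hs2 : 0 ≤ 1 - 2 * η * s ^ 2 := by linarith
  have hmain : (1 + η * x) * (1 - 2 * η * s ^ 2) * s * vnorm v ≤
      vnorm (Aᵀ *ᵥ ((1 - η • S) *ᵥ w)) := by
    have p1 : (1 - 2 * η * s ^ 2) * s * vnorm w ≤ vnorm (Aᵀ *ᵥ ((1 - η • S) *ᵥ w)) := by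
      refine (sq_le_sq₀ (by have := vnorm_nonneg w; positivity) (vnorm_nonneg _)).1
        (le_trans ?_ (hq1 w))
      rw [mul_pow, mul_pow, mul_comm (s ^ 2)]
      refine mul_le_mul_of_nonneg_right (mul_le_mul_of_nonneg_right ?_ (sq_nonneg _))
        (sq_nonneg _)
      have : 0 ≤ 2 * η * s ^ 2 := by positivity
      nlinarith
    have p2 := mul_le_mul_of_nonneg_left hwn (show 0 ≤ (1 - 2 * η * s ^ 2) * s by positivity)
    linarith
  -- `1 + η(D - S) = (1 - ηS)(1 + ηD) + η²SD` decouples the growth due to `D` from the shrinking due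
  -- to `S`. The leftover `η²SD` is counted with the perturbation.
  have hsplit : ((1 + η • (D - S)) * A + η • E)ᵀ *ᵥ v =
      Aᵀ *ᵥ ((1 - η • S) *ᵥ w) + (η • (η • (D * S * A) + E)ᵀ) *ᵥ v := by
    rw [hw, mulVec_mulVec, mulVec_mulVec, ← add_mulVec]
    congr 1
    simp only [transpose_add, transpose_mul, transpose_smul, transpose_sub, transpose_one, hSt, hDt,
      mul_add, mul_sub, sub_mul, smul_mul_assoc, mul_smul_comm, mul_one, smul_add,
      Matrix.mul_assoc]
    module
  have herr : vnorm ((η • (η • (D * S * A) + E)ᵀ) *ᵥ v) ≤ η * e * vnorm v := by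
    refine (vnorm_mulVec_le _ v).trans (mul_le_mul_of_nonneg_right ?_ (vnorm_nonneg v))
    rw [norm_smul, norm_transpose_matrix, Real.norm_of_nonneg hη]
    refine mul_le_mul_of_nonneg_left (le_trans (norm_add_le _ _) ?_) hη
    rwa [norm_smul, Real.norm_of_nonneg hη]
  rw [hsplit]
  have := vnorm_sub_le (Aᵀ *ᵥ ((1 - η • S) *ᵥ w)) ((η • (η • (D * S * A) + E)ᵀ) *ᵥ v)
  linarith

/-- The skew part pairs with `B` to `-‖Q‖²/2` and `BBᵀB` pairs nonnegatively, so only the negative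
part of `D - AAᵀ` can make `B` grow to first order in `η`. -/
theorem frobInner_driftB_le {D A B : Matrix (Fin d) (Fin d) ℝ} {l : ℝ}
    (hR : (D - A * Aᵀ + l • (1 : Matrix (Fin d) (Fin d) ℝ)).PosSemidef) :
    frobInner B (driftB D A B) ≤ l * frobNorm B ^ 2 := by
  have h1 := frobInner_conj_nonneg hR B
  have h2 := frobInner_conj_nonneg (posSemidef_self_mul_transpose B) B
  have h3 : frobInner B (skewQ A B * A) = -(1 / 2) * frobInner (skewQ A B) (skewQ A B) := by
    have t1 : (Bᵀ * (A * (Bᵀ * A))).trace = (A * (Bᵀ * (A * Bᵀ))).trace := by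
      rw [trace_mul_comm]; simp only [Matrix.mul_assoc]
    have t2 : (Bᵀ * (B * (Aᵀ * A))).trace = (A * (Bᵀ * (B * Aᵀ))).trace := by
      rw [← Matrix.mul_assoc, ← Matrix.mul_assoc, trace_mul_comm]; simp only [Matrix.mul_assoc]
    have t3 : (B * (Aᵀ * (A * Bᵀ))).trace = (A * (Bᵀ * (B * Aᵀ))).trace := by
      rw [← Matrix.mul_assoc, trace_mul_comm]; simp only [Matrix.mul_assoc]
    have t4 : (B * (Aᵀ * (B * Aᵀ))).trace = (A * (Bᵀ * (A * Bᵀ))).trace := by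
      rw [← trace_transpose]; simp [Matrix.mul_assoc]
    simp only [frobInner, skewQ, transpose_sub, transpose_mul, transpose_transpose, mul_sub,
      sub_mul, Matrix.mul_assoc, trace_sub, t1, t2, t3, t4]
    ring
  have h4 : 0 ≤ frobInner (skewQ A B) (skewQ A B) := by rw [← frobNorm_sq]; positivity
  have h5 : frobInner B (driftB D A B) = frobInner B (skewQ A B * A) -
      frobInner B ((D - A * Aᵀ + l • 1) * B) - frobInner B (B * Bᵀ * B) + l * frobInner B B := by
    simp only [driftB, frobInner, mul_add, mul_sub, add_mul, sub_mul, trace_add, trace_sub,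
      smul_mul_assoc, mul_smul_comm, trace_smul, one_mul, smul_eq_mul]
    ring
  rw [h5, h3, frobNorm_sq]
  linarith

theorem frobNorm_driftB_le {D A B : Matrix (Fin d) (Fin d) ℝ} {α r : ℝ} (hA : ‖A‖ ≤ α)
    (hB : ‖B‖ ≤ α) (hR : ‖D - A * Aᵀ‖ ≤ r) :
    frobNorm (driftB D A B) ≤ (3 * α ^ 2 + r) * frobNorm B := by
  have hα : 0 ≤ α := (norm_nonneg _).trans hA
  have hAt := (norm_transpose_matrix A).trans_le hA
  have hBt := (norm_transpose_matrix B).trans_le hB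
  have hf := frobNorm_nonneg B
  have h1 : frobNorm (skewQ A B) ≤ 2 * α * frobNorm B := by
    have a1 := frobNorm_mul_le' A Bᵀ
    have a2 := frobNorm_mul_le B Aᵀ
    rw [frobNorm_transpose] at a1
    have a3 := frobNorm_add_le (A * Bᵀ) (-(B * Aᵀ))
    rw [frobNorm_neg] at a3
    rw [skewQ, sub_eq_add_neg]
    nlinarith
  have h2 : frobNorm (skewQ A B * A) ≤ 2 * α ^ 2 * frobNorm B := by
    have a1 := frobNorm_mul_le (skewQ A B) A
    have a2 := mul_le_mul h1 hA (norm_nonneg _) (by positivity)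
    linarith
  have h3 : frobNorm ((D - A * Aᵀ + B * Bᵀ) * B) ≤ (r + α ^ 2) * frobNorm B := by
    refine (frobNorm_mul_le' _ _).trans (mul_le_mul_of_nonneg_right ?_ hf)
    refine norm_add_le_of_le hR ?_
    rw [sq]
    exact norm_mul_le_of_le hB hBt
  have h4 := frobNorm_add_le (skewQ A B * A) (-((D - A * Aᵀ + B * Bᵀ) * B))
  rw [frobNorm_neg] at h4
  rw [driftB, sub_eq_add_neg]
  linarith

theorem frobNorm_asymB_step {D A B F G : Matrix (Fin d) (Fin d) ℝ} {η α r l ω : ℝ} (hη : 0 ≤ η)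
    (hl : 0 ≤ l) (hA : ‖A‖ ≤ α) (hB : ‖B‖ ≤ α) (hr : ‖D - A * Aᵀ‖ ≤ r)
    (hR : (D - A * Aᵀ + l • (1 : Matrix (Fin d) (Fin d) ℝ)).PosSemidef)
    (hFG : ‖F‖ + ‖G‖ ≤ ω) :
    frobNorm ((B + η • driftB D A B) + (-(η / 2)) • (A * (G - F) + B * (G + F))) ≤
      frobNorm B + η * ((l + η * (3 * α ^ 2 + r) ^ 2 + ω) * frobNorm B + α * √d * ω) := by
  have hα : 0 ≤ α := (norm_nonneg _).trans hA
  have hr0 : 0 ≤ r := (norm_nonneg _).trans hr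
  have hω : 0 ≤ ω := le_trans (by positivity) hFG
  have hf := frobNorm_nonneg B
  -- Squares are compared: `1 + 2ηl + η²K² ≤ (1 + η(l + ηK²))²` with `K = 3α² + r`. The triangle
  -- inequality would put `K` in the place of `l`.
  have h1 : frobNorm (B + η • driftB D A B) ≤
      (1 + η * (l + η * (3 * α ^ 2 + r) ^ 2)) * frobNorm B := by
    refine (sq_le_sq₀ (frobNorm_nonneg _) (by positivity)).1 ?_
    rw [frobNorm_add_smul_sq]
    have a1 := mul_le_mul_of_nonneg_left (frobInner_driftB_le (B := B) hR) (show 0 ≤ 2 * η by positivity)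
    have a2 := mul_le_mul_of_nonneg_left
      (pow_le_pow_left₀ (frobNorm_nonneg _) (frobNorm_driftB_le hA hB hr) 2) (sq_nonneg η)
    have a3 : 0 ≤ (η * (l + η * (3 * α ^ 2 + r) ^ 2)) ^ 2 * frobNorm B ^ 2 := by positivity
    have a4 : 0 ≤ η ^ 2 * ((3 * α ^ 2 + r) ^ 2 * frobNorm B ^ 2) := by positivity
    nlinarith
  have h2 : frobNorm (A * (G - F)) ≤ α * √d * ω := by
    have a1 := frobNorm_mul_le' A (G - F)
    have a2 := frobNorm_le_sqrt_mul_norm (G - F)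
    have a3 : ‖G - F‖ ≤ ω := (norm_sub_le G F).trans ((add_comm _ _).trans_le hFG)
    have a4 : frobNorm (G - F) ≤ √d * ω :=
      a2.trans (mul_le_mul_of_nonneg_left a3 (Real.sqrt_nonneg _))
    calc _ ≤ _ := a1
      _ ≤ α * (√d * ω) := mul_le_mul hA a4 (frobNorm_nonneg _) hα
      _ = _ := by ring
  have h3 : frobNorm (B * (G + F)) ≤ frobNorm B * ω :=
    (frobNorm_mul_le _ _).trans (mul_le_mul_of_nonneg_left
      ((norm_add_le G F).trans ((add_comm _ _).trans_le hFG)) hf)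
  have h4 := frobNorm_add_le (A * (G - F)) (B * (G + F))
  have h5 := frobNorm_add_le (B + η • driftB D A B)
    ((-(η / 2)) • (A * (G - F) + B * (G + F)))
  rw [frobNorm_smul, abs_neg, abs_of_nonneg (by positivity)] at h5
  have h6 : η / 2 * frobNorm (A * (G - F) + B * (G + F)) ≤
      η * (α * √d * ω + frobNorm B * ω) := by
    have : 0 ≤ α * √d * ω + frobNorm B * ω := by positivity
    nlinarith
  linarith

/-- The lower blocks contract. -/
theorem norm_lower_step {k : ℕ} {J : Matrix (Fin k) (Fin d) ℝ} {H : Matrix (Fin d) (Fin d) ℝ}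
    {η x : ℝ} (hη : 0 ≤ η) (hH : H.PosSemidef) (hH1 : η * ‖H‖ ≤ 1) (hJ : ‖J‖ ≤ x) :
    ‖J + η • (-(J * H))‖ ≤ x := by
  have hHt := (posSemidef_iff_real.1 hH).1
  have h1 : (1 - η • H).PosSemidef := by
    have := posSemidef_smul_one_sub (M := η • H) (r := 1) (by simp [hHt])
      (by rwa [norm_smul, Real.norm_of_nonneg hη])
    simpa using this
  have h2 := norm_one_sub_smul_le (y := 0) hη (by simp) (by simpa using hH) h1
  have h3 := norm_mul_le_of_le hJ h2
  have e : J + η • (-(J * H)) = J * (1 - η • H) := by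
    rw [Matrix.mul_sub, Matrix.mul_one, Matrix.mul_smul, smul_neg, sub_eq_add_neg]
  rw [e]
  simpa using h3

end Step

/-! ### Gradient descent in the coordinates of the singular vectors. -/

section Blocks

variable {d k l : ℕ}

theorem upper_add (X Y : Matrix (Fin (d + k)) (Fin d) ℝ) : upper (X + Y) = upper X + upper Y := rfl

theorem lower_add (X Y : Matrix (Fin (d + k)) (Fin d) ℝ) : lower (X + Y) = lower X + lower Y := rfl

theorem upper_sub (X Y : Matrix (Fin (d + k)) (Fin d) ℝ) : upper (X - Y) = upper X - upper Y := rfl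

theorem lower_sub (X Y : Matrix (Fin (d + k)) (Fin d) ℝ) : lower (X - Y) = lower X - lower Y := rfl

theorem upper_smul (r : ℝ) (X : Matrix (Fin (d + k)) (Fin d) ℝ) :
    upper (r • X) = r • upper X := rfl

theorem lower_smul (r : ℝ) (X : Matrix (Fin (d + k)) (Fin d) ℝ) :
    lower (r • X) = r • lower X := rfl

theorem upper_mul (X : Matrix (Fin (d + k)) (Fin d) ℝ) (M : Matrix (Fin d) (Fin d) ℝ) :
    upper (X * M) = upper X * M := rfl

theorem lower_mul (X : Matrix (Fin (d + k)) (Fin d) ℝ) (M : Matrix (Fin d) (Fin d) ℝ) :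
    lower (X * M) = lower X * M := rfl

theorem transpose_mul_self_eq_blocks (X : Matrix (Fin (d + k)) (Fin d) ℝ) :
    Xᵀ * X = (upper X)ᵀ * upper X + (lower X)ᵀ * lower X := by
  ext i j
  simp [Matrix.mul_apply, Fin.sum_univ_add, upper, lower]

theorem upper_rectDiag_mul (σ : Fin d → ℝ) (Y : Matrix (Fin (d + l)) (Fin d) ℝ) :
    upper (rectDiag k l σ * Y) = diagonal σ * upper Y := by
  ext i j
  simp [Matrix.mul_apply, Fin.sum_univ_add, upper, rectDiag]

theorem lower_rectDiag_mul (σ : Fin d → ℝ) (Y : Matrix (Fin (d + l)) (Fin d) ℝ) :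
    lower (rectDiag k l σ * Y) = 0 := by
  ext i j
  simp [Matrix.mul_apply, Fin.sum_univ_add, lower, rectDiag]

theorem rectDiag_transpose (σ : Fin d → ℝ) : (rectDiag k l σ)ᵀ = rectDiag l k σ := by
  simp [rectDiag, fromBlocks_transpose]

/-- One step of gradient descent in the coordinates of the singular vectors. -/
structure IsStep (σ : Fin d → ℝ) (η : ℝ) (X X' : Matrix (Fin (d + k)) (Fin d) ℝ)
    (Y Y' : Matrix (Fin (d + l)) (Fin d) ℝ) : Prop where
  upper_left : upper X' = upper X + η • (diagonal σ * upper Y -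
    upper X * ((upper Y)ᵀ * upper Y + (lower Y)ᵀ * lower Y))
  upper_right : upper Y' = upper Y + η • (diagonal σ * upper X -
    upper Y * ((upper X)ᵀ * upper X + (lower X)ᵀ * lower X))
  lower_left : lower X' = lower X + η •
    (-(lower X * ((upper Y)ᵀ * upper Y + (lower Y)ᵀ * lower Y)))
  lower_right : lower Y' = lower Y + η •
    (-(lower Y * ((upper X)ᵀ * upper X + (lower X)ᵀ * lower X)))

/-- Orthogonal changes of coordinates leave the Gram matrices `UᵀU` and `VᵀV` unchanged and turn `S`
into `rectDiag`, whose zero blocks give the lower parts no driving term. -/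
theorem isStep_of_gd {S : Matrix (Fin (d + k)) (Fin (d + l)) ℝ} {σ : Fin d → ℝ}
    {Φ : Matrix (Fin (d + k)) (Fin (d + k)) ℝ} {Ψ : Matrix (Fin (d + l)) (Fin (d + l)) ℝ}
    (h : IsSVD S σ Φ Ψ) {η : ℝ} {U₀ : Matrix (Fin (d + k)) (Fin d) ℝ}
    {V₀ : Matrix (Fin (d + l)) (Fin d) ℝ} {X : ℕ → Matrix (Fin (d + k)) (Fin d) ℝ}
    {Y : ℕ → Matrix (Fin (d + l)) (Fin d) ℝ}
    (hX : ∀ t, X t = Φ.transpose * (gd S η U₀ V₀ t).1)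
    (hY : ∀ t, Y t = Ψ.transpose * (gd S η U₀ V₀ t).2) (t : ℕ) :
    IsStep σ η (X t) (X (t + 1)) (Y t) (Y (t + 1)) := by
  have hΦ : Φᵀ * Φ = 1 := (mem_orthogonalGroup_iff' _ _).1 h.left_mem
  have hΦ' : Φ * Φᵀ = 1 := (mem_orthogonalGroup_iff _ _).1 h.left_mem
  have hΨ : Ψᵀ * Ψ = 1 := (mem_orthogonalGroup_iff' _ _).1 h.right_mem
  have hΨ' : Ψ * Ψᵀ = 1 := (mem_orthogonalGroup_iff _ _).1 h.right_mem
  set U := (gd S η U₀ V₀ t).1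
  set V := (gd S η U₀ V₀ t).2
  have hU : Φ * X t = U := by rw [hX, ← Matrix.mul_assoc, hΦ', Matrix.one_mul]
  have hV : Ψ * Y t = V := by rw [hY, ← Matrix.mul_assoc, hΨ', Matrix.one_mul]
  have gX : (X t)ᵀ * X t = Uᵀ * U := by
    rw [← hU, transpose_mul, Matrix.mul_assoc, ← Matrix.mul_assoc Φᵀ, hΦ, Matrix.one_mul]
  have gY : (Y t)ᵀ * Y t = Vᵀ * V := by
    rw [← hV, transpose_mul, Matrix.mul_assoc, ← Matrix.mul_assoc Ψᵀ, hΨ, Matrix.one_mul]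
  have e1 : X (t + 1) = X t + η • (rectDiag k l σ * Y t - X t * ((Y t)ᵀ * Y t)) := by
    have : (gd S η U₀ V₀ (t + 1)).1 = U + η • ((S - U * Vᵀ) * V) := rfl
    rw [hX (t + 1), this, h.eq, gY, Matrix.mul_add, ← hX, Matrix.mul_smul, Matrix.sub_mul,
      Matrix.mul_sub]
    congr 3
    · rw [Matrix.mul_assoc, Matrix.mul_assoc Φ, ← Matrix.mul_assoc Φᵀ, hΦ, Matrix.one_mul,
        ← hY]
    · rw [Matrix.mul_assoc, ← Matrix.mul_assoc, ← hX]
  have e2 : Y (t + 1) = Y t + η • (rectDiag l k σ * X t - Y t * ((X t)ᵀ * X t)) := by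
    have : (gd S η U₀ V₀ (t + 1)).2 = V + η • ((S - U * Vᵀ)ᵀ * U) := rfl
    rw [hY (t + 1), this, h.eq, gX, Matrix.mul_add, ← hY, Matrix.mul_smul, transpose_sub,
      Matrix.sub_mul, Matrix.mul_sub]
    congr 3
    · rw [transpose_mul, transpose_mul, transpose_transpose, rectDiag_transpose, Matrix.mul_assoc,
        ← Matrix.mul_assoc Ψᵀ, hΨ, Matrix.one_mul, Matrix.mul_assoc, ← hX]
    · rw [transpose_mul, transpose_transpose, Matrix.mul_assoc, ← Matrix.mul_assoc, ← hY]
  constructor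
  · rw [e1, upper_add, upper_smul, upper_sub, upper_rectDiag_mul, upper_mul,
      transpose_mul_self_eq_blocks]
  · rw [e2, upper_add, upper_smul, upper_sub, upper_rectDiag_mul, upper_mul,
      transpose_mul_self_eq_blocks]
  · rw [e1, lower_add, lower_smul, lower_sub, lower_rectDiag_mul, lower_mul,
      transpose_mul_self_eq_blocks, zero_sub]
  · rw [e2, lower_add, lower_smul, lower_sub, lower_rectDiag_mul, lower_mul,
      transpose_mul_self_eq_blocks, zero_sub]

theorem IsStep.symA_eq {σ : Fin d → ℝ} {η : ℝ} {X X' : Matrix (Fin (d + k)) (Fin d) ℝ}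
    {Y Y' : Matrix (Fin (d + l)) (Fin d) ℝ} (h : IsStep σ η X X' Y Y') :
    symA X' Y' = (1 + η • (diagonal σ - symA X Y * (symA X Y)ᵀ)) * symA X Y +
      η • pertA (symA X Y) (asymB X Y) ((lower X)ᵀ * lower X) ((lower Y)ᵀ * lower Y) := by
  conv_lhs => rw [symA, h.upper_left, h.upper_right]
  exact symA_step _ _ _ _ _ η rfl rfl

theorem IsStep.asymB_eq {σ : Fin d → ℝ} {η : ℝ} {X X' : Matrix (Fin (d + k)) (Fin d) ℝ}
    {Y Y' : Matrix (Fin (d + l)) (Fin d) ℝ} (h : IsStep σ η X X' Y Y') :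
    asymB X' Y' = (asymB X Y + η • driftB (diagonal σ) (symA X Y) (asymB X Y)) +
      (-(η / 2)) • (symA X Y * ((lower Y)ᵀ * lower Y - (lower X)ᵀ * lower X) +
        asymB X Y * ((lower Y)ᵀ * lower Y + (lower X)ᵀ * lower X)) := by
  conv_lhs => rw [asymB, h.upper_left, h.upper_right]
  exact asymB_step _ _ _ _ _ η rfl rfl

theorem upper_left_eq (X : Matrix (Fin (d + k)) (Fin d) ℝ) (Y : Matrix (Fin (d + l)) (Fin d) ℝ) :
    upper X = symA X Y + asymB X Y := by
  rw [symA, asymB]; module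

theorem upper_right_eq (X : Matrix (Fin (d + k)) (Fin d) ℝ) (Y : Matrix (Fin (d + l)) (Fin d) ℝ) :
    upper Y = symA X Y - asymB X Y := by
  rw [symA, asymB]; module

end Blocks

/-! ### Consequences of the smallness of `ε` and `η`. -/

section Regime

/-- The relations between the parameters that the analysis of the warm-up stage uses; `N` stands
for `m + n`, `L` for `log (d σd / ε²)` and `κ` for a small constant. -/
structure Regime (d : ℕ) (c ε η σ₁ σd N L κ : ℝ) : Prop where
  d_pos : 0 < d
  c_pos : 0 < c
  ε_pos : 0 < ε
  η_pos : 0 < η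
  σd_pos : 0 < σd
  σd_le : σd ≤ σ₁
  le_N : 2 * (d : ℝ) ≤ N
  L_eq : L = Real.log (d * σd / ε ^ 2)
  le_L : 4 ≤ L
  κ_pos : 0 < κ
  κ_le : κ ≤ 1 / 1000
  κ_mul_le : 200 * κ * c ^ 2 ≤ 1
  κ_le_c : κ ≤ c
  ε_le : L * √σ₁ * c * ε * (d * √d) * N ≤ κ * σd
  η_le : η * σ₁ ^ 2 ≤ c ^ 2 * ε ^ 2 * d * N

namespace Regime

variable {d : ℕ} {c ε η σ₁ σd N L κ : ℝ}

theorem σ₁_pos (h : Regime d c ε η σ₁ σd N L κ) : 0 < σ₁ := h.σd_pos.trans_le h.σd_le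

theorem one_le_d (h : Regime d c ε η σ₁ σd N L κ) : (1 : ℝ) ≤ d := by
  exact_mod_cast h.d_pos

theorem two_le_N (h : Regime d c ε η σ₁ σd N L κ) : 2 ≤ N := by
  linarith [h.one_le_d, h.le_N]

theorem L_pos (h : Regime d c ε η σ₁ σd N L κ) : 0 < L := by linarith [h.le_L]

theorem sq_sqrt_σ₁ (h : Regime d c ε η σ₁ σd N L κ) : √σ₁ ^ 2 = σ₁ := Real.sq_sqrt h.σ₁_pos.le

/-- `θ = c²ε²dN` is the common unit of smallness: it bounds, up to absolute factors, `(2cdε)²`, the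
Gram matrices of the lower blocks, and `ησ₁²`. -/
theorem theta_pos (h : Regime d c ε η σ₁ σd N L κ) : 0 < c ^ 2 * ε ^ 2 * d * N := by
  have := h.c_pos; have := h.ε_pos; have := h.one_le_d; have := h.two_le_N
  positivity

/-- The basic smallness estimate. -/
theorem sigma_theta_le (h : Regime d c ε η σ₁ σd N L κ) :
    L ^ 2 * (σ₁ * (c ^ 2 * ε ^ 2 * d * N)) ≤ κ ^ 2 * σd ^ 2 := by
  have h0 := h.c_pos; have h1 := h.ε_pos; have h2 := h.one_le_d; have h3 := h.two_le_N
  have h4 := h.L_pos; have h5 := h.σd_pos; have h6 := h.κ_pos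
  have hsq := pow_le_pow_left₀ (by positivity) h.ε_le 2
  have e : (L * √σ₁ * c * ε * (d * √d) * N) ^ 2 =
      L ^ 2 * (σ₁ * (c ^ 2 * ε ^ 2 * d * N)) * ((d : ℝ) ^ 2 * N) := by
    have a1 := h.sq_sqrt_σ₁
    have a2 : √(d : ℝ) ^ 2 = d := Real.sq_sqrt (by positivity)
    calc _ = L ^ 2 * √σ₁ ^ 2 * c ^ 2 * ε ^ 2 * (d ^ 2 * √(d : ℝ) ^ 2) * N ^ 2 := by ring
      _ = _ := by rw [a1, a2]; ring
  rw [e, mul_pow] at hsq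
  -- Squaring `ε_le` gives more than is needed; the surplus factor `d²N ≥ 1` is dropped.
  refine le_trans (le_mul_of_one_le_right ?_ ?_) hsq
  · have := h.σ₁_pos; positivity
  · nlinarith

theorem L_theta_le (h : Regime d c ε η σ₁ σd N L κ) :
    L * (c ^ 2 * ε ^ 2 * d * N) ≤ κ ^ 2 * σd := by
  have h1 := h.sigma_theta_le
  have h2 := h.theta_pos
  set θ := c ^ 2 * ε ^ 2 * d * N
  have h4 := h.le_L
  have h5 := h.σd_pos
  have h6 : L * (σd * θ) ≤ L ^ 2 * (σ₁ * θ) :=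
    mul_le_mul (by nlinarith) (mul_le_mul_of_nonneg_right h.σd_le h2.le) (by positivity)
      (by positivity)
  refine le_of_mul_le_mul_left ?_ h5
  linarith

theorem κ_sq_le (h : Regime d c ε η σ₁ σd N L κ) : κ ^ 2 ≤ 1 / 1000000 := by
  nlinarith [h.κ_pos, h.κ_le]

theorem theta_le (h : Regime d c ε η σ₁ σd N L κ) :
    c ^ 2 * ε ^ 2 * d * N ≤ σd / 1000000 := by
  have h1 := h.L_theta_le
  have h2 := h.theta_pos
  have h3 := h.κ_sq_le
  have h4 := h.le_L
  have h5 := h.σd_pos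
  set θ := c ^ 2 * ε ^ 2 * d * N
  nlinarith

theorem beta_sq_le (h : Regime d c ε η σ₁ σd N L κ) :
    (2 * c * d * ε) ^ 2 ≤ 2 * (c ^ 2 * ε ^ 2 * d * N) := by
  have h0 := h.c_pos; have h1 := h.ε_pos; have h2 := h.one_le_d
  have : 2 * (c ^ 2 * ε ^ 2 * d) * (2 * d) ≤ 2 * (c ^ 2 * ε ^ 2 * d) * N :=
    mul_le_mul_of_nonneg_left h.le_N (by positivity)
  linarith

theorem omega_le (h : Regime d c ε η σ₁ σd N L κ) :
    c ^ 2 * ε ^ 2 * N ≤ c ^ 2 * ε ^ 2 * d * N := by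
  have h0 := h.c_pos; have h1 := h.ε_pos; have h2 := h.one_le_d; have h3 := h.two_le_N
  have : c ^ 2 * ε ^ 2 * N * 1 ≤ c ^ 2 * ε ^ 2 * N * d :=
    mul_le_mul_of_nonneg_left h2 (by positivity)
  linarith

theorem eta_sigma_le (h : Regime d c ε η σ₁ σd N L κ) : η * σ₁ ≤ 1 / 1000000 := by
  have h1 := h.η_le
  have h2 := h.theta_le
  have h3 := h.σd_le
  have h4 := h.σ₁_pos
  refine le_of_mul_le_mul_right ?_ h4
  linarith

theorem beta_le (h : Regime d c ε η σ₁ σd N L κ) : 2 * c * d * ε ≤ √σ₁ := by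
  have h0 := h.c_pos; have h1 := h.ε_pos
  refine (sq_le_sq₀ (by positivity) (Real.sqrt_nonneg _)).1 ?_
  rw [h.sq_sqrt_σ₁]
  linarith [h.beta_sq_le, h.theta_le, h.σd_le, h.σd_pos]

/-- The perturbation of `A` has norm at most `14 √σ₁ θ`, where `θ = c² ε² d N`. -/
theorem pertA_bound (h : Regime d c ε η σ₁ σd N L κ) :
    2 * √σ₁ * (3 * (2 * c * d * ε) ^ 2 + c ^ 2 * ε ^ 2 * N) ≤
      14 * √σ₁ * (c ^ 2 * ε ^ 2 * d * N) := by
  have h1 := h.beta_sq_le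
  have h2 := h.omega_le
  have h3 := Real.sqrt_nonneg σ₁
  nlinarith

theorem pertR_bound (h : Regime d c ε η σ₁ σd N L κ) :
    η * ((2 * √σ₁) ^ 4 * σ₁ + (2 * √σ₁) ^ 2 * σ₁ ^ 2) +
      2 * (1 + η * σ₁) * (2 * √σ₁) * (14 * √σ₁ * (c ^ 2 * ε ^ 2 * d * N)) +
      η * (14 * √σ₁ * (c ^ 2 * ε ^ 2 * d * N)) ^ 2 ≤ 80 * σ₁ * (c ^ 2 * ε ^ 2 * d * N) := by
  have h1 := h.η_le
  have h2 := h.eta_sigma_le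
  have h3 := h.theta_pos
  have h4 := h.theta_le
  have h5 := h.σ₁_pos
  have h6 := h.sq_sqrt_σ₁
  have h7 := h.η_pos
  have h8 := h.σd_le
  set θ := c ^ 2 * ε ^ 2 * d * N
  set s := √σ₁
  have e1 : (2 * s) ^ 4 * σ₁ + (2 * s) ^ 2 * σ₁ ^ 2 = 20 * σ₁ ^ 3 := by
    calc _ = 16 * (s ^ 2) ^ 2 * σ₁ + 4 * s ^ 2 * σ₁ ^ 2 := by ring
      _ = _ := by rw [h6]; ring
  have e2 : 2 * (1 + η * σ₁) * (2 * s) * (14 * s * θ) = 56 * (1 + η * σ₁) * (σ₁ * θ) := by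
    rw [← h6]; ring
  have e3 : η * (14 * s * θ) ^ 2 = 196 * (η * θ) * (σ₁ * θ) := by
    rw [← h6]; ring
  rw [e1, e2, e3]
  have p : 0 < σ₁ * θ := by positivity
  have b1 : η * (20 * σ₁ ^ 3) ≤ 20 * (σ₁ * θ) := by nlinarith
  have b2 : η * θ ≤ 1 / 1000000 := by
    have : η * θ ≤ η * σ₁ := mul_le_mul_of_nonneg_left (by linarith) h7.le
    linarith
  nlinarith

/-- The perturbation is small compared to the initial size of `A`. -/
theorem pertA_le_growth (h : Regime d c ε η σ₁ σd N L κ) :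
    22 * √σ₁ * (c ^ 2 * ε ^ 2 * d * N) ≤ σd * (ε / (c * √d)) / 8 := by
  have h0 := h.c_pos; have h1 := h.ε_pos; have h2 := h.one_le_d; have h3 := h.two_le_N
  have h4 := h.le_L
  have hd : 0 < √(d : ℝ) := Real.sqrt_pos.2 (by linarith)
  have hd2 : √(d : ℝ) ^ 2 = d := Real.sq_sqrt (by linarith)
  have h5 := h.ε_le
  have h6 : √σ₁ * c * ε * (d * √d) * N ≤ κ * σd / 4 := by
    have : 4 * (√σ₁ * c * ε * (d * √d) * N) ≤ L * (√σ₁ * c * ε * (d * √d) * N) :=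
      mul_le_mul_of_nonneg_right h4 (by positivity)
    linarith
  have h7 := h.κ_mul_le
  have h8 := h.σd_pos
  -- The comparison of `√σ₁ θ` with `σ_d ε/(c√d)` is where the full factor `d^{3/2} N` in the bound
  -- on `ε` is used.
  have e : 22 * √σ₁ * (c ^ 2 * ε ^ 2 * d * N) =
      22 * (c * ε / √d) * (√σ₁ * c * ε * (d * √d) * N) := by
    field_simp
  have e2 : σd * (ε / (c * √d)) / 8 = (c * ε / √d) * (σd / (8 * c ^ 2)) := by
    field_simp
  rw [e, e2, mul_comm 22, mul_assoc]
  refine mul_le_mul_of_nonneg_left ?_ (by positivity)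
  rw [le_div_iff₀ (by positivity)]
  have : 22 * (√σ₁ * c * ε * (d * √d) * N) * (8 * c ^ 2) ≤ 22 * (κ * σd / 4) * (8 * c ^ 2) := by
    gcongr
  nlinarith

/-- The growth of `B` in one step. -/
theorem asymB_growth (h : Regime d c ε η σ₁ σd N L κ) {l b : ℝ}
    (hl : l ≤ 17 * L / σd * (80 * σ₁ * (c ^ 2 * ε ^ 2 * d * N))) (hb0 : 0 ≤ b)
    (hb : b ≤ 2 * c * d * ε) :
    (l + η * (3 * (2 * √σ₁) ^ 2 + σ₁) ^ 2 + c ^ 2 * ε ^ 2 * N) * b +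
      2 * √σ₁ * √d * (c ^ 2 * ε ^ 2 * N) ≤ c * d * ε * (σd / (17 * L)) := by
  have h0 := h.c_pos; have h1 := h.ε_pos; have h2 := h.one_le_d; have h3 := h.two_le_N
  have h4 := h.L_pos; have h5 := h.σd_pos; have h6 := h.κ_sq_le; have h7 := h.κ_le
  have hd : 0 < √(d : ℝ) := Real.sqrt_pos.2 (by linarith)
  have hd2 : √(d : ℝ) ^ 2 = d := Real.sq_sqrt (by linarith)
  have hκ := h.κ_pos
  -- All terms are multiplied by `L`, since one step may use only a fraction `1/(17L)` of the rate
  -- `σ_d`. As `l` already contains one `L`, this term requires `L²` in `sigma_theta_le`.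
  have hl2 : l * L ≤ 1360 / 1000000 * σd := by
    calc l * L ≤ 17 * L / σd * (80 * σ₁ * (c ^ 2 * ε ^ 2 * d * N)) * L := by gcongr
      _ = 1360 * (L ^ 2 * (σ₁ * (c ^ 2 * ε ^ 2 * d * N))) / σd := by ring
      _ ≤ 1360 * (κ ^ 2 * σd ^ 2) / σd := 
        div_le_div_of_nonneg_right (mul_le_mul_of_nonneg_left h.sigma_theta_le (by norm_num)) h5.le
      _ = 1360 * κ ^ 2 * σd := by field_simp
      _ ≤ _ := by nlinarith
  have hth : (c ^ 2 * ε ^ 2 * d * N) * L ≤ 1 / 1000000 * σd := by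
    nlinarith [h.L_theta_le]
  have hom : (c ^ 2 * ε ^ 2 * N) * L ≤ 1 / 1000000 * σd :=
    (mul_le_mul_of_nonneg_right h.omega_le h4.le).trans hth
  have hsq : η * (3 * (2 * √σ₁) ^ 2 + σ₁) ^ 2 * L ≤ 169 / 1000000 * σd := by
    have e : η * (3 * (2 * √σ₁) ^ 2 + σ₁) ^ 2 = 169 * (η * σ₁ ^ 2) := by
      rw [mul_pow, h.sq_sqrt_σ₁]; ring
    rw [e]
    have := mul_le_mul_of_nonneg_right h.η_le h4.le
    linarith
  have hcross : 2 * √σ₁ * √d * (c ^ 2 * ε ^ 2 * N) * L ≤ 2 / 1000 * σd * (c * d * ε) := by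
    calc 2 * √σ₁ * √d * (c ^ 2 * ε ^ 2 * N) * L
        = 2 * (c * ε / d) * (L * √σ₁ * c * ε * (d * √d) * N) := by field_simp
      _ ≤ 2 * (c * ε / d) * (κ * σd) := mul_le_mul_of_nonneg_left h.ε_le (by positivity)
      _ ≤ 2 * (c * ε * d) * (1 / 1000 * σd) := by
        gcongr
        rw [div_le_iff₀ (by linarith)]
        have : c * ε * 1 ≤ c * ε * (d * d) := by gcongr; nlinarith
        linarith
      _ = _ := by ring
  have hmain : (l + η * (3 * (2 * √σ₁) ^ 2 + σ₁) ^ 2 + c ^ 2 * ε ^ 2 * N) * b * L ≤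
      2000 / 1000000 * σd * (2 * c * d * ε) := by
    have a1 : (l + η * (3 * (2 * √σ₁) ^ 2 + σ₁) ^ 2 + c ^ 2 * ε ^ 2 * N) * L ≤
        2000 / 1000000 * σd := by linarith
    calc _ = (l + η * (3 * (2 * √σ₁) ^ 2 + σ₁) ^ 2 + c ^ 2 * ε ^ 2 * N) * L * b := by ring
      _ ≤ 2000 / 1000000 * σd * b := mul_le_mul_of_nonneg_right a1 hb0
      _ ≤ _ := by gcongr
  refine le_of_mul_le_mul_right ?_ h4
  have e : c * d * ε * (σd / (17 * L)) * L = c * d * ε * σd / 17 := by field_simp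
  rw [e, add_mul]
  have : 0 < c * d * ε * σd := by positivity
  linarith

theorem residual_loss_le (h : Regime d c ε η σ₁ σd N L κ) :
    17 * L / σd * (80 * σ₁ * (c ^ 2 * ε ^ 2 * d * N)) ≤ σd / 100 := by
  have h4 := h.le_L; have h5 := h.σd_pos; have h6 := h.κ_sq_le; have h8 := h.σ₁_pos
  have h9 := h.theta_pos
  calc 17 * L / σd * (80 * σ₁ * (c ^ 2 * ε ^ 2 * d * N))
      = 1360 * (L * (σ₁ * (c ^ 2 * ε ^ 2 * d * N))) / σd := by ring
    _ ≤ 1360 * (L ^ 2 * (σ₁ * (c ^ 2 * ε ^ 2 * d * N))) / σd := by gcongr; nlinarith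
    _ ≤ 1360 * (κ ^ 2 * σd ^ 2) / σd := 
        div_le_div_of_nonneg_right (mul_le_mul_of_nonneg_left h.sigma_theta_le (by norm_num)) h5.le
    _ = 1360 * κ ^ 2 * σd := by field_simp
    _ ≤ _ := by nlinarith

theorem exp_L (h : Regime d c ε η σ₁ σd N L κ) : Real.exp L = d * σd / ε ^ 2 := by
  have h1 := h.ε_pos; have h2 := h.one_le_d; have h5 := h.σd_pos
  rw [h.L_eq, Real.exp_log (by positivity)]

/-- Since `exp L = dσ_d/ε²`, this amounts to `σ₁ε² ≤ dσ_d²`. It lets the residual decay from `σ₁` be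
counted in units of `L`, with no separate logarithm of the condition number. -/
theorem sigma_le_exp (h : Regime d c ε η σ₁ σd N L κ) : σ₁ ≤ Real.exp L * σd := by
  have h0 := h.c_pos; have h1 := h.ε_pos; have h2 := h.one_le_d; have h3 := h.two_le_N
  have h4 := h.le_L; have h5 := h.σd_pos; have h8 := h.σ₁_pos
  rw [h.exp_L, div_mul_eq_mul_div, le_div_iff₀ (by positivity)]
  have a1 := h.sigma_theta_le
  have a2 : c ^ 2 * (σ₁ * ε ^ 2) ≤ c ^ 2 * σd ^ 2 := by
    have b1 : κ ^ 2 * σd ^ 2 ≤ c ^ 2 * σd ^ 2 := by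
      gcongr
      · exact h.κ_pos.le
      · exact h.κ_le_c
    refine le_trans ?_ (a1.trans b1)
    have b2 : 1 ≤ L ^ 2 * (d * N) := by
      have : 1 ≤ L ^ 2 := by nlinarith
      have : 1 ≤ d * N := by nlinarith
      nlinarith
    calc c ^ 2 * (σ₁ * ε ^ 2) ≤ c ^ 2 * (σ₁ * ε ^ 2) * (L ^ 2 * (d * N)) :=
          le_mul_of_one_le_right (by positivity) b2
      _ = _ := by ring
  have a3 := le_of_mul_le_mul_left a2 (by positivity : 0 < c ^ 2)
  nlinarith [sq_nonneg σd]

end Regime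
end Regime

/-! ### Diagonal matrices and Gram norms. -/

section Spectrum

variable {d : ℕ}

theorem singVal_le_singVal_one {a b : ℕ} (i : ℕ) (M : Matrix (Fin a) (Fin b) ℝ) :
    singVal i M ≤ singVal 1 M := by
  unfold singVal
  exact (Matrix.toEuclideanLin M).singularValues_antitone (by omega)

theorem diagonal_sub_posSemidef {σ : Fin d → ℝ} {x : ℝ} (h : ∀ i, x ≤ σ i) :
    (diagonal σ - x • (1 : Matrix (Fin d) (Fin d) ℝ)).PosSemidef := by
  rw [smul_one_eq_diagonal, diagonal_sub]
  exact posSemidef_diagonal_iff.2 fun i => sub_nonneg.2 (h i)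

theorem sub_diagonal_posSemidef {σ : Fin d → ℝ} {x : ℝ} (h : ∀ i, σ i ≤ x) :
    (x • (1 : Matrix (Fin d) (Fin d) ℝ) - diagonal σ).PosSemidef := by
  rw [smul_one_eq_diagonal, diagonal_sub]
  exact posSemidef_diagonal_iff.2 fun i => sub_nonneg.2 (h i)

theorem norm_diagonal_le {σ : Fin d → ℝ} {x : ℝ} (hx : 0 ≤ x) (h0 : ∀ i, 0 ≤ σ i)
    (h : ∀ i, σ i ≤ x) : ‖diagonal σ‖ ≤ x := by
  rw [l2_opNorm_diagonal, pi_norm_le_iff_of_nonneg hx]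
  intro i
  rw [Real.norm_of_nonneg (h0 i)]
  exact h i

theorem norm_transpose_mul_self {k : ℕ} (J : Matrix (Fin k) (Fin d) ℝ) :
    ‖Jᵀ * J‖ = ‖J‖ ^ 2 := by
  have := norm_self_mul_transpose Jᵀ
  rwa [transpose_transpose, norm_transpose_matrix] at this

end Spectrum

/-! ### Induction over the warm-up stage. -/

section WarmUp

variable {d m' n' : ℕ} {c ε η σ₁ σd N L κ : ℝ} {σ : Fin d → ℝ}

/-- The state of the iteration after `t` steps of the warm-up stage. -/
structure WarmState (c ε η σ₁ σd N L : ℝ) (σ : Fin d → ℝ) (t : ℕ)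
    (X : Matrix (Fin (d + m')) (Fin d) ℝ) (Y : Matrix (Fin (d + n')) (Fin d) ℝ) : Prop where
  J_le : ‖lower X‖ ≤ c * ε * √(max (m' : ℝ) d)
  K_le : ‖lower Y‖ ≤ c * ε * √(max (n' : ℝ) d)
  B_le : frobNorm (asymB X Y) ≤ c * d * ε * (1 + t * (η * (σd / (17 * L))))
  R_ge : (diagonal σ - symA X Y * (symA X Y)ᵀ +
    (t * (η * (80 * σ₁ * (c ^ 2 * ε ^ 2 * d * N)))) •
      (1 : Matrix (Fin d) (Fin d) ℝ)).PosSemidef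
  A_ge : ∀ v, min (ε / (c * √d) * (1 + η * σd / 4) ^ t) (√σd / 2) * vnorm v ≤
    vnorm ((symA X Y)ᵀ *ᵥ v)

/-- The bounds that a state within the time horizon `17 L / (η σd)` implies. -/
structure WarmBounds (c ε σ₁ σd N L : ℝ) (σ : Fin d → ℝ)
    (X : Matrix (Fin (d + m')) (Fin d) ℝ) (Y : Matrix (Fin (d + n')) (Fin d) ℝ) (l : ℝ) :
    Prop where
  l_nonneg : 0 ≤ l
  l_le : l ≤ 17 * L / σd * (80 * σ₁ * (c ^ 2 * ε ^ 2 * d * N))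
  R_ge : (diagonal σ - symA X Y * (symA X Y)ᵀ + l • (1 : Matrix (Fin d) (Fin d) ℝ)).PosSemidef
  R_le : ‖diagonal σ - symA X Y * (symA X Y)ᵀ‖ ≤ σ₁
  A_le : ‖symA X Y‖ ≤ 2 * √σ₁
  B_le : frobNorm (asymB X Y) ≤ 2 * c * d * ε
  JK_le : ‖(lower X)ᵀ * lower X‖ + ‖(lower Y)ᵀ * lower Y‖ ≤ c ^ 2 * ε ^ 2 * N

variable {X : Matrix (Fin (d + m')) (Fin d) ℝ} {Y : Matrix (Fin (d + n')) (Fin d) ℝ}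

/-- Both drifts are linear in `t`, and the horizon `17L/(ησ_d)` is exactly what makes the factor for
`B` at most `2` and keeps `l ≤ σ_d/100`. The bound on `A` then follows from `AAᵀ = Σ - R ≼ σ₁ + l`.
-/
theorem WarmState.bounds (h : Regime d c ε η σ₁ σd N L κ)
    (hσ₁ : ∀ i, σ i ≤ σ₁) (hN : N = (d + m' : ℝ) + (d + n')) {t : ℕ}
    (ht : (t : ℝ) ≤ 17 * L / (η * σd)) (hs : WarmState c ε η σ₁ σd N L σ t X Y) :
    WarmBounds c ε σ₁ σd N L σ X Y (t * (η * (80 * σ₁ * (c ^ 2 * ε ^ 2 * d * N)))) := by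
  have h1 := h.η_pos; have h2 := h.σd_pos; have h3 := h.theta_pos; have h4 := h.σ₁_pos
  have h5 := h.L_pos; have h6 := h.c_pos; have h7 := h.ε_pos
  have hl0 : 0 ≤ t * (η * (80 * σ₁ * (c ^ 2 * ε ^ 2 * d * N))) := by positivity
  have hl1 : t * (η * (80 * σ₁ * (c ^ 2 * ε ^ 2 * d * N))) ≤
      17 * L / σd * (80 * σ₁ * (c ^ 2 * ε ^ 2 * d * N)) := by
    calc _ ≤ 17 * L / (η * σd) * (η * (80 * σ₁ * (c ^ 2 * ε ^ 2 * d * N))) :=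
          mul_le_mul_of_nonneg_right ht (by positivity)
      _ = _ := by field_simp
  have hl2 := hl1.trans h.residual_loss_le
  have hR := hs.R_ge
  set l := t * (η * (80 * σ₁ * (c ^ 2 * ε ^ 2 * d * N)))
  have hσle := h.σd_le
  have hS := posSemidef_self_mul_transpose (symA X Y)
  have hone := PosSemidef.one (n := Fin d) (R := ℝ)
  have hup := sub_diagonal_posSemidef hσ₁
  refine ⟨hl0, hl1, hR, ?_, ?_, ?_, ?_⟩
  · refine norm_le_of_posSemidef h4.le ?_ ?_
    · convert hup.add hS using 1
      abel
    · convert hR.add (hone.smul (show 0 ≤ σ₁ - l by linarith)) using 1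
      module
  · have a1 : ‖symA X Y * (symA X Y)ᵀ‖ ≤ 4 * σ₁ := by
      refine norm_le_of_posSemidef (by linarith) ?_ ?_
      · convert (hR.add hup).add (hone.smul (show 0 ≤ 3 * σ₁ - l by linarith)) using 1
        module
      · convert hS.add (hone.smul (show 0 ≤ 4 * σ₁ by linarith)) using 1
        abel
    rw [norm_self_mul_transpose] at a1
    refine (sq_le_sq₀ (norm_nonneg _) (by positivity)).1 ?_
    rw [mul_pow, h.sq_sqrt_σ₁]
    linarith
  · refine hs.B_le.trans ?_
    have a1 : t * (η * (σd / (17 * L))) ≤ 1 := by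
      calc _ ≤ 17 * L / (η * σd) * (η * (σd / (17 * L))) :=
            mul_le_mul_of_nonneg_right ht (by positivity)
        _ = 1 := by field_simp
    have a2 : 0 ≤ c * d * ε := by positivity
    nlinarith
  · rw [norm_transpose_mul_self, norm_transpose_mul_self]
    have a1 := pow_le_pow_left₀ (norm_nonneg _) hs.J_le 2
    have a2 := pow_le_pow_left₀ (norm_nonneg _) hs.K_le 2
    rw [mul_pow, Real.sq_sqrt (by positivity)] at a1 a2
    have a3 : max (m' : ℝ) d ≤ d + m' :=
      max_le (by linarith [(Nat.cast_nonneg d : (0 : ℝ) ≤ d)])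
        (by linarith [(Nat.cast_nonneg m' : (0 : ℝ) ≤ m')])
    have a4 : max (n' : ℝ) d ≤ d + n' :=
      max_le (by linarith [(Nat.cast_nonneg d : (0 : ℝ) ≤ d)])
        (by linarith [(Nat.cast_nonneg n' : (0 : ℝ) ≤ n')])
    have a5 : 0 ≤ (c * ε) ^ 2 := by positivity
    rw [hN]
    nlinarith

theorem WarmBounds.B_norm_le {l : ℝ} (h : Regime d c ε η σ₁ σd N L κ)
    (hb : WarmBounds c ε σ₁ σd N L σ X Y l) : ‖asymB X Y‖ ≤ 2 * √σ₁ := by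
  have := (norm_le_frobNorm _).trans hb.B_le
  linarith [h.beta_le, Real.sqrt_nonneg σ₁]

theorem WarmBounds.pertA_le {l : ℝ} (h : Regime d c ε η σ₁ σd N L κ)
    (hb : WarmBounds c ε σ₁ σd N L σ X Y l) :
    ‖pertA (symA X Y) (asymB X Y) ((lower X)ᵀ * lower X) ((lower Y)ᵀ * lower Y)‖ ≤
      14 * √σ₁ * (c ^ 2 * ε ^ 2 * d * N) :=
  (norm_pertA_le hb.A_le ((norm_le_frobNorm _).trans hb.B_le)
    (by linarith [h.beta_le, Real.sqrt_nonneg σ₁]) hb.JK_le).trans h.pertA_bound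

theorem WarmBounds.pertR_le {l : ℝ} (h : Regime d c ε η σ₁ σd N L κ)
    (hb : WarmBounds c ε σ₁ σd N L σ X Y l) :
    ‖pertR (diagonal σ - symA X Y * (symA X Y)ᵀ) (symA X Y)
      (pertA (symA X Y) (asymB X Y) ((lower X)ᵀ * lower X) ((lower Y)ᵀ * lower Y)) η‖ ≤
      η * (80 * σ₁ * (c ^ 2 * ε ^ 2 * d * N)) :=
  (norm_pertR_le h.η_pos.le hb.A_le hb.R_le (hb.pertA_le h)).trans
    (mul_le_mul_of_nonneg_left h.pertR_bound h.η_pos.le)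

theorem WarmBounds.step_size {l : ℝ} (h : Regime d c ε η σ₁ σd N L κ)
    (hb : WarmBounds c ε σ₁ σd N L σ X Y l) :
    ((1 / 8 : ℝ) • (1 : Matrix (Fin d) (Fin d) ℝ) -
      η • (symA X Y * (symA X Y)ᵀ)).PosSemidef := by
  refine posSemidef_smul_one_sub (by simp) ?_
  rw [norm_smul, Real.norm_of_nonneg h.η_pos.le, norm_self_mul_transpose]
  have a1 := pow_le_pow_left₀ (norm_nonneg _) hb.A_le 2
  rw [mul_pow, h.sq_sqrt_σ₁] at a1
  have := mul_le_mul_of_nonneg_left a1 h.η_pos.le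
  linarith [h.eta_sigma_le]

theorem WarmBounds.one_sub_posSemidef {l : ℝ} (h : Regime d c ε η σ₁ σd N L κ)
    (hb : WarmBounds c ε σ₁ σd N L σ X Y l) :
    (1 - η • (symA X Y * (symA X Y)ᵀ)).PosSemidef := by
  convert (hb.step_size h).add ((PosSemidef.one (n := Fin d) (R := ℝ)).smul
    (show (0 : ℝ) ≤ 7 / 8 by norm_num)) using 1
  module

theorem residual_eq_of_isStep {X' : Matrix (Fin (d + m')) (Fin d) ℝ}
    {Y' : Matrix (Fin (d + n')) (Fin d) ℝ} (hst : IsStep σ η X X' Y Y') :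
    diagonal σ - symA X' Y' * (symA X' Y')ᵀ =
      (1 - η • (symA X Y * (symA X Y)ᵀ)) * (diagonal σ - symA X Y * (symA X Y)ᵀ) *
        (1 - η • (symA X Y * (symA X Y)ᵀ)) -
      pertR (diagonal σ - symA X Y * (symA X Y)ᵀ) (symA X Y)
        (pertA (symA X Y) (asymB X Y) ((lower X)ᵀ * lower X) ((lower Y)ᵀ * lower Y)) η := by
  rw [hst.symA_eq]
  exact residual_step _ η (by simp) rfl

/-- The invariants support each other: the norm bounds control the perturbations, the lower bound on
`R` controls `B`, and small `B`, `J`, `K` keep the growth of `A` undisturbed. -/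
theorem WarmState.step (h : Regime d c ε η σ₁ σd N L κ) (hσd : ∀ i, σd ≤ σ i)
    (hσ₁ : ∀ i, σ i ≤ σ₁) (hN : N = (d + m' : ℝ) + (d + n')) {t : ℕ}
    (ht : (t : ℝ) ≤ 17 * L / (η * σd)) (hs : WarmState c ε η σ₁ σd N L σ t X Y)
    (hs0 : ε / (c * √d) ≤ √σd / 2)
    {X' : Matrix (Fin (d + m')) (Fin d) ℝ} {Y' : Matrix (Fin (d + n')) (Fin d) ℝ}
    (hst : IsStep σ η X X' Y Y') : WarmState c ε η σ₁ σd N L σ (t + 1) X' Y' := by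
  have hb := hs.bounds h hσ₁ hN ht
  have hη := h.η_pos
  have h2 := h.σd_pos; have h4 := h.σ₁_pos; have h6 := h.c_pos; have h7 := h.ε_pos
  have hBn := (norm_le_frobNorm _).trans hb.B_le
  have hβ := h.beta_le
  have hs1 := Real.sqrt_nonneg σ₁
  have hω : c ^ 2 * ε ^ 2 * N ≤ σ₁ := by
    linarith [h.omega_le, h.theta_le, h.σd_le]
  have hup : ∀ M : Matrix (Fin d) (Fin d) ℝ, ‖M‖ ≤ 3 * √σ₁ → ‖Mᵀ * M‖ ≤ 9 * σ₁ := by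
    intro M hM
    rw [norm_transpose_mul_self]
    have := pow_le_pow_left₀ (norm_nonneg _) hM 2
    rw [mul_pow, h.sq_sqrt_σ₁] at this
    linarith
  have hU : ‖upper X‖ ≤ 3 * √σ₁ := by
    rw [upper_left_eq X Y]
    have := norm_add_le (symA X Y) (asymB X Y)
    linarith [hb.A_le]
  have hV : ‖upper Y‖ ≤ 3 * √σ₁ := by
    rw [upper_right_eq X Y]
    have := norm_sub_le (symA X Y) (asymB X Y)
    linarith [hb.A_le]
  have hJ0 := norm_nonneg ((lower X)ᵀ * lower X)
  have hK0 := norm_nonneg ((lower Y)ᵀ * lower Y)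
  have hJK := hb.JK_le
  have hησ := h.eta_sigma_le
  constructor
  · rw [hst.lower_left]
    refine norm_lower_step hη.le
      ((posSemidef_transpose_mul_self _).add (posSemidef_transpose_mul_self _)) ?_ hs.J_le
    have a1 : ‖(upper Y)ᵀ * upper Y + (lower Y)ᵀ * lower Y‖ ≤ 10 * σ₁ :=
      (norm_add_le _ _).trans (by linarith [hup _ hV])
    have := mul_le_mul_of_nonneg_left a1 hη.le
    linarith
  · rw [hst.lower_right]
    refine norm_lower_step hη.le
      ((posSemidef_transpose_mul_self _).add (posSemidef_transpose_mul_self _)) ?_ hs.K_le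
    have a1 : ‖(upper X)ᵀ * upper X + (lower X)ᵀ * lower X‖ ≤ 10 * σ₁ :=
      (norm_add_le _ _).trans (by linarith [hup _ hU])
    have := mul_le_mul_of_nonneg_left a1 hη.le
    linarith
  · rw [hst.asymB_eq]
    have a1 := frobNorm_asymB_step hη.le hb.l_nonneg hb.A_le (hb.B_norm_le h) hb.R_le hb.R_ge
      hb.JK_le
    have a2 := mul_le_mul_of_nonneg_left
      (h.asymB_growth hb.l_le (frobNorm_nonneg _) hb.B_le) hη.le
    refine (a1.trans (add_le_add hs.B_le a2)).trans_eq ?_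
    push_cast
    ring
  · rw [residual_eq_of_isStep hst]
    have := residual_lower_step hb.l_nonneg hη.le (posSemidef_self_mul_transpose _)
      (hb.one_sub_posSemidef h) hb.R_ge (pertR_transpose _ _ _ (by simp)) (hb.pertR_le h)
    convert this using 3
    push_cast
    ring
  · intro v
    rw [hst.symA_eq]
    have hg : 1 ≤ (1 + η * σd / 4) ^ t := one_le_pow₀ (by
      have : 0 ≤ η * σd := by positivity
      linarith)
    have hd : 0 < √(d : ℝ) := Real.sqrt_pos.2 (by linarith [h.one_le_d])
    have hs0p : 0 < ε / (c * √d) := by positivity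
    set s0 := ε / (c * √d) with hs0def
    set s := min (s0 * (1 + η * σd / 4) ^ t) (√σd / 2) with hsdef
    have hss0 : s0 ≤ s := le_min (le_mul_of_one_le_right hs0p.le hg) hs0
    have hsσ : s ^ 2 ≤ σd / 4 := by
      have := pow_le_pow_left₀ (hs0p.le.trans hss0) (min_le_right (s0 * (1 + η * σd / 4) ^ t)
        (√σd / 2)) 2
      rw [div_pow, Real.sq_sqrt h2.le] at this
      linarith
    have hησd : η * σd ≤ 1 / 1000000 :=
      (mul_le_mul_of_nonneg_left h.σd_le hη.le).trans hησ
    have hE : η * ‖diagonal σ * (symA X Y * (symA X Y)ᵀ) * symA X Y‖ +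
        ‖pertA (symA X Y) (asymB X Y) ((lower X)ᵀ * lower X) ((lower Y)ᵀ * lower Y)‖ ≤
        22 * √σ₁ * (c ^ 2 * ε ^ 2 * d * N) := by
      have a1 := norm_diagonal_le h4.le (fun i => h2.le.trans (hσd i)) hσ₁
      have a2 := norm_mul_le_of_le (norm_mul_le_of_le a1 (norm_mul_le_of_le hb.A_le
        ((norm_transpose_matrix _).trans_le hb.A_le))) hb.A_le
      have a3 := mul_le_mul_of_nonneg_left a2 hη.le
      have e : η * (σ₁ * (2 * √σ₁ * (2 * √σ₁)) * (2 * √σ₁)) = 8 * √σ₁ * (η * σ₁ ^ 2) := by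
        calc _ = 8 * √σ₁ * (η * σ₁ * √σ₁ ^ 2) := by ring
          _ = _ := by rw [h.sq_sqrt_σ₁]; ring
      rw [e] at a3
      have a4 := mul_le_mul_of_nonneg_left h.η_le (show 0 ≤ 8 * √σ₁ by positivity)
      linarith [hb.pertA_le h]
    have hs2 : η * s ^ 2 ≤ η * (σd / 4) := mul_le_mul_of_nonneg_left hsσ hη.le
    have key := lower_bound_step hη.le (hs0p.le.trans hss0) (diagonal_sub_posSemidef hσd)
      (hb.step_size h) hs.A_ge (by linarith) hE v
    refine le_trans (mul_le_mul_of_nonneg_right ?_ (vnorm_nonneg v)) key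
    have hgrow : (1 + η * σd / 4) * s ≤ (1 + η * σd) * (1 - 2 * η * s ^ 2) * s -
        η * (22 * √σ₁ * (c ^ 2 * ε ^ 2 * d * N)) := by
      have b1 : η * (22 * √σ₁ * (c ^ 2 * ε ^ 2 * d * N)) ≤ η * σd / 8 * s := by
        have := mul_le_mul_of_nonneg_left h.pertA_le_growth hη.le
        have b2 : η * σd / 8 * s0 ≤ η * σd / 8 * s :=
          mul_le_mul_of_nonneg_left hss0 (by positivity)
        linarith
      have hx : 0 < η * σd := by positivity
      -- With `x = ησ_d` and `ηs² ≤ x/4`, the right side is at least `(1 + x)(1 - x/2)`, which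
      -- exceeds `1 + 3x/8` for small `x`. The perturbation uses up `x/8`, leaving the rate `x/4`.
      have b3 : 1 + η * σd / 4 + η * σd / 8 ≤ (1 + η * σd) * (1 - 2 * η * s ^ 2) := by
        nlinarith
      have := mul_le_mul_of_nonneg_right b3 (hs0p.le.trans hss0)
      linarith
    refine le_trans ?_ hgrow
    have hx : 0 < η * σd := by positivity
    -- Below the cap the bound gains the growth factor; at the cap it is merely kept.
    rcases min_choice (s0 * (1 + η * σd / 4) ^ t) (√σd / 2) with h0 | h0
    · refine (min_le_left _ _).trans_eq ?_
      rw [hsdef, h0, pow_succ]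
      ring
    · refine (min_le_right _ _).trans ?_
      rw [hsdef, h0]
      refine le_mul_of_one_le_left (by positivity) (by linarith)

theorem WarmState.zero (h : Regime d c ε η σ₁ σd N L κ) (hσd : ∀ i, σd ≤ σ i)
    (h0 : InitBound c ε X Y) :
    WarmState c ε η σ₁ σd N L σ 0 X Y ∧ ε / (c * √d) ≤ √σd / 2 := by
  have h2 := h.σd_pos; have h6 := h.c_pos; have h7 := h.ε_pos
  have hd : 0 < √(d : ℝ) := Real.sqrt_pos.2 (by linarith [h.one_le_d])
  have hA := h0.A_le
  rw [singVal_one_eq_norm h.d_pos] at hA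
  have hAn := (le_singVal_iff h.d_pos _ _).1 h0.le_A
  have hA2 : (c * √d * ε) ^ 2 ≤ σd / 4 := by
    rw [mul_pow, mul_pow, Real.sq_sqrt (by positivity)]
    have a1 := h.theta_le
    have a2 : c ^ 2 * ε ^ 2 * d * 1 ≤ c ^ 2 * ε ^ 2 * d * N :=
      mul_le_mul_of_nonneg_left (by linarith [h.two_le_N]) (by positivity)
    linarith
  have hs0 : ε / (c * √d) ≤ √σd / 2 := by
    have a1 : ε / (c * √d) ≤ c * √d * ε :=
      h0.le_A.trans ((singVal_le_singVal_one d _).trans h0.A_le)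
    refine a1.trans ((sq_le_sq₀ (by positivity) (by positivity)).1 ?_)
    rw [div_pow, Real.sq_sqrt h2.le]
    linarith
  refine ⟨⟨h0.J_le, h0.K_le, ?_, ?_, fun v => ?_⟩, hs0⟩
  · rw [Nat.cast_zero, zero_mul, add_zero, mul_one]
    exact h0.B_le
  -- At time zero `AAᵀ ≼ σ_d ≼ Σ`, so the residual starts out nonnegative.
  · have a1 : ‖symA X Y * (symA X Y)ᵀ‖ ≤ σd := by
      rw [norm_self_mul_transpose]
      have := pow_le_pow_left₀ (norm_nonneg _) hA 2
      linarith
    have a2 := (diagonal_sub_posSemidef hσd).add (posSemidef_smul_one_sub (by simp) a1)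
    convert a2 using 1
    rw [Nat.cast_zero, zero_mul, zero_smul]
    abel
  · rw [pow_zero, mul_one, min_eq_left hs0]
    exact lower_bound_transpose hAn v

variable {X : ℕ → Matrix (Fin (d + m')) (Fin d) ℝ} {Y : ℕ → Matrix (Fin (d + n')) (Fin d) ℝ}

theorem warmState_of_le (h : Regime d c ε η σ₁ σd N L κ) (hσd : ∀ i, σd ≤ σ i)
    (hσ₁ : ∀ i, σ i ≤ σ₁) (hN : N = (d + m' : ℝ) + (d + n'))
    (hst : ∀ t, IsStep σ η (X t) (X (t + 1)) (Y t) (Y (t + 1)))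
    (h0 : InitBound c ε (X 0) (Y 0)) (t : ℕ) (ht : (t : ℝ) ≤ 17 * L / (η * σd)) :
    WarmState c ε η σ₁ σd N L σ t (X t) (Y t) := by
  induction t with
  | zero => exact (WarmState.zero h hσd h0).1
  | succ t ih =>
    have ht' : (t : ℝ) ≤ 17 * L / (η * σd) := by
      push_cast at ht
      linarith
    exact (ih ht').step h hσd hσ₁ hN ht' (WarmState.zero h hσd h0).2 (hst t)

/-- The rate is at least `exp(ησ_d/8)` per step, so `8L/(ησ_d)` steps multiply by `exp L = dσ_d/ε²`.
This lifts `ε/(c√d)` to `√d σ_d/(cε)`, above the cap because `cε ≤ √σ_d`. -/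
theorem half_sqrt_le_growth (h : Regime d c ε η σ₁ σd N L κ) {t : ℕ}
    (ht : 8 * L / (η * σd) ≤ t) :
    √σd / 2 ≤ ε / (c * √d) * (1 + η * σd / 4) ^ t := by
  have hη := h.η_pos
  have h2 := h.σd_pos; have h6 := h.c_pos; have h7 := h.ε_pos; have h1 := h.one_le_d
  have hd : 0 < √(d : ℝ) := Real.sqrt_pos.2 (by linarith)
  have hd2 : √(d : ℝ) ^ 2 = d := Real.sq_sqrt (by linarith)
  have hx : 0 < η * σd := by positivity
  have hx1 : η * σd ≤ 1 / 1000000 :=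
    (mul_le_mul_of_nonneg_left h.σd_le hη.le).trans h.eta_sigma_le
  have a1 : Real.exp L ≤ (1 + η * σd / 4) ^ t := by
    have b1 : Real.exp (η * σd / 8) ≤ 1 + η * σd / 4 := by
      have := Real.exp_bound_div_one_sub_of_interval (x := η * σd / 8) (by positivity)
        (by linarith)
      refine this.trans ?_
      rw [div_le_iff₀ (by linarith)]
      nlinarith
    refine le_trans ?_ (pow_le_pow_left₀ (Real.exp_pos _).le b1 t)
    rw [← Real.exp_nat_mul, Real.exp_le_exp]
    rw [div_le_iff₀ hx] at ht
    linarith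
  have a2 := mul_le_mul_of_nonneg_left a1 (show 0 ≤ ε / (c * √d) by positivity)
  refine le_trans ?_ a2
  rw [h.exp_L]
  have e : ε / (c * √d) * (d * σd / ε ^ 2) = √d * σd / (c * ε) := by
    rw [div_mul_div_comm, div_eq_div_iff (by positivity) (by positivity)]
    nth_rewrite 1 [← hd2]
    ring
  rw [e, le_div_iff₀ (by positivity)]
  have a3 : c * ε ≤ √σd := by
    refine Real.le_sqrt_of_sq_le ?_
    have b1 := h.theta_le
    have b2 : 1 ≤ d * N := by nlinarith [h.two_le_N]
    have b3 : c ^ 2 * ε ^ 2 * 1 ≤ c ^ 2 * ε ^ 2 * (d * N) :=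
      mul_le_mul_of_nonneg_left b2 (by positivity)
    rw [mul_pow]
    linarith
  have a4 : 1 ≤ √(d : ℝ) := Real.one_le_sqrt.2 h1
  have a5 : √σd ^ 2 = σd := Real.sq_sqrt h2.le
  have a6 : √σd / 2 * (c * ε) ≤ √σd / 2 * √σd := by gcongr
  nlinarith

/-- After time `T` the lower bound on `A` sits at its cap, so `AAᵀ ≽ σ_d/4` and `‖R‖` obeys `x ↦ (1
- ησ_d/4)x + 80ησ₁θ`. The additive term `320σ₁θ/σ_d` is the fixed point of this map. -/
theorem residual_decay (h : Regime d c ε η σ₁ σd N L κ) (hσd : ∀ i, σd ≤ σ i)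
    (hσ₁ : ∀ i, σ i ≤ σ₁) (hN : N = (d + m' : ℝ) + (d + n'))
    (hst : ∀ t, IsStep σ η (X t) (X (t + 1)) (Y t) (Y (t + 1)))
    (h0 : InitBound c ε (X 0) (Y 0)) {T : ℕ} (hT : 8 * L / (η * σd) ≤ T) (s : ℕ)
    (hs : ((T + s : ℕ) : ℝ) ≤ 17 * L / (η * σd)) :
    ‖diagonal σ - symA (X (T + s)) (Y (T + s)) * (symA (X (T + s)) (Y (T + s)))ᵀ‖ ≤
      (1 - η * (σd / 4)) ^ s * σ₁ + 320 * σ₁ * (c ^ 2 * ε ^ 2 * d * N) / σd := by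
  have h2 := h.σd_pos; have h3 := h.theta_pos; have h4 := h.σ₁_pos; have hη := h.η_pos
  induction s with
  | zero =>
    have hb := (warmState_of_le h hσd hσ₁ hN hst h0 T hs).bounds h hσ₁ hN hs
    have : 0 ≤ 320 * σ₁ * (c ^ 2 * ε ^ 2 * d * N) / σd := by positivity
    simpa using hb.R_le.trans (by linarith)
  | succ s ih =>
    have hs' : ((T + s : ℕ) : ℝ) ≤ 17 * L / (η * σd) := by
      push_cast at hs ⊢
      linarith
    have hw := warmState_of_le h hσd hσ₁ hN hst h0 (T + s) hs'
    have hb := hw.bounds h hσ₁ hN hs'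
    have hA : (symA (X (T + s)) (Y (T + s)) * (symA (X (T + s)) (Y (T + s)))ᵀ -
        (σd / 4) • (1 : Matrix (Fin d) (Fin d) ℝ)).PosSemidef := by
      have a1 : 8 * L / (η * σd) ≤ ((T + s : ℕ) : ℝ) := by
        push_cast
        linarith [(Nat.cast_nonneg s : (0 : ℝ) ≤ s)]
      have a2 := hw.A_ge
      rw [min_eq_right (half_sqrt_le_growth h a1)] at a2
      have a3 := (posSemidef_mul_transpose_sub_iff (by positivity)).2 a2
      rw [div_pow, Real.sq_sqrt h2.le] at a3
      convert a3 using 3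
      norm_num
    have hx1 : η * σd ≤ 1 / 1000000 :=
      (mul_le_mul_of_nonneg_left h.σd_le hη.le).trans h.eta_sigma_le
    have := residual_norm_step hη.le (by positivity) (by linarith) hA (hb.one_sub_posSemidef h)
      (ih hs') (hb.pertR_le h)
    rw [← residual_eq_of_isStep (hst (T + s))] at this
    refine this.trans_eq ?_
    field_simp
    ring

/-- The warm-up stage for an initialization that obeys the bounds. -/
theorem warm_up (h : Regime d c ε η σ₁ σd N L κ) (hσd : ∀ i, σd ≤ σ i)
    (hσ₁ : ∀ i, σ i ≤ σ₁) (hN : N = (d + m' : ℝ) + (d + n'))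
    (hst : ∀ t, IsStep σ η (X t) (X (t + 1)) (Y t) (Y (t + 1)))
    (h0 : InitBound c ε (X 0) (Y 0)) {T : ℕ} (hT : 8 * L / (η * σd) ≤ T)
    (hT2 : ((T + T : ℕ) : ℝ) ≤ 17 * L / (η * σd)) :
    (∀ t ≤ T + T,
      Loewner ((ε ^ 2 / (c ^ 2 * d)) • (1 : Matrix (Fin d) (Fin d) ℝ))
        (symA (X t) (Y t) * (symA (X t) (Y t)).transpose) ∧
      Loewner (symA (X t) (Y t) * (symA (X t) (Y t)).transpose)
        ((2 : ℝ) • Matrix.diagonal σ) ∧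
      frobNorm (asymB (X t) (Y t)) ≤ 2 * c * d * ε ∧
      opNorm (lower (X t)) ≤ c * ε * √(max (m' : ℝ) d) ∧
      opNorm (lower (Y t)) ≤ c * ε * √(max (n' : ℝ) d)) ∧
    √(σd / 2) ≤ singVal d (symA (X (T + T)) (Y (T + T))) ∧
    singVal 1 (errP σ (X (T + T)) (Y (T + T))) ≤ σd / 4 := by
  have h2 := h.σd_pos; have h3 := h.theta_pos; have h4 := h.σ₁_pos; have hη := h.η_pos
  have h6 := h.c_pos; have h7 := h.ε_pos; have h1 := h.one_le_d; have h8 := h.le_L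
  have hd : 0 < √(d : ℝ) := Real.sqrt_pos.2 (by linarith)
  have hx : 0 < η * σd := by positivity
  have hx1 : η * σd ≤ 1 / 1000000 :=
    (mul_le_mul_of_nonneg_left h.σd_le hη.le).trans h.eta_sigma_le
  have hR : ‖diagonal σ - symA (X (T + T)) (Y (T + T)) * (symA (X (T + T)) (Y (T + T)))ᵀ‖ ≤
      σd / 16 := by
    refine (residual_decay h hσd hσ₁ hN hst h0 hT T hT2).trans ?_
    have a1 : 320 * σ₁ * (c ^ 2 * ε ^ 2 * d * N) / σd ≤ σd / 32 := by
      rw [div_le_iff₀ h2]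
      have b1 := h.sigma_theta_le
      have b2 : 1 * (σ₁ * (c ^ 2 * ε ^ 2 * d * N)) ≤
          L ^ 2 * (σ₁ * (c ^ 2 * ε ^ 2 * d * N)) :=
        mul_le_mul_of_nonneg_right (by nlinarith) (by positivity)
      have b3 : κ ^ 2 * σd ^ 2 ≤ 1 / 1000000 * σd ^ 2 :=
        mul_le_mul_of_nonneg_right h.κ_sq_le (by positivity)
      nlinarith
    have a2 : (1 - η * (σd / 4)) ^ T * σ₁ ≤ σd / 32 := by
      have b1 : (1 - η * (σd / 4)) ^ T ≤ Real.exp (-(2 * L)) := by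
        have c1 : 1 - η * (σd / 4) ≤ Real.exp (-(η * (σd / 4))) := by
          have := Real.add_one_le_exp (-(η * (σd / 4)))
          linarith
        refine (pow_le_pow_left₀ (by linarith) c1 T).trans ?_
        rw [← Real.exp_nat_mul, Real.exp_le_exp]
        rw [div_le_iff₀ hx] at hT
        linarith
      -- One of the two factors `exp(-L)` pays for the ratio `σ₁/σ_d`; the other is at most `exp(-4)
      -- ≤ 1/32`.
      have b2 : Real.exp (-(2 * L)) * σ₁ ≤ Real.exp (-L) * σd := by
        calc _ ≤ Real.exp (-(2 * L)) * (Real.exp L * σd) :=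
              mul_le_mul_of_nonneg_left h.sigma_le_exp (Real.exp_pos _).le
          _ = _ := by rw [← mul_assoc, ← Real.exp_add]; ring_nf
      have b3 : Real.exp (-L) ≤ 1 / 32 := by
        rw [Real.exp_neg, ← one_div]
        refine one_div_le_one_div_of_le (by norm_num) ?_
        have c1 : Real.exp 4 ≤ Real.exp L := Real.exp_le_exp.2 h8
        have c2 : (2.7 : ℝ) ^ 4 ≤ Real.exp 1 ^ 4 :=
          pow_le_pow_left₀ (by norm_num) (by linarith [Real.exp_one_gt_d9]) 4
        rw [← Real.exp_nat_mul] at c2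
        norm_num at c2
        linarith
      have b4 := mul_le_mul_of_nonneg_right b1 h4.le
      have b5 := mul_le_mul_of_nonneg_right b3 h2.le
      linarith
    linarith
  refine ⟨fun t ht => ?_, ?_, ?_⟩
  · have ht' : (t : ℝ) ≤ 17 * L / (η * σd) := le_trans (by exact_mod_cast ht) hT2
    have hw := warmState_of_le h hσd hσ₁ hN hst h0 t ht'
    have hb := hw.bounds h hσ₁ hN ht'
    refine ⟨?_, ?_, hb.B_le, hw.J_le, hw.K_le⟩
    · have a1 : (ε / (c * √d)) ^ 2 = ε ^ 2 / (c ^ 2 * d) := by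
        rw [div_pow, mul_pow, Real.sq_sqrt (by positivity)]
      rw [Loewner, ← a1, posSemidef_mul_transpose_sub_iff (by positivity)]
      intro v
      refine le_trans (mul_le_mul_of_nonneg_right (le_min ?_ ?_) (vnorm_nonneg v)) (hw.A_ge v)
      · exact le_mul_of_one_le_right (by positivity) (one_le_pow₀ (by linarith))
      · exact (WarmState.zero h hσd h0).2
    · have a1 := hb.R_ge
      have a2 := hb.l_le.trans h.residual_loss_le
      set l := (t : ℝ) * (η * (80 * σ₁ * (c ^ 2 * ε ^ 2 * d * N)))
      have := (a1.add (diagonal_sub_posSemidef hσd)).add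
        ((PosSemidef.one (n := Fin d) (R := ℝ)).smul (show 0 ≤ σd - l by linarith))
      rw [Loewner]
      convert this using 1
      module
  · rw [le_singVal_iff h.d_pos]
    -- `AAᵀ = Σ - R ≽ σ_d - σ_d/16 ≽ σ_d/2`.
    have a1 : (symA (X (T + T)) (Y (T + T)) * (symA (X (T + T)) (Y (T + T)))ᵀ -
        √(σd / 2) ^ 2 • (1 : Matrix (Fin d) (Fin d) ℝ)).PosSemidef := by
      rw [Real.sq_sqrt (by positivity)]
      have := ((posSemidef_smul_one_sub (by simp) hR).add (diagonal_sub_posSemidef hσd)).add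
        ((PosSemidef.one (n := Fin d) (R := ℝ)).smul (show 0 ≤ σd / 2 - σd / 16 by linarith))
      convert this using 1
      module
    intro v
    have := lower_bound_transpose (A := (symA (X (T + T)) (Y (T + T)))ᵀ)
      ((posSemidef_mul_transpose_sub_iff (Real.sqrt_nonneg _)).1 a1) v
    rwa [transpose_transpose] at this
  · rw [singVal_one_eq_norm h.d_pos, errP]
    have hw := warmState_of_le h hσd hσ₁ hN hst h0 (T + T) hT2
    have hb := hw.bounds h hσ₁ hN hT2
    have a1 := (norm_le_frobNorm _).trans hb.B_le
    have a2 := pow_le_pow_left₀ (norm_nonneg _) a1 2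
    rw [← norm_self_mul_transpose] at a2
    refine (norm_add_le _ _).trans ?_
    linarith [h.beta_sq_le, h.theta_le]

end WarmUp

/-! ### From the hypotheses on `ε` and `η` to the regime. -/

section Parameters

/-- The quantity `L` depends on `ε` itself, so a bound on `yL` is not immediate. Its part `y log M`
is covered by `Λ`, and `y log(1/y) ≤ 2√y ≤ 2u` handles the rest; the square root is the reason for
the hypothesis with `u²`. -/
theorem le_mul_log_bound {y M u Λ L E : ℝ} (hy : 0 < y) (hM : 1 ≤ M) (hu : 0 ≤ u) (hu1 : u ≤ 1)
    (hΛ : Λ = 1 + Real.log M) (hyu : y * Λ ≤ u ^ 2) (hE : 0 < E) (hL : L = Real.log E)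
    (hEM : E ≤ M ^ 6 * (1 / y) ^ 2) : L * y ≤ 10 * u := by
  have hlog : 0 ≤ Real.log M := Real.log_nonneg hM
  have hyu' : y ≤ u ^ 2 := by nlinarith
  have h1 : L ≤ 6 * Real.log M + 2 * Real.log (1 / y) := by
    rw [hL]
    refine (Real.log_le_log hE hEM).trans_eq ?_
    rw [Real.log_mul (by positivity) (by positivity), Real.log_pow, Real.log_pow]
    push_cast
    ring
  have hsq : 0 < √y := Real.sqrt_pos.2 hy
  have hsqy : √y ^ 2 = y := Real.sq_sqrt hy.le
  have h2 : Real.log (1 / y) ≤ 2 * (1 / √y) := by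
    have e : 1 / y = (1 / √y) ^ 2 := by rw [div_pow, hsqy, one_pow]
    rw [e, Real.log_pow]
    push_cast
    have := Real.log_le_sub_one_of_pos (show 0 < 1 / √y by positivity)
    linarith
  have h3 : √y ≤ u := (Real.sqrt_le_sqrt hyu').trans_eq (Real.sqrt_sq hu)
  have h4 : 1 / √y * y = √y := by
    nth_rewrite 2 [← hsqy]
    field_simp
  calc L * y ≤ (6 * Real.log M + 2 * (2 * (1 / √y))) * y := by
        refine mul_le_mul_of_nonneg_right ?_ hy.le
        linarith
    _ = 6 * (y * Real.log M) + 4 * (1 / √y * y) := by ring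
    _ = 6 * (y * Real.log M) + 4 * √y := by rw [h4]
    _ ≤ 6 * u ^ 2 + 4 * u := by
        have : y * Real.log M ≤ u ^ 2 := by
          rw [hΛ] at hyu
          nlinarith
        linarith
    _ ≤ 10 * u := by nlinarith

/-- The constants of the theorem put the parameters into the regime of the analysis. -/
theorem regime_of_le {d : ℕ} {c ε η σ₁ σd N κ u : ℝ} (hd : 0 < d) (hc : 0 < c) (hε : 0 < ε)
    (hη : 0 < η) (hσd : 0 < σd) (hσ : σd ≤ σ₁) (hN : 2 * (d : ℝ) ≤ N) (hκ : 0 < κ)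
    (hκ1 : κ ≤ 1 / 1000) (hκ2 : 200 * κ * c ^ 2 ≤ 1) (hκ3 : κ ≤ c) (hu0 : 0 < u)
    (hu1 : u ≤ 1 / 10) (hu2 : 10 * u * c ≤ κ)
    (hεle : ε ≤ u ^ 2 * (σd / (√((d : ℝ) ^ 3 * σ₁) * N)) / (1 + Real.log (N * (σ₁ / σd))) ^ 1)
    (hηle : η ≤ c ^ 2 * (σd * ε ^ 2 / (d * σ₁ ^ 3))) :
    Regime d c ε η σ₁ σd N (Real.log (d * σd / ε ^ 2)) κ := by
  have hd1 : (1 : ℝ) ≤ d := by exact_mod_cast hd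
  have hσ₁ : 0 < σ₁ := hσd.trans_le hσ
  have hN0 : 2 ≤ N := by linarith
  have hsd : 0 < √(d : ℝ) := Real.sqrt_pos.2 (by linarith)
  have hsd2 : √(d : ℝ) ^ 2 = d := Real.sq_sqrt (by linarith)
  have hs1 : 0 < √σ₁ := Real.sqrt_pos.2 hσ₁
  have hs12 : √σ₁ ^ 2 = σ₁ := Real.sq_sqrt hσ₁.le
  have hratio : 1 ≤ σ₁ / σd := (one_le_div hσd).2 hσ
  have hM : 1 ≤ N * (σ₁ / σd) := by nlinarith
  set M := N * (σ₁ / σd) with hMdef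
  have hΛ : 1 ≤ 1 + Real.log M := by linarith [Real.log_nonneg hM]
  have hsqrt : √((d : ℝ) ^ 3 * σ₁) = d * √d * √σ₁ := by
    rw [Real.sqrt_mul (by positivity), show (d : ℝ) ^ 3 = d ^ 2 * d by ring,
      Real.sqrt_mul (by positivity), Real.sqrt_sq (by positivity)]
  rw [hsqrt, pow_one] at hεle
  -- The rescaled initialization size: the hypothesis on `ε` says `yΛ ≤ u²`, and `ε_le` asks for
  -- `cLy ≤ κ`.
  set y := ε * (d * √d * √σ₁ * N) / σd with hy
  have hy0 : 0 < y := by positivity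
  have hyΛ : y * (1 + Real.log M) ≤ u ^ 2 := by
    rw [le_div_iff₀ (by linarith)] at hεle
    rw [hy, div_mul_eq_mul_div, div_le_iff₀ hσd]
    have := mul_le_mul_of_nonneg_right hεle (show 0 ≤ d * √d * √σ₁ * N by positivity)
    have e : u ^ 2 * (σd / (d * √d * √σ₁ * N)) * (d * √d * √σ₁ * N) = u ^ 2 * σd := by
      field_simp
    linarith
  have hyu : y ≤ u ^ 2 := by nlinarith
  have hE : d * σd / ε ^ 2 = d ^ 4 * (σ₁ / σd) * N ^ 2 * (1 / y) ^ 2 := by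
    have e1 : y ^ 2 = ε ^ 2 * (d ^ 3 * σ₁ * N ^ 2) / σd ^ 2 := by
      rw [hy, div_pow, mul_pow, mul_pow, mul_pow, mul_pow, hsd2, hs12]
      ring
    rw [div_pow, e1]
    field_simp
  have hE0 : 0 < d * σd / ε ^ 2 := by positivity
  have hEle : d * σd / ε ^ 2 ≤ M ^ 6 * (1 / y) ^ 2 := by
    rw [hE]
    refine mul_le_mul_of_nonneg_right ?_ (by positivity)
    have b1 : (d : ℝ) ^ 4 ≤ N ^ 4 := pow_le_pow_left₀ (by positivity) (by linarith) 4
    have b2 : σ₁ / σd ≤ (σ₁ / σd) ^ 6 := le_self_pow₀ hratio (by norm_num)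
    calc (d : ℝ) ^ 4 * (σ₁ / σd) * N ^ 2 ≤ N ^ 4 * (σ₁ / σd) ^ 6 * N ^ 2 := by gcongr
      _ = M ^ 6 := by rw [hMdef]; ring
  have hLy := le_mul_log_bound hy0 hM hu0.le (by linarith) rfl hyΛ hE0 rfl hEle
  refine ⟨hd, hc, hε, hη, hσd, hσ, hN, rfl, ?_, hκ, hκ1, hκ2, hκ3, ?_, ?_⟩
  · rw [Real.le_log_iff_exp_le hE0, hE]
    have b1 : 1 ≤ (d : ℝ) ^ 4 * (σ₁ / σd) * N ^ 2 := by
      have c1 : (1 : ℝ) ≤ (d : ℝ) ^ 4 := one_le_pow₀ hd1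
      have c2 : (1 : ℝ) ≤ N ^ 2 := one_le_pow₀ (by linarith)
      have c3 := one_le_mul_of_one_le_of_one_le c1 hratio
      exact one_le_mul_of_one_le_of_one_le c3 c2
    have b2 : 10 ≤ 1 / y := by
      rw [le_div_iff₀ hy0]
      nlinarith
    have b3 : (10 : ℝ) ^ 2 ≤ (1 / y) ^ 2 := pow_le_pow_left₀ (by norm_num) b2 2
    have b4 : Real.exp 1 ^ 4 ≤ (2.8 : ℝ) ^ 4 :=
      pow_le_pow_left₀ (Real.exp_pos 1).le (by linarith [Real.exp_one_lt_d9]) 4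
    rw [← Real.exp_nat_mul] at b4
    norm_num at b4
    nlinarith
  · have e : Real.log (d * σd / ε ^ 2) * √σ₁ * c * ε * (d * √d) * N =
        Real.log (d * σd / ε ^ 2) * y * (c * σd) := by
      have e1 : y * σd = ε * (d * √d * √σ₁ * N) := by rw [hy, div_mul_cancel₀ _ hσd.ne']
      calc _ = Real.log (d * σd / ε ^ 2) * (ε * (d * √d * √σ₁ * N)) * c := by ring
        _ = Real.log (d * σd / ε ^ 2) * (y * σd) * c := by rw [e1]
        _ = _ := by ring
    rw [e]
    have := mul_le_mul_of_nonneg_right hLy (show 0 ≤ c * σd by positivity)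
    have b := mul_le_mul_of_nonneg_right hu2 hσd.le
    linarith
  · have b1 := mul_le_mul_of_nonneg_right hηle (show 0 ≤ σ₁ ^ 2 by positivity)
    have e : c ^ 2 * (σd * ε ^ 2 / (d * σ₁ ^ 3)) * σ₁ ^ 2 = c ^ 2 * ε ^ 2 * (σd / (d * σ₁)) := by
      field_simp
    rw [e] at b1
    refine b1.trans ?_
    rw [mul_assoc (c ^ 2 * ε ^ 2)]
    refine mul_le_mul_of_nonneg_left ?_ (by positivity)
    have b2 : σd / (d * σ₁) ≤ 1 := by
      rw [div_le_one (by positivity)]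
      exact hσ.trans (le_mul_of_one_le_left hσ₁.le hd1)
    exact b2.trans (one_le_mul_of_one_le_of_one_le hd1 (by linarith))

end Parameters

/-! ### Choice of constants for part (a). -/

section WarmUpTheorem

theorem warm_up_stage (c : ℝ) (hc : 0 < c) : ∃ k₁ k₂ C : ℝ, 0 < k₁ ∧ 0 < k₂ ∧ 0 < C ∧
    ∀ (d m' n' : ℕ) (hd : 0 < d)
      (S : Matrix (Fin (d + m')) (Fin (d + n')) ℝ) (σ : Fin d → ℝ)
      (Φ : Matrix (Fin (d + m')) (Fin (d + m')) ℝ)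
      (Ψ : Matrix (Fin (d + n')) (Fin (d + n')) ℝ) (_ : IsSVD S σ Φ Ψ)
      (m n σ₁ σd ε η : ℝ)
      (_ : m = d + m') (_ : n = d + n')
      (_ : σ₁ = σ ⟨0, hd⟩) (_ : σd = σ ⟨d - 1, Nat.sub_lt hd one_pos⟩)
      (_ : 0 < ε)
      (_ : ε ≤ k₁ * (σd / (√((d : ℝ) ^ 3 * σ₁) * (m + n)))
        / (1 + Real.log ((m + n) * (σ₁ / σd))) ^ 1)
      (_ : 0 < η) (_ : η ≤ k₂ * (σd * ε ^ 2 / (d * σ₁ ^ 3))),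
      ∃ T₀ : ℕ, (T₀ : ℝ) ≤ C * (1 / (η * σd) * Real.log (d * σd / ε ^ 2)) ∧
        ∀ (U₀ : Matrix (Fin (d + m')) (Fin d) ℝ) (V₀ : Matrix (Fin (d + n')) (Fin d) ℝ)
          (X : ℕ → Matrix (Fin (d + m')) (Fin d) ℝ)
          (Y : ℕ → Matrix (Fin (d + n')) (Fin d) ℝ),
          (∀ t, X t = Φ.transpose * (gd S η U₀ V₀ t).1) →
          (∀ t, Y t = Ψ.transpose * (gd S η U₀ V₀ t).2) →
          InitBound c ε (X 0) (Y 0) →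
          (∀ t ≤ T₀,
            Loewner ((ε ^ 2 / (c ^ 2 * d)) • (1 : Matrix (Fin d) (Fin d) ℝ))
              (symA (X t) (Y t) * (symA (X t) (Y t)).transpose) ∧
            Loewner (symA (X t) (Y t) * (symA (X t) (Y t)).transpose)
              ((2 : ℝ) • Matrix.diagonal σ) ∧
            frobNorm (asymB (X t) (Y t)) ≤ 2 * c * d * ε ∧
            opNorm (lower (X t)) ≤ c * ε * √(max (m' : ℝ) d) ∧
            opNorm (lower (Y t)) ≤ c * ε * √(max (n' : ℝ) d)) ∧
          √(σd / 2) ≤ singVal d (symA (X T₀) (Y T₀)) ∧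
          singVal 1 (errP σ (X T₀) (Y T₀)) ≤ σd / 4 := by
  obtain ⟨κ, hκ0, hκ1, hκ2, hκ3⟩ : ∃ κ : ℝ, 0 < κ ∧ κ ≤ 1 / 1000 ∧ 200 * κ * c ^ 2 ≤ 1 ∧ κ ≤ c := by
    refine ⟨min (1 / 1000) (min (1 / (200 * c ^ 2)) c), by positivity, min_le_left _ _, ?_,
      (min_le_right _ _).trans (min_le_right _ _)⟩
    have : min (1 / 1000) (min (1 / (200 * c ^ 2)) c) ≤ 1 / (200 * c ^ 2) :=
      (min_le_right _ _).trans (min_le_left _ _)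
    rw [le_div_iff₀ (by positivity)] at this
    linarith
  obtain ⟨u, hu0, hu1, hu2⟩ : ∃ u : ℝ, 0 < u ∧ u ≤ 1 / 10 ∧ 10 * u * c ≤ κ := by
    refine ⟨min (1 / 10) (κ / (10 * c)), by positivity, min_le_left _ _, ?_⟩
    have := min_le_right (1 / 10) (κ / (10 * c))
    rw [le_div_iff₀ (by positivity)] at this
    linarith
  -- `k₁ = u²` gives `Ly ≤ 10u ≤ κ/c`, and `k₂ = c²` gives `ησ₁² ≤ c²ε² ≤ θ`.
  refine ⟨u ^ 2, c ^ 2, 17, by positivity, by positivity, by norm_num, ?_⟩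
  intro d m' n' hd S σ Φ Ψ hsvd m n σ₁ σd ε η hm hn hσ₁ hσd hε hεle hη hηle
  have hlow : ∀ i, σd ≤ σ i := fun i => by
    rw [hσd]
    exact hsvd.antitone (Fin.le_def.2 (Nat.le_sub_one_of_lt i.isLt))
  have hupp : ∀ i, σ i ≤ σ₁ := fun i => by
    rw [hσ₁]
    exact hsvd.antitone (Fin.le_def.2 (Nat.zero_le _))
  have hσd0 : 0 < σd := by rw [hσd]; exact hsvd.pos _
  have hreg : Regime d c ε η σ₁ σd (m + n) (Real.log (d * σd / ε ^ 2)) κ := by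
    refine regime_of_le hd hc hε hη hσd0 ((hlow ⟨0, hd⟩).trans (hupp _)) ?_ hκ0 hκ1 hκ2 hκ3 hu0
      hu1 hu2 hεle hηle
    rw [hm, hn]
    linarith [(Nat.cast_nonneg m' : (0 : ℝ) ≤ m'), (Nat.cast_nonneg n' : (0 : ℝ) ≤ n')]
  set L := Real.log (d * σd / ε ^ 2)
  have hx : 0 < η * σd := by positivity
  have hT : 8 * L / (η * σd) ≤ (⌈8 * L / (η * σd)⌉₊ : ℕ) := Nat.le_ceil _
  -- Two phases take `16L/(ησ_d)` plus at most `2` for rounding, and `2 ≤ L/(ησ_d)`; hence `17`.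
  have hT2 : ((⌈8 * L / (η * σd)⌉₊ + ⌈8 * L / (η * σd)⌉₊ : ℕ) : ℝ) ≤ 17 * L / (η * σd) := by
    have h8 := hreg.le_L
    have a1 := Nat.ceil_lt_add_one (show 0 ≤ 8 * L / (η * σd) by positivity)
    have a2 : 2 ≤ L / (η * σd) := by
      rw [le_div_iff₀ hx]
      have : η * σd ≤ 1 / 1000000 :=
        (mul_le_mul_of_nonneg_left hreg.σd_le hη.le).trans hreg.eta_sigma_le
      linarith
    push_cast
    have e1 : 8 * L / (η * σd) = 8 * (L / (η * σd)) := by ring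
    have e2 : 17 * L / (η * σd) = 17 * (L / (η * σd)) := by ring
    rw [e1] at a1 ⊢
    rw [e2]
    linarith
  refine ⟨⌈8 * L / (η * σd)⌉₊ + ⌈8 * L / (η * σd)⌉₊, hT2.trans_eq (by ring), ?_⟩
  intro U₀ V₀ X Y hX hY h0
  exact warm_up hreg hlow hupp (by rw [hm, hn]) (isStep_of_gd hsvd hX hY) h0 hT hT2

end WarmUpTheorem

/-! ### Gaussian vectors and matrices, and their invariances. -/

section GaussianMeasures

/-- The standard Gaussian measure on coordinate vectors. -/
def gVec (n : ℕ) : Measure (Fin n → ℝ) := Measure.pi fun _ => gaussianReal 0 1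

/-- The law of a matrix with independent standard Gaussian entries. -/
def gMat (m d : ℕ) : Measure (Fin m → Fin d → ℝ) := Measure.pi fun _ => gVec d

instance (n : ℕ) : IsProbabilityMeasure (gVec n) := by unfold gVec; infer_instance

instance (m d : ℕ) : IsProbabilityMeasure (gMat m d) := by unfold gMat; infer_instance

theorem measurePreserving_pi_comp {ι κ α : Type*} [Fintype ι] [Fintype κ] [MeasurableSpace α]
    (μ : Measure α) [IsProbabilityMeasure μ] {f : κ → ι} (hf : Function.Injective f) :
    MeasurePreserving (fun (w : ι → α) (k : κ) => w (f k)) (Measure.pi fun _ => μ)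
      (Measure.pi fun _ => μ) := by
  refine ⟨by fun_prop, ?_⟩
  have h := iIndepFun_pi (μ := fun _ : ι => μ) (X := fun _ => id) fun _ => aemeasurable_id
  have h2 := (h.precomp hf).map_fun_eq_pi_map
    (fun k => (measurable_pi_apply (f k)).aemeasurable)
  rw [h2]
  congr 1
  funext k
  exact (measurePreserving_eval (fun _ : ι => μ) (f k)).map_eq

theorem measurePreserving_upper (d k : ℕ) :
    MeasurePreserving (fun (w : Fin (d + k) → Fin d → ℝ) (i : Fin d) => w (Fin.castAdd k i))
      (gMat (d + k) d) (gMat d d) :=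
  measurePreserving_pi_comp _ (Fin.castAdd_injective d k)

theorem measurePreserving_lower (d k : ℕ) :
    MeasurePreserving (fun (w : Fin (d + k) → Fin d → ℝ) (i : Fin k) => w (Fin.natAdd d i))
      (gMat (d + k) d) (gMat k d) :=
  measurePreserving_pi_comp _ (Fin.natAdd_injective k d)

theorem measurePreserving_uncurry (m d : ℕ) :
    MeasurePreserving (fun (w : Fin m → Fin d → ℝ) (p : Fin m × Fin d) => w p.1 p.2)
      (gMat m d) (Measure.pi fun _ : Fin m × Fin d => gaussianReal 0 1) := by
  refine ⟨by fun_prop, ?_⟩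
  have h := Measure.infinitePi_map_curry_symm
    (fun (_ : Fin m) (_ : Fin d) => gaussianReal (0 : ℝ) 1)
  simp only [Measure.infinitePi_eq_pi] at h
  exact h

theorem measurePreserving_curry (m d : ℕ) :
    MeasurePreserving (fun (w : Fin m × Fin d → ℝ) (i : Fin m) (j : Fin d) => w (i, j))
      (Measure.pi fun _ : Fin m × Fin d => gaussianReal 0 1) (gMat m d) := by
  refine ⟨by fun_prop, ?_⟩
  have h := Measure.infinitePi_map_curry
    (fun (_ : Fin m) (_ : Fin d) => gaussianReal (0 : ℝ) 1)
  simp only [Measure.infinitePi_eq_pi] at h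
  exact h

theorem measurePreserving_swap (m d : ℕ) :
    MeasurePreserving (fun (w : Fin m → Fin d → ℝ) (j : Fin d) (i : Fin m) => w i j)
      (gMat m d) (gMat d m) :=
  (measurePreserving_curry d m).comp ((measurePreserving_pi_comp (gaussianReal 0 1)
    (Prod.swap_injective (α := Fin d) (β := Fin m))).comp (measurePreserving_uncurry m d))

theorem measurePreserving_toLp (n : ℕ) :
    MeasurePreserving (WithLp.toLp 2) (gVec n) (stdGaussian (EuclideanSpace ℝ (Fin n))) :=
  ⟨by fun_prop, map_pi_eq_stdGaussian⟩

theorem measurePreserving_dotProduct {n : ℕ} {h : Fin n → ℝ} (hh : vnorm h = 1) :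
    MeasurePreserving (fun x => x ⬝ᵥ h) (gVec n) (gaussianReal 0 1) := by
  have h1 : MeasurePreserving (innerSL ℝ (WithLp.toLp 2 h))
      (stdGaussian (EuclideanSpace ℝ (Fin n))) (gaussianReal 0 1) := by
    refine ⟨by fun_prop, ?_⟩
    rw [IsGaussian.map_eq_gaussianReal, integral_strongDual_stdGaussian, variance_dual_stdGaussian,
      innerSL_apply_norm]
    rw [vnorm] at hh
    simp [hh]
  convert h1.comp (measurePreserving_toLp n) using 1
  funext x
  simp [EuclideanSpace.inner_toLp_toLp]

theorem vnorm_orthogonal_mulVec {n : ℕ} {O : Matrix (Fin n) (Fin n) ℝ} (hO : Oᵀ * O = 1)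
    (v : Fin n → ℝ) : vnorm (O *ᵥ v) = vnorm v := by
  refine (pow_left_inj₀ (vnorm_nonneg _) (vnorm_nonneg _) two_ne_zero).1 ?_
  rw [vnorm_sq, vnorm_sq, dotProduct_mulVec, ← mulVec_transpose, mulVec_mulVec, hO, one_mulVec]

theorem measurePreserving_orthogonal_mulVec {n : ℕ} {O : Matrix (Fin n) (Fin n) ℝ}
    (hO : Oᵀ * O = 1) : MeasurePreserving (fun x => O *ᵥ x) (gVec n) (gVec n) := by
  let li : EuclideanSpace ℝ (Fin n) →ₗᵢ[ℝ] EuclideanSpace ℝ (Fin n) :=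
    ⟨Matrix.toEuclideanLin O, fun x => vnorm_orthogonal_mulVec hO x.ofLp⟩
  let e := li.toLinearIsometryEquiv rfl
  have h1 : MeasurePreserving e (stdGaussian (EuclideanSpace ℝ (Fin n)))
      (stdGaussian (EuclideanSpace ℝ (Fin n))) := ⟨by fun_prop, stdGaussian_map e⟩
  have h2 : MeasurePreserving (WithLp.ofLp : EuclideanSpace ℝ (Fin n) → Fin n → ℝ)
      (stdGaussian (EuclideanSpace ℝ (Fin n))) (gVec n) :=
    (measurePreserving_toLp n).symm (MeasurableEquiv.toLp 2 (Fin n → ℝ))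
  exact h2.comp (h1.comp (measurePreserving_toLp n))

/-- The law of a Gaussian matrix is invariant under orthogonal transformations of the rows. -/
theorem measurePreserving_orthogonal_mul {m : ℕ} (d : ℕ) {O : Matrix (Fin m) (Fin m) ℝ}
    (hO : Oᵀ * O = 1) :
    MeasurePreserving (fun (w : Fin m → Fin d → ℝ) (i : Fin m) (j : Fin d) => (O * of w) i j)
      (gMat m d) (gMat m d) := by
  -- Left multiplication rotates each column separately, so it is carried out on the transposed
  -- array, whose independent rows are those columns.
  have h1 : MeasurePreserving (fun (w : Fin d → Fin m → ℝ) j => O *ᵥ w j) (gMat d m) (gMat d m) :=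
    measurePreserving_pi _ _ fun _ => measurePreserving_orthogonal_mulVec hO
  exact (measurePreserving_swap d m).comp (h1.comp (measurePreserving_swap m d))

theorem measurePreserving_inv_scale (m d : ℕ) {ε : ℝ} (hε : ε ≠ 0) :
    MeasurePreserving (fun (w : Fin m → Fin d → ℝ) i j => ε⁻¹ * w i j)
      (Measure.pi fun _ => Measure.pi fun _ => gaussianReal 0 (Real.toNNReal (ε ^ 2)))
      (gMat m d) := by
  have h1 : MeasurePreserving (fun x => ε⁻¹ * x) (gaussianReal 0 (Real.toNNReal (ε ^ 2)))
      (gaussianReal 0 1) := by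
    refine ⟨by fun_prop, ?_⟩
    rw [gaussianReal_map_const_mul, mul_zero]
    congr 1
    rw [← NNReal.coe_inj, NNReal.coe_mul, Real.coe_toNNReal _ (sq_nonneg ε), NNReal.coe_one,
      NNReal.coe_mk]
    field_simp
  exact measurePreserving_pi _ _ fun _ => measurePreserving_pi _ _ fun _ => h1

end GaussianMeasures

/-! ### One-dimensional Gaussian estimates. -/

section OneDimensional

/-- The density is at most `1/√(2π) ≤ 1/2`. Both the small-ball bound and the probability that a
Gaussian is not small come from this. -/
theorem gaussianReal_le_volume (s : Set ℝ) :
    gaussianReal 0 1 s ≤ ENNReal.ofReal (1 / 2) * volume s := by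
  rw [gaussianReal_apply 0 one_ne_zero]
  refine (lintegral_mono (g := fun _ => ENNReal.ofReal (1 / 2)) fun x => ?_).trans_eq (by simp)
  refine ENNReal.ofReal_le_ofReal ?_
  rw [gaussianPDFReal_def]
  have h1 : (√(2 * Real.pi * ((1 : NNReal) : ℝ)))⁻¹ ≤ 1 / 2 := by
    rw [← one_div]
    refine one_div_le_one_div_of_le two_pos (Real.le_sqrt_of_sq_le ?_)
    have := Real.pi_gt_three
    push_cast
    linarith
  have h2 : Real.exp (-(x - 0) ^ 2 / (2 * ((1 : NNReal) : ℝ))) ≤ 1 := by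
    rw [Real.exp_le_one_iff]
    push_cast
    have := sq_nonneg (x - 0)
    linarith
  calc _ ≤ 1 / 2 * (1 : ℝ) := mul_le_mul h1 h2 (Real.exp_pos _).le (by norm_num)
    _ = _ := by ring

theorem gaussianReal_small_ball (b s : ℝ) :
    gaussianReal 0 1 {x | |x + b| < s} ≤ ENNReal.ofReal s := by
  refine (gaussianReal_le_volume _).trans ?_
  have : {x : ℝ | |x + b| < s} = Metric.ball (-b) s := by
    ext x
    simp [Real.dist_eq]
  rw [this, Real.volume_ball, ← ENNReal.ofReal_mul (by norm_num)]
  exact (ENNReal.ofReal_le_ofReal (by linarith))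

theorem half_le_gaussianReal :
    ENNReal.ofReal (1 / 2) ≤ gaussianReal 0 1 {x | 1 / 2 < |x|} := by
  have h1 : gaussianReal 0 1 (Metric.closedBall (0 : ℝ) (1 / 2)) ≤ ENNReal.ofReal (1 / 2) := by
    refine (gaussianReal_le_volume _).trans ?_
    rw [Real.volume_closedBall, ← ENNReal.ofReal_mul (by norm_num)]
    norm_num
  have h2 : {x : ℝ | 1 / 2 < |x|} = (Metric.closedBall (0 : ℝ) (1 / 2))ᶜ := by
    ext x
    simp
  rw [h2, prob_compl_eq_one_sub Metric.isClosed_closedBall.measurableSet]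
  refine le_trans ?_ (tsub_le_tsub_left h1 1)
  rw [← ENNReal.ofReal_one, ← ENNReal.ofReal_sub _ (by norm_num)]
  exact ENNReal.ofReal_le_ofReal (by norm_num)

/-- The factor `exp(x²/4)` turns the density of variance `1` into `√2` times that of variance `2`;
the bound `2` is a convenient excess. -/
theorem lintegral_exp_sq_gaussianReal :
    ∫⁻ x, ENNReal.ofReal (Real.exp (x ^ 2 / 4)) ∂(gaussianReal 0 1) ≤ 2 := by
  rw [gaussianReal_of_var_ne_zero 0 one_ne_zero,
    lintegral_withDensity_eq_lintegral_mul _ (measurable_gaussianPDF 0 1) (by fun_prop)]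
  have h : ∀ x : ℝ, (gaussianPDF 0 1 * fun x => ENNReal.ofReal (Real.exp (x ^ 2 / 4))) x ≤
      2 * gaussianPDF 0 2 x := by
    intro x
    rw [Pi.mul_apply, gaussianPDF, gaussianPDF, ← ENNReal.ofReal_mul (gaussianPDFReal_nonneg _ _ _),
      show (2 : ℝ≥0∞) = ENNReal.ofReal 2 by simp, ← ENNReal.ofReal_mul (by norm_num)]
    refine ENNReal.ofReal_le_ofReal ?_
    rw [gaussianPDFReal_def, gaussianPDFReal_def]
    have e : Real.exp (-(x - 0) ^ 2 / (2 * ((1 : NNReal) : ℝ))) * Real.exp (x ^ 2 / 4) =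
        Real.exp (-(x - 0) ^ 2 / (2 * ((2 : NNReal) : ℝ))) := by
      rw [← Real.exp_add]
      congr 1
      push_cast
      ring
    rw [mul_assoc, e, ← mul_assoc]
    refine mul_le_mul_of_nonneg_right ?_ (Real.exp_pos _).le
    rw [← div_eq_mul_inv, ← one_div, div_le_div_iff₀ (by positivity) (by positivity), one_mul]
    refine Real.sqrt_le_iff.2 ⟨by positivity, ?_⟩
    rw [mul_pow, Real.sq_sqrt (by positivity)]
    have := Real.pi_pos
    push_cast
    linarith
  calc _ ≤ ∫⁻ x, 2 * gaussianPDF 0 2 x := lintegral_mono h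
    _ = 2 := by
      rw [lintegral_const_mul _ (measurable_gaussianPDF 0 2), lintegral_gaussianPDF_eq_one 0
        two_ne_zero, mul_one]

end OneDimensional

/-! ### Nets on the sphere. -/

section Net

/-- A maximal `1`-separated set on the sphere of radius `2` has at most `5^d` points, and maximality
makes it a `1`-net there. Halving it gives a `1/2`-net of the unit sphere. -/
theorem exists_net (d : ℕ) : ∃ s : Finset (Fin d → ℝ), s.card ≤ 5 ^ d ∧
    (∀ c ∈ s, vnorm c = 1) ∧ ∀ v, vnorm v = 1 → ∃ c ∈ s, vnorm (v - c) ≤ 1 / 2 := by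
  classical
  let E := EuclideanSpace ℝ (Fin d)
  let good : Finset E → Prop := fun s => (∀ c ∈ s, ‖c‖ = 2) ∧
    ∀ c ∈ s, ∀ c' ∈ s, c ≠ c' → 1 ≤ ‖c - c'‖
  have hcard : ∀ s, good s → s.card ≤ 5 ^ d := fun s hs => by
    have := Besicovitch.card_le_of_separated s (fun c hc => (hs.1 c hc).le) hs.2
    simpa [E] using this
  let Q : ℕ → Prop := fun k => ∃ s, good s ∧ s.card = k
  have hQ0 : Q 0 := ⟨∅, ⟨by simp, by simp⟩, rfl⟩
  -- The cardinality bound guarantees a separated set of greatest size; a point far from all of it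
  -- could be added.
  obtain ⟨s, hs, hsc⟩ : Q (Nat.findGreatest Q (5 ^ d)) :=
    Nat.findGreatest_spec (Nat.zero_le _) hQ0
  refine ⟨s.image fun c => (1 / 2 : ℝ) • c.ofLp, Finset.card_image_le.trans (hcard s hs), ?_, ?_⟩
  · intro c hc
    obtain ⟨c', hc', rfl⟩ := Finset.mem_image.1 hc
    rw [vnorm_smul, vnorm, WithLp.toLp_ofLp, hs.1 c' hc']
    norm_num
  · intro v hv
    by_contra hcon
    push Not at hcon
    set x : E := WithLp.toLp 2 ((2 : ℝ) • v)
    have hx : ‖x‖ = 2 := by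
      have := vnorm_smul 2 v
      rw [hv, abs_two, mul_one] at this
      exact this
    have hfar : ∀ c ∈ s, 1 < ‖x - c‖ := by
      intro c hc
      have h1 := hcon _ (Finset.mem_image_of_mem (fun c : E => (1 / 2 : ℝ) • c.ofLp) hc)
      have h2 : vnorm ((2 : ℝ) • (v - (1 / 2 : ℝ) • c.ofLp)) = ‖x - c‖ := by
        have e : (2 : ℝ) • (v - (1 / 2 : ℝ) • c.ofLp) = (2 : ℝ) • v - c.ofLp := by module
        rw [e]
        rfl
      rw [vnorm_smul, abs_two] at h2
      linarith
    have hxs : x ∉ s := fun h => by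
      have := hfar x h
      simp at this
      linarith
    have hgood : good (insert x s) := by
      refine ⟨?_, ?_⟩
      · intro c hc
        rcases Finset.mem_insert.1 hc with rfl | hc
        · exact hx
        · exact hs.1 c hc
      · intro c hc c' hc' hne
        rcases Finset.mem_insert.1 hc with rfl | hc <;>
          rcases Finset.mem_insert.1 hc' with rfl | hc'
        · exact absurd rfl hne
        · exact (hfar c' hc').le
        · rw [norm_sub_rev]; exact (hfar c hc).le
        · exact hs.2 c hc c' hc' hne
    have h3 : (insert x s).card = s.card + 1 := Finset.card_insert_of_notMem hxs
    have h4 := Nat.le_findGreatest (P := Q) (hcard _ hgood) ⟨_, hgood, rfl⟩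
    omega

/-- Replacing a unit vector by its nearest net point costs at most `‖M‖/2`, which is absorbed on the
left. -/
theorem norm_le_of_net {k d : ℕ} {s : Finset (Fin d → ℝ)}
    (hnet : ∀ v, vnorm v = 1 → ∃ c ∈ s, vnorm (v - c) ≤ 1 / 2) (M : Matrix (Fin k) (Fin d) ℝ)
    {r : ℝ} (hr : 0 ≤ r) (h : ∀ c ∈ s, vnorm (M *ᵥ c) ≤ r) : ‖M‖ ≤ 2 * r := by
  have h1 : ‖M‖ ≤ r + ‖M‖ / 2 := by
    refine norm_le_of_vnorm (by positivity) fun v => ?_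
    rcases (vnorm_nonneg v).eq_or_lt with h0 | h0
    · rw [vnorm_eq_zero.1 h0.symm]; simp [vnorm_zero]
    have hu : vnorm ((vnorm v)⁻¹ • v) = 1 := by
      rw [vnorm_smul, abs_of_pos (inv_pos.2 h0), inv_mul_cancel₀ h0.ne']
    obtain ⟨c, hc, hcv⟩ := hnet _ hu
    have e : M *ᵥ ((vnorm v)⁻¹ • v) = M *ᵥ c + M *ᵥ ((vnorm v)⁻¹ • v - c) := by
      rw [← mulVec_add, add_sub_cancel]
    have h2 : vnorm (M *ᵥ ((vnorm v)⁻¹ • v)) ≤ r + ‖M‖ / 2 := by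
      rw [e]
      refine (vnorm_add_le _ _).trans (add_le_add (h c hc) ?_)
      refine (vnorm_mulVec_le _ _).trans ?_
      have := mul_le_mul_of_nonneg_left hcv (norm_nonneg M)
      linarith
    rw [mulVec_smul, vnorm_smul, abs_of_pos (inv_pos.2 h0), inv_mul_le_iff₀ h0] at h2
    linarith
  linarith

end Net

/-! ### Operator norm of a Gaussian matrix. -/

section OperatorNormTail

theorem continuous_vnorm {n : ℕ} : Continuous (vnorm : (Fin n → ℝ) → ℝ) := by
  unfold vnorm
  fun_prop

/-- For unit `v` the coordinates of `w v` are independent standard Gaussians, so `exp(‖wv‖²/4)` has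
mean at most `2^k`; Markov's inequality does the rest. -/
theorem gMat_mulVec_tail {k d : ℕ} {v : Fin d → ℝ} (hv : vnorm v = 1) {r : ℝ} (hr : 0 ≤ r) :
    gMat k d {w | r < vnorm (of w *ᵥ v)} ≤ ENNReal.ofReal (2 ^ k * Real.exp (-(r ^ 2 / 4))) := by
  let f : (Fin d → ℝ) → ℝ≥0∞ := fun x => ENNReal.ofReal (Real.exp ((x ⬝ᵥ v) ^ 2 / 4))
  have hf : Measurable f := by
    have := (measurePreserving_dotProduct hv).measurable
    fun_prop
  have hint : ∫⁻ x, f x ∂(gVec d) ≤ 2 := by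
    have h1 := (measurePreserving_dotProduct hv).lintegral_comp
      (f := fun x => ENNReal.ofReal (Real.exp (x ^ 2 / 4))) (by fun_prop)
    rw [h1]
    exact lintegral_exp_sq_gaussianReal
  have hprod : ∫⁻ w, ∏ i, f (w i) ∂(gMat k d) ≤ 2 ^ k := by
    have h1 := lintegral_prod_eq_prod_lintegral_of_indepFun (μ := gMat k d) Finset.univ
      (fun i (w : Fin k → Fin d → ℝ) => f (w i))
      (iIndepFun_pi (μ := fun _ : Fin k => gVec d) (X := fun _ => f) fun _ => hf.aemeasurable)
      (fun i => hf.comp (measurable_pi_apply i))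
    rw [h1]
    have h2 : ∀ i : Fin k, ∫⁻ w : Fin k → Fin d → ℝ, f (w i) ∂(gMat k d) ≤ 2 := fun i => by
      have := (measurePreserving_eval (fun _ : Fin k => gVec d) i).lintegral_comp hf
      exact this.trans_le hint
    calc _ ≤ ∏ _i : Fin k, (2 : ℝ≥0∞) := Finset.prod_le_prod' fun i _ => h2 i
      _ = 2 ^ k := by simp
  have heq : ∀ w : Fin k → Fin d → ℝ,
      ∏ i, f (w i) = ENNReal.ofReal (Real.exp (vnorm (of w *ᵥ v) ^ 2 / 4)) := by
    intro w
    rw [← ENNReal.ofReal_prod_of_nonneg fun i _ => (Real.exp_pos _).le, ← Real.exp_sum,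
      ← Finset.sum_div, vnorm_sq]
    simp [dotProduct, mulVec, sq]
  simp only [heq] at hprod
  have hmeas : Measurable fun w : Fin k → Fin d → ℝ =>
      ENNReal.ofReal (Real.exp (vnorm (of w *ᵥ v) ^ 2 / 4)) := by
    simp only [← heq]
    fun_prop
  have hmk := mul_meas_ge_le_lintegral (μ := gMat k d) hmeas (ENNReal.ofReal (Real.exp (r ^ 2 / 4)))
  have hsub : {w : Fin k → Fin d → ℝ | r < vnorm (of w *ᵥ v)} ⊆
      {w | ENNReal.ofReal (Real.exp (r ^ 2 / 4)) ≤
        ENNReal.ofReal (Real.exp (vnorm (of w *ᵥ v) ^ 2 / 4))} := by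
    intro w hw
    have hw : r < vnorm (of w *ᵥ v) := hw
    refine ENNReal.ofReal_le_ofReal (Real.exp_le_exp.2 ?_)
    have := pow_le_pow_left₀ hr hw.le 2
    linarith
  have h3 := (mul_le_mul_right (measure_mono hsub) (ENNReal.ofReal (Real.exp (r ^ 2 / 4)))).trans
    (hmk.trans hprod)
  have h4 := mul_le_mul_right h3 (ENNReal.ofReal (Real.exp (-(r ^ 2 / 4))))
  rw [← mul_assoc, ← ENNReal.ofReal_mul (Real.exp_pos _).le, ← Real.exp_add, neg_add_cancel,
    Real.exp_zero, ENNReal.ofReal_one, one_mul] at h4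
  refine h4.trans_eq ?_
  rw [mul_comm (2 ^ k : ℝ), ENNReal.ofReal_mul (Real.exp_pos _).le, ENNReal.ofReal_pow two_pos.le]
  simp

theorem gMat_norm_tail (k d : ℕ) {r : ℝ} (hr : 0 ≤ r) :
    gMat k d {w | 2 * r < ‖(of w : Matrix (Fin k) (Fin d) ℝ)‖} ≤
      ENNReal.ofReal (5 ^ d * (2 ^ k * Real.exp (-(r ^ 2 / 4)))) := by
  obtain ⟨s, hcard, hs, hnet⟩ := exists_net d
  have hsub : {w : Fin k → Fin d → ℝ | 2 * r < ‖(of w : Matrix (Fin k) (Fin d) ℝ)‖} ⊆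
      ⋃ c ∈ s, {w | r < vnorm (of w *ᵥ c)} := by
    intro w hw
    by_contra hcon
    simp only [Set.mem_iUnion, Set.mem_ofPred_eq, not_exists, not_lt] at hcon
    exact absurd (norm_le_of_net hnet (of w) hr hcon) (not_le.2 hw)
  calc _ ≤ ∑ c ∈ s, gMat k d {w | r < vnorm (of w *ᵥ c)} :=
        (measure_mono hsub).trans (measure_biUnion_finset_le _ _)
    _ ≤ ∑ _c ∈ s, ENNReal.ofReal (2 ^ k * Real.exp (-(r ^ 2 / 4))) :=
        Finset.sum_le_sum fun c hc => gMat_mulVec_tail (hs c hc) hr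
    _ = s.card * ENNReal.ofReal (2 ^ k * Real.exp (-(r ^ 2 / 4))) := by simp
    _ ≤ ((5 ^ d : ℕ) : ℝ≥0∞) * ENNReal.ofReal (2 ^ k * Real.exp (-(r ^ 2 / 4))) := by gcongr
    _ = _ := by
        rw [ENNReal.ofReal_mul (by positivity), ENNReal.ofReal_pow (by norm_num)]
        simp

/-- The norm of a Gaussian matrix is, with high probability, of the order of the square root of
its larger dimension. -/
theorem gMat_norm_bound {δ : ℝ} (hδ : 0 < δ) : ∃ c : ℝ, 0 < c ∧ ∀ k d : ℕ, 0 < d →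
    gMat k d {w | c * √(max (k : ℝ) d) < ‖(of w : Matrix (Fin k) (Fin d) ℝ)‖} ≤
      ENNReal.ofReal δ := by
  set x := min δ 1
  have hx : 0 < x := lt_min hδ one_pos
  have hx1 : x ≤ 1 := min_le_right _ _
  -- Chosen so that `exp(-Kn/4) = (x/10)^n`, which cancels `5^d 2^k ≤ 10^n` and leaves `x^n ≤ x`.
  set K := 4 * Real.log (10 / x)
  have hK : 0 < K := mul_pos (by norm_num) (Real.log_pos (by rw [lt_div_iff₀ hx]; linarith))
  refine ⟨2 * √K, by positivity, fun k d hd => ?_⟩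
  have hr : 0 ≤ √K * √(max (k : ℝ) d) := by positivity
  have hmain := gMat_norm_tail k d hr
  rw [← mul_assoc] at hmain
  refine hmain.trans (ENNReal.ofReal_le_ofReal ?_)
  have hcast : max (k : ℝ) d = ((max k d : ℕ) : ℝ) := by push_cast; rfl
  rw [mul_pow, Real.sq_sqrt hK.le, Real.sq_sqrt (by positivity), hcast]
  set n := max k d
  have hexp : Real.exp (-(K * n / 4)) = (x / 10) ^ n := by
    have e : -(K * n / 4) = n * Real.log (x / 10) := by
      rw [← inv_div 10 x, Real.log_inv]
      simp only [K]
      ring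
    rw [e, Real.exp_nat_mul, Real.exp_log (by positivity)]
  rw [hexp]
  have h5 : (5 : ℝ) ^ d ≤ 5 ^ n := pow_le_pow_right₀ (by norm_num) (le_max_right k d)
  have h2 : (2 : ℝ) ^ k ≤ 2 ^ n := pow_le_pow_right₀ (by norm_num) (le_max_left k d)
  have hn : n ≠ 0 := by
    have := le_max_right k d
    omega
  calc (5 : ℝ) ^ d * (2 ^ k * (x / 10) ^ n) ≤ 5 ^ n * (2 ^ n * (x / 10) ^ n) := by gcongr
    _ = x ^ n := by rw [← mul_pow, ← mul_pow]; congr 1; ring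
    _ ≤ x := pow_le_of_le_one hx.le hx1 hn
    _ ≤ δ := min_le_left _ _

end OperatorNormTail

/-! ### Least singular value of a shifted Gaussian matrix. -/

section LeastSingularValue

theorem exists_unit_orthogonal {n : ℕ} (r : Fin n → Fin (n + 1) → ℝ) :
    ∃ h : Fin (n + 1) → ℝ, vnorm h = 1 ∧ ∀ i, r i ⬝ᵥ h = 0 := by
  have hker : LinearMap.ker (Matrix.mulVecLin (of r)) ≠ ⊥ :=
    LinearMap.ker_ne_bot_of_finrank_lt (by simp)
  obtain ⟨x, hx, hx0⟩ := Submodule.exists_mem_ne_zero_of_ne_bot hker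
  have hx : of r *ᵥ x = 0 := hx
  have hpos : 0 < vnorm x :=
    (vnorm_nonneg x).lt_of_ne fun h => hx0 (vnorm_eq_zero.1 h.symm)
  refine ⟨(vnorm x)⁻¹ • x, ?_, fun i => ?_⟩
  · rw [vnorm_smul, abs_of_pos (inv_pos.2 hpos), inv_mul_cancel₀ hpos.ne']
  · rw [dotProduct_smul]
    have : r i ⬝ᵥ x = 0 := congrFun hx i
    rw [this, smul_zero]

theorem exists_orthogonal_first_row {n : ℕ} {g : Fin (n + 1) → ℝ} (hg : vnorm g = 1) :
    ∃ O : Matrix (Fin (n + 1)) (Fin (n + 1)) ℝ, Oᵀ * O = 1 ∧ O 0 = g := by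
  have hon : Orthonormal ℝ (({0} : Set (Fin (n + 1))).domRestrict
      fun _ : Fin (n + 1) => (WithLp.toLp 2 g : EuclideanSpace ℝ (Fin (n + 1)))) := by
    refine ⟨fun _ => hg, fun i j hij => absurd (Subsingleton.elim i j) hij⟩
  obtain ⟨b, hb⟩ := hon.exists_orthonormalBasis_extension_of_card_eq (by simp)
  refine ⟨of fun i => (b i).ofLp, ?_, ?_⟩
  · rw [mul_eq_one_comm]
    ext i j
    have h1 := orthonormal_iff_ite.1 b.orthonormal j i
    rw [Matrix.mul_apply, one_apply]
    simp only [transpose_apply, of_apply]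
    rw [PiLp.inner_apply] at h1
    simp only [eq_comm (a := i)]
    simpa using h1
  · have := hb 0 rfl
    change (b 0).ofLp = g
    rw [this]

/-- The set of matrices `w` with `(w + M)ᵀ` small on some vector satisfying an open condition. -/
theorem isOpen_exists_vnorm_lt {X : Type*} [TopologicalSpace X] {a b : ℕ}
    {F : X → Matrix (Fin a) (Fin b) ℝ} (hF : Continuous F) (s : ℝ)
    {p : (Fin a → ℝ) → X → Prop} (hp : ∀ u, IsOpen {x | p u x}) :
    IsOpen {x | ∃ u, vnorm ((F x)ᵀ *ᵥ u) < s ∧ p u x} := by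
  have : {x | ∃ u, vnorm ((F x)ᵀ *ᵥ u) < s ∧ p u x} =
      ⋃ u, {x | vnorm ((F x)ᵀ *ᵥ u) < s} ∩ {x | p u x} := by
    ext x
    simp
  rw [this]
  -- The inequality is strict, so the set is open for each fixed `u`, and an arbitrary union of open
  -- sets is open. Measurability thus needs no measurable choice of `u`.
  refine isOpen_iUnion fun u => IsOpen.inter ?_ (hp u)
  refine isOpen_lt ?_ continuous_const
  exact continuous_vnorm.comp (hF.matrix_transpose.matrix_mulVec continuous_const)

theorem continuous_of_add {a b : ℕ} (M : Matrix (Fin a) (Fin b) ℝ) :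
    Continuous fun w : Fin a → Fin b → ℝ => of w + M :=
  continuous_id.add continuous_const

/-- The distance of a Gaussian row to the span of the other rows is rarely small. -/
theorem gMat_first_row_small {n : ℕ} (M : Matrix (Fin (n + 1)) (Fin (n + 1)) ℝ) (s : ℝ) :
    gMat (n + 1) (n + 1) {w | ∃ u, vnorm ((of w + M)ᵀ *ᵥ u) < s ∧ u 0 = 1} ≤
      ENNReal.ofReal s := by
  set E := {w : Fin (n + 1) → Fin (n + 1) → ℝ | ∃ u, vnorm ((of w + M)ᵀ *ᵥ u) < s ∧ u 0 = 1}
    with hE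
  have hEm : MeasurableSet E :=
    (isOpen_exists_vnorm_lt (continuous_of_add M) s
      (p := fun u _ => u 0 = 1) fun u => isOpen_const).measurableSet
  let e := MeasurableEquiv.piFinSuccAbove (fun _ : Fin (n + 1) => Fin (n + 1) → ℝ) 0
  have hmp : MeasurePreserving e.symm ((gVec (n + 1)).prod (gMat n (n + 1)))
      (gMat (n + 1) (n + 1)) :=
    (measurePreserving_piFinSuccAbove (fun _ : Fin (n + 1) => gVec (n + 1)) 0).symm
  rw [← hmp.measure_preimage hEm.nullMeasurableSet,
    Measure.prod_apply_symm (e.symm.measurable hEm)]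
  have hslice : ∀ y : Fin n → Fin (n + 1) → ℝ,
      gVec (n + 1) ((fun x => (x, y)) ⁻¹' (e.symm ⁻¹' E)) ≤ ENNReal.ofReal s := by
    intro y
    -- With all rows but the first frozen, a unit normal `h` to them reduces `(w + M)ᵀu` paired with
    -- `h` to the first row paired with `h`, because `u 0 = 1`. This is a shifted one-dimensional
    -- Gaussian.
    obtain ⟨h, hh, horth⟩ := exists_unit_orthogonal fun i => y i + M i.succ
    have hsub : (fun x => (x, y)) ⁻¹' (e.symm ⁻¹' E) ⊆
        (fun x => x ⬝ᵥ h) ⁻¹' {z | |z + M 0 ⬝ᵥ h| < s} := by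
      intro x hx
      obtain ⟨u, hu, hu0⟩ : ∃ u, vnorm ((of (e.symm (x, y)) + M)ᵀ *ᵥ u) < s ∧ u 0 = 1 := hx
      have e0 : e.symm (x, y) 0 = x := rfl
      have e1 : ∀ i : Fin n, e.symm (x, y) i.succ = y i := fun i => rfl
      have hdot : ((of (e.symm (x, y)) + M)ᵀ *ᵥ u) ⬝ᵥ h = x ⬝ᵥ h + M 0 ⬝ᵥ h := by
        rw [mulVec_transpose, ← dotProduct_mulVec, dotProduct, Fin.sum_univ_succ, hu0, one_mul]
        have hz : ∀ i : Fin n, ((of (e.symm (x, y)) + M) *ᵥ h) i.succ = 0 := fun i => horth i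
        simp only [hz, mul_zero, Finset.sum_const_zero, add_zero]
        exact add_dotProduct x (M 0) h
      change |x ⬝ᵥ h + M 0 ⬝ᵥ h| < s
      rw [← hdot]
      have := abs_dotProduct_le ((of (e.symm (x, y)) + M)ᵀ *ᵥ u) h
      rw [hh, mul_one] at this
      exact this.trans_lt hu
    refine (measure_mono hsub).trans ?_
    have hms : MeasurableSet {z : ℝ | |z + M 0 ⬝ᵥ h| < s} :=
      (isOpen_lt (by fun_prop) continuous_const).measurableSet
    rw [(measurePreserving_dotProduct hh).measure_preimage hms.nullMeasurableSet]
    exact gaussianReal_small_ball _ _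
  refine (lintegral_mono hslice).trans_eq ?_
  simp

/-- An orthogonal `O` with first row `g/‖g‖` makes `⟨u, g⟩/‖g‖` the first coordinate of `Ou`.
Rescaling that coordinate to `1` enlarges the threshold at most by the factor `2‖g‖`, and `Ow` has
the law of `w`; the shift `M` just becomes `OM`. -/
theorem gMat_direction_small {d : ℕ} (hd : 0 < d) (M : Matrix (Fin d) (Fin d) ℝ) {t : ℝ}
    (ht : 0 < t) (g : Fin d → ℝ) :
    gMat d d {w | ∃ u, vnorm ((of w + M)ᵀ *ᵥ u) < t ∧ 1 / 2 < |u ⬝ᵥ g|} ≤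
      ENNReal.ofReal (2 * t * vnorm g) := by
  obtain ⟨n, rfl⟩ : ∃ n, d = n + 1 := ⟨d - 1, by omega⟩
  rcases (vnorm_nonneg g).eq_or_lt with h0 | h0
  · have : {w : Fin (n + 1) → Fin (n + 1) → ℝ |
        ∃ u, vnorm ((of w + M)ᵀ *ᵥ u) < t ∧ 1 / 2 < |u ⬝ᵥ g|} = ∅ := by
      rw [vnorm_eq_zero.1 h0.symm]
      ext w
      simp
    rw [this]
    simp
  obtain ⟨O, hO, hO0⟩ := exists_orthogonal_first_row (g := (vnorm g)⁻¹ • g) (by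
    rw [vnorm_smul, abs_of_pos (inv_pos.2 h0), inv_mul_cancel₀ h0.ne'])
  have hmp := measurePreserving_orthogonal_mul (n + 1) hO
  have hEm : MeasurableSet {w : Fin (n + 1) → Fin (n + 1) → ℝ |
      ∃ u, vnorm ((of w + O * M)ᵀ *ᵥ u) < 2 * t * vnorm g ∧ u 0 = 1} :=
    (isOpen_exists_vnorm_lt (continuous_of_add (O * M)) _
      (p := fun u _ => u 0 = 1) fun u => isOpen_const).measurableSet
  refine le_trans (measure_mono ?_) ((hmp.measure_preimage hEm.nullMeasurableSet).trans_le
    (gMat_first_row_small (O * M) (2 * t * vnorm g)))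
  rintro w ⟨u, hu, hug⟩
  set y := (O *ᵥ u) 0 with hy
  have hyg : y = (vnorm g)⁻¹ * (u ⬝ᵥ g) := by
    have : y = O 0 ⬝ᵥ u := rfl
    rw [this, hO0, smul_dotProduct, smul_eq_mul, dotProduct_comm]
  have hyabs : 1 / (2 * vnorm g) < |y| := by
    rw [hyg, abs_mul, abs_of_pos (inv_pos.2 h0)]
    have := mul_lt_mul_of_pos_left hug (inv_pos.2 h0)
    calc 1 / (2 * vnorm g) = (vnorm g)⁻¹ * (1 / 2) := by field_simp
      _ < _ := this
  have hy0 : 0 < |y| := lt_trans (by positivity) hyabs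
  refine ⟨y⁻¹ • (O *ᵥ u), ?_, ?_⟩
  · have e : (of (fun i j => (O * of w) i j) + O * M)ᵀ *ᵥ (y⁻¹ • (O *ᵥ u)) =
        y⁻¹ • ((of w + M)ᵀ *ᵥ u) := by
      have e1 : (of (fun i j => (O * of w) i j) + O * M) = O * (of w + M) := by
        rw [Matrix.mul_add]
        rfl
      rw [e1, mulVec_smul, transpose_mul, mulVec_mulVec, Matrix.mul_assoc, hO, Matrix.mul_one]
    rw [e, vnorm_smul, abs_inv, inv_mul_lt_iff₀ hy0]
    have h2 : t ≤ |y| * (2 * t * vnorm g) := by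
      rw [div_lt_iff₀ (by positivity)] at hyabs
      nlinarith
    exact hu.trans_le h2
  · rw [Pi.smul_apply, smul_eq_mul, ← hy, inv_mul_cancel₀ (abs_pos.1 hy0)]

/-- Obtained from `‖g‖ ≤ √d + ‖g‖²/√d` and `x² ≤ 4 exp(x²/4)`, so the exponential moment already at
hand suffices: `√d + 8√d`. -/
theorem lintegral_vnorm_gVec {d : ℕ} (hd : 0 < d) :
    ∫⁻ g, ENNReal.ofReal (vnorm g) ∂(gVec d) ≤ ENNReal.ofReal (9 * √d) := by
  have hd' : (0 : ℝ) < d := by exact_mod_cast hd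
  have hsd : 0 < √(d : ℝ) := Real.sqrt_pos.2 hd'
  have hsd2 : √(d : ℝ) ^ 2 = d := Real.sq_sqrt hd'.le
  have hpt : ∀ g : Fin d → ℝ, ENNReal.ofReal (vnorm g) ≤ ENNReal.ofReal (√d) +
      ENNReal.ofReal (4 / √d) * ∑ i, ENNReal.ofReal (Real.exp (g i ^ 2 / 4)) := by
    intro g
    rw [← ENNReal.ofReal_sum_of_nonneg (fun i _ => (Real.exp_pos _).le),
      ← ENNReal.ofReal_mul (by positivity), ← ENNReal.ofReal_add (by positivity)
        (mul_nonneg (by positivity) (Finset.sum_nonneg fun i _ => (Real.exp_pos _).le))]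
    refine ENNReal.ofReal_le_ofReal ?_
    have h1 : vnorm g ≤ √d + vnorm g ^ 2 / √d := by
      rw [← sub_le_iff_le_add', le_div_iff₀ hsd]
      nlinarith [sq_nonneg (vnorm g - √d), vnorm_nonneg g]
    have h2 : vnorm g ^ 2 ≤ 4 * ∑ i, Real.exp (g i ^ 2 / 4) := by
      rw [vnorm_sq, dotProduct, Finset.mul_sum]
      refine Finset.sum_le_sum fun i _ => ?_
      have := Real.add_one_le_exp (g i ^ 2 / 4)
      nlinarith
    have h3 := div_le_div_of_nonneg_right h2 hsd.le
    calc vnorm g ≤ √d + vnorm g ^ 2 / √d := h1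
      _ ≤ √d + 4 * (∑ i, Real.exp (g i ^ 2 / 4)) / √d := by linarith
      _ = _ := by ring
  have hcoord : ∀ i : Fin d,
      ∫⁻ g : Fin d → ℝ, ENNReal.ofReal (Real.exp (g i ^ 2 / 4)) ∂(gVec d) ≤ 2 := fun i => by
    have := (measurePreserving_eval (fun _ : Fin d => gaussianReal 0 1) i).lintegral_comp
      (f := fun x => ENNReal.ofReal (Real.exp (x ^ 2 / 4))) (by fun_prop)
    exact this.trans_le lintegral_exp_sq_gaussianReal
  refine (lintegral_mono hpt).trans ?_
  rw [lintegral_add_left measurable_const, lintegral_const, measure_univ, mul_one,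
    lintegral_const_mul _ (by fun_prop), lintegral_finsetSum _ (fun i _ => by fun_prop)]
  have hsum : ∑ i : Fin d, ∫⁻ g : Fin d → ℝ, ENNReal.ofReal (Real.exp (g i ^ 2 / 4)) ∂(gVec d) ≤
      ENNReal.ofReal (2 * d) := by
    refine (Finset.sum_le_sum fun i _ => hcoord i).trans_eq ?_
    rw [ENNReal.ofReal_mul two_pos.le]
    simp [mul_comm]
  calc _ ≤ ENNReal.ofReal √d + ENNReal.ofReal (4 / √d) * ENNReal.ofReal (2 * d) := by gcongr
    _ = ENNReal.ofReal (√d + 4 / √d * (2 * d)) := by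
        rw [← ENNReal.ofReal_mul (by positivity), ← ENNReal.ofReal_add (by positivity)
          (by positivity)]
    _ = _ := by
        congr 1
        have : (d : ℝ) / √d = √d := Real.div_sqrt
        calc √(d : ℝ) + 4 / √d * (2 * d) = √d + 8 * (d / √d) := by ring
          _ = _ := by rw [this]; ring

/-- The least singular value of a shifted Gaussian matrix is rarely much smaller than the inverse
square root of the dimension. -/
theorem gMat_least_singVal {d : ℕ} (hd : 0 < d) (M : Matrix (Fin d) (Fin d) ℝ) {t : ℝ}
    (ht : 0 < t) :
    gMat d d {w | ∃ u, vnorm ((of w + M)ᵀ *ᵥ u) < t ∧ vnorm u = 1} ≤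
      ENNReal.ofReal (36 * t * √d) := by
  -- An independent Gaussian direction `g` is added, and the measure of `F` is computed in both
  -- orders: integrating over `w` first bounds it above, integrating over `g` first bounds it below.
  set F : Set ((Fin d → ℝ) × (Fin d → Fin d → ℝ)) :=
    {p | ∃ u, vnorm ((of p.2 + M)ᵀ *ᵥ u) < t ∧ (vnorm u = 1 ∧ 1 / 2 < |u ⬝ᵥ p.1|)} with hF
  have hFm : MeasurableSet F := by
    refine (isOpen_exists_vnorm_lt (F := fun p : (Fin d → ℝ) × (Fin d → Fin d → ℝ) => of p.2 + M)
      (p := fun u p => vnorm u = 1 ∧ 1 / 2 < |u ⬝ᵥ p.1|)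
      ((continuous_of_add M).comp continuous_snd) t fun u => ?_).measurableSet
    have h1 : IsOpen {p : (Fin d → ℝ) × (Fin d → Fin d → ℝ) | 1 / 2 < |u ⬝ᵥ p.1|} :=
      isOpen_lt continuous_const (Continuous.dotProduct continuous_const continuous_fst).abs
    exact isOpen_const.and h1
  have hupper : (gVec d).prod (gMat d d) F ≤ ENNReal.ofReal (18 * t * √d) := by
    rw [Measure.prod_apply hFm]
    have h1 : ∀ g, gMat d d (Prod.mk g ⁻¹' F) ≤
        ENNReal.ofReal (2 * t) * ENNReal.ofReal (vnorm g) := by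
      intro g
      rw [← ENNReal.ofReal_mul (by positivity)]
      refine le_trans (measure_mono ?_) (gMat_direction_small hd M ht g)
      rintro w ⟨u, hu, -, hug⟩
      exact ⟨u, hu, hug⟩
    refine (lintegral_mono h1).trans ?_
    rw [lintegral_const_mul _ (continuous_vnorm.measurable.ennreal_ofReal)]
    refine (mul_le_mul_right (lintegral_vnorm_gVec hd) _).trans_eq ?_
    rw [← ENNReal.ofReal_mul (by positivity)]
    congr 1
    ring
  set Bad := {w : Fin d → Fin d → ℝ | ∃ u, vnorm ((of w + M)ᵀ *ᵥ u) < t ∧ vnorm u = 1} with hBad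
  have hBm : MeasurableSet Bad :=
    (isOpen_exists_vnorm_lt (continuous_of_add M) t
      (p := fun u _ => vnorm u = 1) fun u => isOpen_const).measurableSet
  -- For a bad `w` any witnessing unit `u` will do: `⟨u, g⟩` is standard Gaussian and exceeds `1/2`
  -- in absolute value with probability at least `1/2`. A union bound over coordinate directions
  -- would lose a power of `d`.
  have hlower : ENNReal.ofReal (1 / 2) * gMat d d Bad ≤ (gVec d).prod (gMat d d) F := by
    rw [Measure.prod_apply_symm hFm, ← lintegral_indicator_const hBm]
    refine lintegral_mono fun w => ?_
    by_cases hw : w ∈ Bad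
    · rw [Set.indicator_of_mem hw]
      obtain ⟨u, hu, hu1⟩ := hw
      have hms : MeasurableSet {x : ℝ | 1 / 2 < |x|} :=
        (isOpen_lt continuous_const continuous_abs).measurableSet
      refine half_le_gaussianReal.trans ?_
      rw [← (measurePreserving_dotProduct hu1).measure_preimage hms.nullMeasurableSet]
      refine measure_mono fun g hg => ⟨u, hu, hu1, ?_⟩
      rw [dotProduct_comm]
      exact hg
    · rw [Set.indicator_of_notMem hw]
      exact zero_le
  have h3 := mul_le_mul_right (hlower.trans hupper) (ENNReal.ofReal 2)
  rw [← mul_assoc, ← ENNReal.ofReal_mul two_pos.le, ← ENNReal.ofReal_mul two_pos.le] at h3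
  rw [show (2 : ℝ) * (1 / 2) = 1 by norm_num, ENNReal.ofReal_one, one_mul] at h3
  refine h3.trans_eq ?_
  congr 1
  ring

end LeastSingularValue

/-! ### Gaussian initializations obey the bounds. -/

section GaussianInitialization

variable {d m' n' : ℕ}

theorem initBound_of_norm_le {c c₀ ε : ℝ} (hd : 0 < d) (hc₀ : c₀ ≤ c) (hε : 0 < ε)
    {X : Matrix (Fin (d + m')) (Fin d) ℝ} {Y : Matrix (Fin (d + n')) (Fin d) ℝ}
    (hU : ‖upper X‖ ≤ c₀ * √(max (d : ℝ) d)) (hJ : ‖lower X‖ ≤ c₀ * √(max (m' : ℝ) d))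
    (hV : ‖upper Y‖ ≤ c₀ * √(max (d : ℝ) d)) (hK : ‖lower Y‖ ≤ c₀ * √(max (n' : ℝ) d))
    (hmin : ∀ u, vnorm u = 1 → 2 / (c * √d) ≤ vnorm ((upper X + upper Y)ᵀ *ᵥ u)) :
    InitBound c ε (ε • X) (ε • Y) := by
  rw [max_self] at hU hV
  have hdn : 0 < √(d : ℝ) := Real.sqrt_pos.2 (by exact_mod_cast hd)
  have hd2 : √(d : ℝ) * √d = d := Real.mul_self_sqrt (by positivity)
  have hA : symA (ε • X) (ε • Y) = (ε / 2) • (upper X + upper Y) := by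
    rw [symA, upper_smul, upper_smul]
    module
  have hB : asymB (ε • X) (ε • Y) = (ε / 2) • (upper X - upper Y) := by
    rw [asymB, upper_smul, upper_smul]
    module
  have hhalf : ‖ε / 2‖ = ε / 2 := Real.norm_of_nonneg (by positivity)
  have hmono : ∀ x : ℝ, 0 ≤ x → c₀ * x ≤ c * x := fun x hx => mul_le_mul_of_nonneg_right hc₀ hx
  have hAn : ‖symA (ε • X) (ε • Y)‖ ≤ c * √d * ε := by
    rw [hA, norm_smul, hhalf]
    have h1 := norm_add_le (upper X) (upper Y)
    have h2 : ‖upper X + upper Y‖ ≤ 2 * (c * √d) := by linarith [hmono _ hdn.le]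
    have := mul_le_mul_of_nonneg_left h2 (show 0 ≤ ε / 2 by positivity)
    linarith
  have hBn : ‖asymB (ε • X) (ε • Y)‖ ≤ c * √d * ε := by
    rw [hB, norm_smul, hhalf]
    have h1 := norm_sub_le (upper X) (upper Y)
    have h2 : ‖upper X - upper Y‖ ≤ 2 * (c * √d) := by linarith [hmono _ hdn.le]
    have := mul_le_mul_of_nonneg_left h2 (show 0 ≤ ε / 2 by positivity)
    linarith
  have hlow : ∀ {k : ℕ} (Z : Matrix (Fin (d + k)) (Fin d) ℝ),
      ‖lower Z‖ ≤ c₀ * √(max (k : ℝ) d) →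
      ‖lower (ε • Z)‖ ≤ c * ε * √(max (k : ℝ) d) := by
    intro k Z hZ
    rw [lower_smul, norm_smul, Real.norm_of_nonneg hε.le]
    have := mul_le_mul_of_nonneg_left
      (hZ.trans (hmono _ (Real.sqrt_nonneg (max (k : ℝ) d)))) hε.le
    linarith
  refine ⟨?_, ?_, ?_, hlow X hJ, hlow Y hK⟩
  · rw [le_singVal_iff hd]
    intro v
    have key : ∀ u, ε / (c * √d) * vnorm u ≤ vnorm ((symA (ε • X) (ε • Y))ᵀ *ᵥ u) := by
      intro u
      rcases (vnorm_nonneg u).eq_or_lt with h0 | h0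
      · rw [← h0, mul_zero]
        exact vnorm_nonneg _
      have h1 := hmin ((vnorm u)⁻¹ • u) (by
        rw [vnorm_smul, abs_of_pos (inv_pos.2 h0), inv_mul_cancel₀ h0.ne'])
      rw [mulVec_smul, vnorm_smul, abs_of_pos (inv_pos.2 h0), le_inv_mul_iff₀ h0] at h1
      rw [hA, transpose_smul, smul_mulVec, vnorm_smul, abs_of_nonneg (by positivity)]
      have := mul_le_mul_of_nonneg_left h1 (show 0 ≤ ε / 2 by positivity)
      refine le_trans (le_of_eq ?_) this
      ring
    have := lower_bound_transpose key v
    rwa [transpose_transpose] at this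
  · rwa [singVal_one_eq_norm hd]
  · refine (frobNorm_le_sqrt_mul_norm _).trans ?_
    have := mul_le_mul_of_nonneg_left hBn hdn.le
    calc _ ≤ √d * (c * √d * ε) := this
      _ = c * (√d * √d) * ε := by ring
      _ = _ := by rw [hd2]

theorem continuous_upper_of {k : ℕ} :
    Continuous fun w : Fin (d + k) → Fin d → ℝ => upper (of w) :=
  continuous_id.matrix_submatrix _ _

theorem continuous_norm_of (k l : ℕ) :
    Continuous fun w : Fin k → Fin l → ℝ => ‖(of w : Matrix (Fin k) (Fin l) ℝ)‖ :=
  continuous_norm (E := Matrix (Fin k) (Fin l) ℝ)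

theorem measurableSet_lt_norm (k l : ℕ) (r : ℝ) :
    MeasurableSet {w : Fin k → Fin l → ℝ | r < ‖(of w : Matrix (Fin k) (Fin l) ℝ)‖} :=
  (isOpen_lt continuous_const (continuous_norm_of k l)).measurableSet

theorem measurableSet_upper_sum_least (s : ℝ) :
    MeasurableSet {w : (Fin (d + m') → Fin d → ℝ) × (Fin (d + n') → Fin d → ℝ) |
      ∃ u, vnorm ((upper (of w.1) + upper (of w.2))ᵀ *ᵥ u) < s ∧ vnorm u = 1} := by
  have h : Continuous fun w : (Fin (d + m') → Fin d → ℝ) × (Fin (d + n') → Fin d → ℝ) =>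
      upper (of w.1) + upper (of w.2) :=
    (continuous_upper_of.comp continuous_fst).add (continuous_upper_of.comp continuous_snd)
  exact (isOpen_exists_vnorm_lt h s (p := fun u _ => vnorm u = 1)
    fun u => isOpen_const).measurableSet

theorem gMat_upper_tail (k : ℕ) (r : ℝ) :
    gMat (d + k) d {w | r < ‖upper (of w)‖} =
      gMat d d {w | r < ‖(of w : Matrix (Fin d) (Fin d) ℝ)‖} :=
  (measurePreserving_upper d k).measure_preimage (measurableSet_lt_norm d d r).nullMeasurableSet

theorem gMat_lower_tail (k : ℕ) (r : ℝ) :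
    gMat (d + k) d {w | r < ‖lower (of w)‖} =
      gMat k d {w | r < ‖(of w : Matrix (Fin k) (Fin d) ℝ)‖} :=
  (measurePreserving_lower d k).measure_preimage (measurableSet_lt_norm k d r).nullMeasurableSet

/-- With the second factor frozen, its upper block is a deterministic shift, and the bound for
shifted Gaussian matrices is uniform in the shift. -/
theorem gMat_upper_sum_least (hd : 0 < d) {t : ℝ} (ht : 0 < t) :
    (gMat (d + m') d).prod (gMat (d + n') d)
      {w | ∃ u, vnorm ((upper (of w.1) + upper (of w.2))ᵀ *ᵥ u) < t ∧ vnorm u = 1} ≤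
      ENNReal.ofReal (36 * t * √d) := by
  rw [Measure.prod_apply_symm (measurableSet_upper_sum_least t)]
  refine (lintegral_mono (g := fun _ => ENNReal.ofReal (36 * t * √d)) fun w₂ => ?_).trans_eq
    (by simp)
  have hm2 : MeasurableSet {w : Fin d → Fin d → ℝ |
      ∃ u, vnorm ((of w + upper (of w₂))ᵀ *ᵥ u) < t ∧ vnorm u = 1} :=
    (isOpen_exists_vnorm_lt (continuous_of_add (upper (of w₂))) t
      (p := fun u _ => vnorm u = 1) fun u => isOpen_const).measurableSet
  exact ((measurePreserving_upper d m').measure_preimage hm2.nullMeasurableSet).trans_le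
    (gMat_least_singVal hd (upper (of w₂)) ht)

/-- A Gaussian initialization obeys the bounds with high probability. -/
theorem gaussianInit_bound (δ : ℝ) (hδ : 0 < δ) : ∃ c : ℝ, 0 < c ∧
    ∀ (d m' n' : ℕ) (_ : 0 < d)
      (Φ : Matrix (Fin (d + m')) (Fin (d + m')) ℝ)
      (Ψ : Matrix (Fin (d + n')) (Fin (d + n')) ℝ)
      (_ : Φ ∈ Matrix.orthogonalGroup (Fin (d + m')) ℝ)
      (_ : Ψ ∈ Matrix.orthogonalGroup (Fin (d + n')) ℝ)
      (ε : ℝ) (_ : 0 < ε),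
      gaussianInit (d + m') (d + n') d ε
        {w | ¬ InitBound c ε (Φ.transpose * Matrix.of w.1) (Ψ.transpose * Matrix.of w.2)}
        ≤ ENNReal.ofReal δ := by
  obtain ⟨c₀, hc₀, hnorm⟩ := gMat_norm_bound (show 0 < δ / 5 by positivity)
  have hc : 0 < max c₀ (360 / δ) := lt_max_of_lt_left hc₀
  -- The threshold `2/(c√d)` for `U + V` has failure probability at most `36 · 2/c = 72/c`, so `c ≥
  -- 360/δ` makes it at most `δ/5`, the share of each of the five events.
  refine ⟨max c₀ (360 / δ), hc, fun d m' n' hd Φ Ψ hΦ hΨ ε hε => ?_⟩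
  set c := max c₀ (360 / δ) with hcdef
  have hΦ' : Φᵀᵀ * Φᵀ = 1 := by
    rw [transpose_transpose]
    exact (mem_orthogonalGroup_iff _ _).1 hΦ
  have hΨ' : Ψᵀᵀ * Ψᵀ = 1 := by
    rw [transpose_transpose]
    exact (mem_orthogonalGroup_iff _ _).1 hΨ
  have hdn : 0 < √(d : ℝ) := Real.sqrt_pos.2 (by exact_mod_cast hd)
  have ht : 0 < 2 / (c * √d) := by positivity
  -- Normalization to variance one followed by the change to singular coordinates; it carries the
  -- initialization to a pair of independent standard Gaussian matrices.
  let R := fun (w : (Fin (d + m') → Fin d → ℝ) × (Fin (d + n') → Fin d → ℝ)) =>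
    ((fun i j => (Φᵀ * of (fun i j => ε⁻¹ * w.1 i j)) i j,
      fun i j => (Ψᵀ * of (fun i j => ε⁻¹ * w.2 i j)) i j) :
      (Fin (d + m') → Fin d → ℝ) × (Fin (d + n') → Fin d → ℝ))
  have hR : MeasurePreserving R (gaussianInit (d + m') (d + n') d ε)
      ((gMat (d + m') d).prod (gMat (d + n') d)) :=
    ((measurePreserving_orthogonal_mul d hΦ').comp
      (measurePreserving_inv_scale (d + m') d hε.ne')).prod
      ((measurePreserving_orthogonal_mul d hΨ').comp
        (measurePreserving_inv_scale (d + n') d hε.ne'))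
  let E₁ := {w : Fin (d + m') → Fin d → ℝ | c₀ * √(max (d : ℝ) d) < ‖upper (of w)‖}
  let E₂ := {w : Fin (d + m') → Fin d → ℝ | c₀ * √(max (m' : ℝ) d) < ‖lower (of w)‖}
  let E₃ := {w : Fin (d + n') → Fin d → ℝ | c₀ * √(max (d : ℝ) d) < ‖upper (of w)‖}
  let E₄ := {w : Fin (d + n') → Fin d → ℝ | c₀ * √(max (n' : ℝ) d) < ‖lower (of w)‖}
  let E₅ := {w : (Fin (d + m') → Fin d → ℝ) × (Fin (d + n') → Fin d → ℝ) |
    ∃ u, vnorm ((upper (of w.1) + upper (of w.2))ᵀ *ᵥ u) < 2 / (c * √d) ∧ vnorm u = 1}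
  have m1 : MeasurableSet E₁ := (measurePreserving_upper d m').measurable
    (measurableSet_lt_norm d d _)
  have m2 : MeasurableSet E₂ := (measurePreserving_lower d m').measurable
    (measurableSet_lt_norm m' d _)
  have m3 : MeasurableSet E₃ := (measurePreserving_upper d n').measurable
    (measurableSet_lt_norm d d _)
  have m4 : MeasurableSet E₄ := (measurePreserving_lower d n').measurable
    (measurableSet_lt_norm n' d _)
  have m5 : MeasurableSet E₅ := measurableSet_upper_sum_least _
  let N := Prod.fst ⁻¹' E₁ ∪ (Prod.fst ⁻¹' E₂ ∪ (Prod.snd ⁻¹' E₃ ∪ (Prod.snd ⁻¹' E₄ ∪ E₅)))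
  have hNm : MeasurableSet N := (measurable_fst m1).union ((measurable_fst m2).union
    ((measurable_snd m3).union ((measurable_snd m4).union m5)))
  have hsub : {w : (Fin (d + m') → Fin d → ℝ) × (Fin (d + n') → Fin d → ℝ) |
      ¬ InitBound c ε (Φᵀ * of w.1) (Ψᵀ * of w.2)} ⊆ R ⁻¹' N := by
    intro w hw
    by_contra hcon
    refine hw ?_
    have hcon : R w ∉ N := hcon
    simp only [N, Set.mem_union, not_or, Set.mem_preimage] at hcon
    obtain ⟨h1, h2, h3, h4, h5⟩ := hcon
    have hscale : ∀ {k : ℕ} (O : Matrix (Fin k) (Fin k) ℝ) (x : Fin k → Fin d → ℝ),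
        ε • (of (fun i j => (O * of (fun i j => ε⁻¹ * x i j)) i j) : Matrix (Fin k) (Fin d) ℝ) =
          O * of x := by
      intro k O x
      have e : (of (fun i j => ε⁻¹ * x i j) : Matrix (Fin k) (Fin d) ℝ) = ε⁻¹ • of x := rfl
      rw [e, Matrix.mul_smul]
      change ε • ε⁻¹ • (O * of x) = O * of x
      rw [smul_inv_smul₀ hε.ne']
    have := initBound_of_norm_le (c := c) (ε := ε) hd (le_max_left _ _) hε
      (X := of (R w).1) (Y := of (R w).2) (not_lt.1 h1) (not_lt.1 h2) (not_lt.1 h3) (not_lt.1 h4)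
      (fun u hu => not_lt.1 fun hlt => h5 ⟨u, hlt, hu⟩)
    rwa [hscale, hscale] at this
  refine (measure_mono hsub).trans ?_
  rw [hR.measure_preimage hNm.nullMeasurableSet]
  set P := (gMat (d + m') d).prod (gMat (d + n') d)
  have p1 : P (Prod.fst ⁻¹' E₁) ≤ ENNReal.ofReal (δ / 5) := by
    rw [measurePreserving_fst.measure_preimage m1.nullMeasurableSet]
    exact (gMat_upper_tail m' _).trans_le (hnorm d d hd)
  have p2 : P (Prod.fst ⁻¹' E₂) ≤ ENNReal.ofReal (δ / 5) := by
    rw [measurePreserving_fst.measure_preimage m2.nullMeasurableSet]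
    exact (gMat_lower_tail m' _).trans_le (hnorm m' d hd)
  have p3 : P (Prod.snd ⁻¹' E₃) ≤ ENNReal.ofReal (δ / 5) := by
    rw [measurePreserving_snd.measure_preimage m3.nullMeasurableSet]
    exact (gMat_upper_tail n' _).trans_le (hnorm d d hd)
  have p4 : P (Prod.snd ⁻¹' E₄) ≤ ENNReal.ofReal (δ / 5) := by
    rw [measurePreserving_snd.measure_preimage m4.nullMeasurableSet]
    exact (gMat_lower_tail n' _).trans_le (hnorm n' d hd)
  have p5 : P E₅ ≤ ENNReal.ofReal (δ / 5) := by
    refine (gMat_upper_sum_least hd ht).trans (ENNReal.ofReal_le_ofReal ?_)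
    have e : 36 * (2 / (c * √d)) * √d = 72 / c := by
      field_simp
      norm_num
    rw [e, div_le_iff₀ hc]
    have h1 : 360 / δ ≤ c := le_max_right _ _
    rw [div_le_iff₀ hδ] at h1
    linarith
  calc P N ≤ P (Prod.fst ⁻¹' E₁) + (P (Prod.fst ⁻¹' E₂) + (P (Prod.snd ⁻¹' E₃) +
        (P (Prod.snd ⁻¹' E₄) + P E₅))) :=
        (measure_union_le _ _).trans (add_le_add_right ((measure_union_le _ _).trans
          (add_le_add_right ((measure_union_le _ _).trans
            (add_le_add_right (measure_union_le _ _) _)) _)) _)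
    _ ≤ ENNReal.ofReal (δ / 5) + (ENNReal.ofReal (δ / 5) + (ENNReal.ofReal (δ / 5) +
        (ENNReal.ofReal (δ / 5) + ENNReal.ofReal (δ / 5)))) :=
        add_le_add p1 (add_le_add p2 (add_le_add p3 (add_le_add p4 p5)))
    _ = ENNReal.ofReal δ := by
        have h5 : 0 ≤ δ / 5 := by positivity
        rw [← ENNReal.ofReal_add h5 h5, ← ENNReal.ofReal_add h5 (by positivity),
          ← ENNReal.ofReal_add h5 (by positivity), ← ENNReal.ofReal_add h5 (by positivity)]
        congr 1
        ring

end GaussianInitialization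

end LowRankGD

end

/-! ### The theorem. -/

open LowRankGD in
theorem theorem2 :
    -- Stage one of gradient descent, from every initialization that obeys the bounds with `c`.
    (∃ p : ℕ, ∀ c : ℝ, 0 < c → ∃ k₁ k₂ C : ℝ, 0 < k₁ ∧ 0 < k₂ ∧ 0 < C ∧
      ∀ (d m' n' : ℕ) (hd : 0 < d)
        (S : Matrix (Fin (d + m')) (Fin (d + n')) ℝ) (σ : Fin d → ℝ)
        (Φ : Matrix (Fin (d + m')) (Fin (d + m')) ℝ)
        (Ψ : Matrix (Fin (d + n')) (Fin (d + n')) ℝ) (_ : IsSVD S σ Φ Ψ)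
        (m n σ₁ σd ε η : ℝ)
        (_ : m = d + m') (_ : n = d + n')
        (_ : σ₁ = σ ⟨0, hd⟩) (_ : σd = σ ⟨d - 1, Nat.sub_lt hd one_pos⟩)
        (_ : 0 < ε)
        (_ : ε ≤ k₁ * (σd / (√((d : ℝ) ^ 3 * σ₁) * (m + n)))
          / (1 + Real.log ((m + n) * (σ₁ / σd))) ^ p)
        (_ : 0 < η) (_ : η ≤ k₂ * (σd * ε ^ 2 / (d * σ₁ ^ 3))),
        ∃ T₀ : ℕ, (T₀ : ℝ) ≤ C * (1 / (η * σd) * Real.log (d * σd / ε ^ 2)) ∧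
          ∀ (U₀ : Matrix (Fin (d + m')) (Fin d) ℝ) (V₀ : Matrix (Fin (d + n')) (Fin d) ℝ)
            (X : ℕ → Matrix (Fin (d + m')) (Fin d) ℝ)
            (Y : ℕ → Matrix (Fin (d + n')) (Fin d) ℝ),
            (∀ t, X t = Φ.transpose * (gd S η U₀ V₀ t).1) →
            (∀ t, Y t = Ψ.transpose * (gd S η U₀ V₀ t).2) →
            InitBound c ε (X 0) (Y 0) →
            (∀ t ≤ T₀,
              Loewner ((ε ^ 2 / (c ^ 2 * d)) • (1 : Matrix (Fin d) (Fin d) ℝ))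
                (symA (X t) (Y t) * (symA (X t) (Y t)).transpose) ∧
              Loewner (symA (X t) (Y t) * (symA (X t) (Y t)).transpose)
                ((2 : ℝ) • Matrix.diagonal σ) ∧
              frobNorm (asymB (X t) (Y t)) ≤ 2 * c * d * ε ∧
              opNorm (lower (X t)) ≤ c * ε * √(max (m' : ℝ) d) ∧
              opNorm (lower (Y t)) ≤ c * ε * √(max (n' : ℝ) d)) ∧
            √(σd / 2) ≤ singVal d (symA (X T₀) (Y T₀)) ∧
            singVal 1 (errP σ (X T₀) (Y T₀)) ≤ σd / 4) ∧
    -- A Gaussian initialization obeys these bounds with high probability.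
    (∀ δ : ℝ, 0 < δ → ∃ c : ℝ, 0 < c ∧
      ∀ (d m' n' : ℕ) (_ : 0 < d)
        (Φ : Matrix (Fin (d + m')) (Fin (d + m')) ℝ)
        (Ψ : Matrix (Fin (d + n')) (Fin (d + n')) ℝ)
        (_ : Φ ∈ Matrix.orthogonalGroup (Fin (d + m')) ℝ)
        (_ : Ψ ∈ Matrix.orthogonalGroup (Fin (d + n')) ℝ)
        (ε : ℝ) (_ : 0 < ε),
        gaussianInit (d + m') (d + n') d ε
          {w | ¬ InitBound c ε (Φ.transpose * Matrix.of w.1) (Ψ.transpose * Matrix.of w.2)}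
          ≤ ENNReal.ofReal δ) := by
  -- A single power of the logarithm suffices: `p = 1`.
  exact ⟨⟨1, fun c hc => warm_up_stage c hc⟩, fun δ hδ => gaussianInit_bound δ hδ⟩
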